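/- Let $k\ge 2$ and let $\mathbb T^k$ be the infinite rooted $k$-ary tree; let $\mathbb T^k_L$ be the finite tree formed by its vertices at distance at most $L$ from the root. For $p\in(0,1)$ the OFA-$k$f process on a finite set $\mathbb T$ of vertices is the continuous-time Markov chain on $\{0,1\}^{\mathbb T}$ with generator $$\mathcal L_{\mathbb T}f(\eta)=\sum_{x\in\mathbb T}c_{\mathbb T,x}(\eta)\,[\mu_x(f)(\eta)-f(\eta)],$$ where $\mu_x(f)$ is the average of $f$ when $\eta_x$ is resampled from the Bernoulli($p$) law, and $c_{\mathbb T,x}(\eta)=1$ if all children of $x$ that lie in $\mathbb T$ are empty (have spin $0$) and $c_{\mathbb T,x}(\eta)=0$ otherwise. It is reversible with respect to the Bernoulli($p$) product measure $\mu_{\mathbb T}$. Let $T_{\rm rel}(\mathbb T)$ be its relaxation time, i.e. the inverse of $\inf_f \mu_{\mathbb T}(f(-\mathcal L_{\mathbb T}f))/\mathrm{Var}_{\mathbb T}(f)$ over non-constant $f$. Let $h^\eta_t$ be the density with respect to $\mu_{\mathbb T}$ of the law at time $t$ of the chain started from $\eta$, and for $a\ge1$ put $$T_a(\mathbb T)=\inf\{t\ge0:\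 \max_\eta \mu_{\mathbb T}(|h^\eta_t-1|^a)^{1/a}\le 1/4\}$$ ($T_1$ is the mixing time $T_{\rm mix}$). Let $\mathcal L$ be the generator of the process on the infinite tree, namely the $L^2(\mu)$-closure, $\mu$ being the Bernoulli($p$) product measure, of the operator $f\mapsto\sum_{x\in\mathbb T^k}c_x[\mu_x(f)-f]$ on functions of finitely many spins, with $c_x=1$ if all $k$ children of $x$ are empty and $c_x=0$ otherwise; and let $$p_c=\sup\{p\in[0,1):\ 0 \text{ is a simple eigenvalue of } \mathcal L\}.$$ Then there are constants $\alpha,\beta\ge0$, independent of $k$, $p$ and $L$, such that for every $k\ge2$ the following hold. **Comparison.** For every $\delta>0$ there is $c=c(k,\delta)>0$ such that for all $p\in[\delta,1-\delta]$ and all integers $L\ge1$, $$\frac1c\,L\,T_{\rm rel}(\mathbb T^k_{\lfloor L/2\rfloor})\le T_1(\mathbb T^k_L)\le T_2(\mathbb T^k_L)\le c\,L\,T_{\rm rel}(\mathbb T^k_L).$$ **(i)** If $p=p_c$, there is $c=c(k)>0$ such that for all $L\ge1$, $$c^{-1}L^3\le T_1(\mathbb T^k_L)\le c\,L^{3+\beta}.$$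 **(ii)** For every $p\in(0,p_c)$ there is $c=c(k,p)>0$ such that for all $L\ge1$, $$\frac1c(p_c-p)^{-2}L\le T_1(\mathbb T^k_L)\le c\,L\,(p_c-p)^{-(2+\alpha)}.$$ Moreover, for every $\delta>0$ there is $c=c(k,\delta)>0$ such that for all $p\in[\delta,p_c)$ the upper bound holds with this $c$ for all $L\ge1$, and the lower bound holds with this $c$ for all $L\ge1$ with $L\ge (p_c-p)^{-1}$. -/

import Mathlib

open MeasureTheory ProbabilityTheory Filter Topology

namespace OFA

noncomputable section

/-- Vertices of the infinite rooted `k`-ary tree. The root is `[]`, the `k` children of `x` are the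
lists `i :: x` with `i : Fin k`, and the depth of `x` is its length. -/
abbrev Vertex (k : ℕ) : Type := List (Fin k)

/-- The vertex set of the finite `k`-ary tree of depth `L`: all vertices of depth at most `L`. -/
def tree (k L : ℕ) : Finset (Vertex k) :=
  (List.finite_length_le (Fin k) L).toFinset

/-- Single-site Bernoulli weights: `p` for an occupied site (`true`, that is `1`) and `1 - p` for
an empty one (`false`, that is `0`). -/
def weight (p : ℝ) (b : Bool) : ℝ := if b = true then p else 1 - p

/-- The constraint at `x`: it equals `1` if all children of `x` are empty, and `0` otherwise. -/
def constraint {k : ℕ} (x : Vertex k) (ω : Vertex k → Bool) : ℝ :=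
  if ∀ i : Fin k, ω (i :: x) = false then 1 else 0

/-- The average of `f` over the spin at `x`, the other spins being frozen. -/
def siteMean {V : Type} [DecidableEq V] (p : ℝ) (x : V) (f : (V → Bool) → ℝ) (ω : V → Bool) : ℝ :=
  ∑ b : Bool, weight p b * f (Function.update ω x b)

/-! ### The process on the infinite tree and the critical density -/

/-- Local functions: those that depend on finitely many spins. -/
def IsLocal {k : ℕ} (f : (Vertex k → Bool) → ℝ) : Prop :=
  ∃ A : Finset (Vertex k), DependsOn f (A : Set (Vertex k))

/-- The infinite-volume generator on local functions. For a local function only finitely many terms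
of the sum are nonzero. -/
def generator {k : ℕ} (p : ℝ) (f : (Vertex k → Bool) → ℝ) (ω : Vertex k → Bool) : ℝ :=
  ∑' x : Vertex k, constraint x ω * (siteMean p x f ω - f ω)

/-- The Bernoulli(`p`) product measure on configurations on the infinite tree. -/
def productLaw (k : ℕ) (p : unitInterval) : Measure (Vertex k → Bool) :=
  Measure.infinitePi fun _ : Vertex k => bernoulliMeasure true false p

/-- `f` is in the kernel of the closure in `L²` of the generator on local functions: `f` is an
`L²`-limit of local functions `g n` whose images under the generator tend to `0` in `L²`. -/
def InKernel {k : ℕ} (p : unitInterval) (f : (Vertex k → Bool) → ℝ) : Prop :=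
  MemLp f 2 (productLaw k p) ∧
    ∃ g : ℕ → (Vertex k → Bool) → ℝ, (∀ n, IsLocal (g n)) ∧
      Tendsto (fun n => eLpNorm (g n - f) 2 (productLaw k p)) atTop (𝓝 0) ∧
      Tendsto (fun n => eLpNorm (generator (p : ℝ) (g n)) 2 (productLaw k p)) atTop (𝓝 0)

/-- `0` is a simple eigenvalue of the generator: its kernel consists of the (almost surely)
constant functions. -/
def ZeroIsSimple (k : ℕ) (p : unitInterval) : Prop :=
  ∀ f : (Vertex k → Bool) → ℝ, InKernel p f → ∃ a : ℝ, f =ᵐ[productLaw k p] fun _ => a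

/-- The critical density. The degenerate density `1`, at which the product measure is a point mass
and `0` is trivially a simple eigenvalue, is left out. -/
def criticalDensity (k : ℕ) : ℝ :=
  sSup {p : ℝ | ∃ u : unitInterval, (u : ℝ) = p ∧ p < 1 ∧ ZeroIsSimple k u}

/-! ### The process on a finite set of vertices -/

/-- Configurations on a finite set of vertices. -/
abbrev Config {k : ℕ} (A : Finset (Vertex k)) : Type := A → Bool

/-- Extension of a configuration by empty sites outside `A`. -/
def zeroExt {k : ℕ} {A : Finset (Vertex k)} (η : Config A) : Vertex k → Bool :=
  fun x => if h : x ∈ A then η ⟨x, h⟩ else false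

/-- The finite-volume constraint. -/
def finConstraint {k : ℕ} (A : Finset (Vertex k)) (x : A) (η : Config A) : ℝ :=
  constraint (x : Vertex k) (zeroExt η)

/-- The finite-volume generator. -/
def finGenerator {k : ℕ} (p : ℝ) (A : Finset (Vertex k)) (f : Config A → ℝ) (η : Config A) : ℝ :=
  ∑ x : A, finConstraint A x η * (siteMean p x f η - f η)

/-- The probability of a configuration under the Bernoulli(`p`) product measure. -/
def mass {k : ℕ} (p : ℝ) {A : Finset (Vertex k)} (η : Config A) : ℝ :=
  ∏ x : A, weight p (η x)

/-- Expectation under the Bernoulli(`p`) product measure. -/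
def mean {k : ℕ} (p : ℝ) {A : Finset (Vertex k)} (f : Config A → ℝ) : ℝ :=
  ∑ η : Config A, mass p η * f η

/-- Variance under the Bernoulli(`p`) product measure. -/
def var {k : ℕ} (p : ℝ) {A : Finset (Vertex k)} (f : Config A → ℝ) : ℝ :=
  mean p (fun η => f η ^ 2) - mean p f ^ 2

/-- The Dirichlet form of the finite-volume generator. -/
def dirichletForm {k : ℕ} (p : ℝ) (A : Finset (Vertex k)) (f : Config A → ℝ) : ℝ :=
  mean p fun η => f η * (-finGenerator p A f η)

/-- The spectral gap: the infimum of the Rayleigh quotient over the non-constant functions. -/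
def gap {k : ℕ} (p : ℝ) (A : Finset (Vertex k)) : ℝ :=
  sInf {r : ℝ | ∃ f : Config A → ℝ, (¬ ∃ a : ℝ, ∀ η, f η = a) ∧ r = dirichletForm p A f / var p f}

/-- The relaxation time. -/
def relaxationTime {k : ℕ} (p : ℝ) (A : Finset (Vertex k)) : ℝ := (gap p A)⁻¹

/-- The matrix of the finite-volume generator. -/
def rateMatrix {k : ℕ} (p : ℝ) (A : Finset (Vertex k)) : Matrix (Config A) (Config A) ℝ :=
  Matrix.of fun η σ => finGenerator p A (fun ζ => if ζ = σ then 1 else 0) η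

/-- The law at time `t` of the finite-volume chain started from `η`. -/
def lawAt {k : ℕ} (p : ℝ) (A : Finset (Vertex k)) (t : ℝ) (η σ : Config A) : ℝ :=
  (NormedSpace.exp (t • rateMatrix p A)) η σ

/-- The relative density of the law at time `t` with respect to the product measure. -/
def density {k : ℕ} (p : ℝ) (A : Finset (Vertex k)) (t : ℝ) (η σ : Config A) : ℝ :=
  lawAt p A t η σ / mass p σ

/-- The mixing time `T_a`. -/
def mixingTime {k : ℕ} (a p : ℝ) (A : Finset (Vertex k)) : ℝ :=
  sInf {t : ℝ | 0 ≤ t ∧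
    ∀ η : Config A, (mean p fun σ => |density p A t η σ - 1| ^ a) ^ (1 / a) ≤ 1 / 4}

end

end OFA

/-! Occupied clusters grow downwards like branching processes with mean offspring `k * p`, and the
critical density is `1 / k`. Since constraints look only downwards, disjoint subtrees evolve
independently; this makes the mixing time comparable to `L` times a relaxation time, and the task
becomes to estimate Poincaré constants.

Upper bounds on the relaxation time. Reveal the spins level by level from the root: the variance is
a sum of one term per site, the squared gradient at `x` after all later (in particular all deeper)
spins are averaged out (`vr_eq_sum_siteVar`). Split each gradient according to whether a long
occupied path hangs below `x`. For unblocked sites, condition on the set `S` of unblocked sites of a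
band of levels. This event does not involve the spins in `S`, and constraints satisfied inside `S`
are satisfied in the whole volume (`freeInd_dependsOn`, `cons_freeSites`), so the Poincaré
inequality of the band applies (`sum_unblocked_le`). For blocked sites, Cauchy–Schwarz gains the
probability `ε` of a long path and leaves a sum of variance terms below `x` (`blocked_le`). Summed
over `x` this is `ε` times a number of levels times the variance, which is absorbed on the left. For
`p ≤ 1 / k` a path of length `n` has probability at most `4 / (n + 4)`; shortening the tree by a
fixed fraction then costs a factor 6, hence polynomial growth (`slabPoincare_critical`). For `p < 1
/ k` the exponential decay lets the inequality at depth of order `(1 - k * p)⁻²` serve all depths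
(`poincare_subcritical`).

Lower bounds on the relaxation time. The test function is the size of the occupied cluster of the
root. As long as `(k * p) ^ L` is at least `1 / 2` its variance is of order `L ^ 3`, while its
energy is at most of order `L`: a site can flip only when its children are empty, and then the size
changes by at most one (`relaxationTime_ge`).

Mixing. The squared `L²` distance is a normalized return probability, bounded by a product over
subtrees; one more level costs a constant factor, removed by waiting a multiple of the relaxation
time (`sqDist_le`). Conversely, add up the slowest eigenfunction over `k ^ m` independent subtrees:
its mean stays visible above its fluctuations until a time proportional to `m` times the relaxation
time of a subtree (`le_of_mean_abs_le`).

Critical density. A gap uniform in the depth forces a trivial kernel (`zeroIsSimple_of_poincare`).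
For `k * p > 1` the normalized size of level `n` of the cluster is an `L²` martingale whose image
under the generator tends to zero; its limit is a nonconstant element of the kernel
(`not_zeroIsSimple`). -/

namespace OFA

noncomputable section

/-! ### Partial averages over finite sets of spins -/

section Average

variable {V : Type} {p : ℝ}

/-- The sites of `W` that come after `x`. -/
def later {ι : Type} [LinearOrder ι] (key : V → ι) (W : Finset V) (x : V) :
    Finset V := W.filter fun y => key x < key y

theorem later_subset {ι : Type} [LinearOrder ι] (key : V → ι) (W : Finset V) (x : V) :
    later key W x ⊆ W := Finset.filter_subset _ _

theorem self_notMem_later {ι : Type} [LinearOrder ι] (key : V → ι) (W : Finset V) (x : V) :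
    x ∉ later key W x := by simp [later]

theorem dependsOn_mono {f : (V → Bool) → ℝ} {S T : Set V} (hf : DependsOn f S) (h : S ⊆ T) :
    DependsOn f T :=
  fun _ _ hw => hf fun i hi => hw i (h hi)

theorem dependsOn_comp₂ {f g : (V → Bool) → ℝ} {S : Set V} (hf : DependsOn f S)
    (hg : DependsOn g S) (F : ℝ → ℝ → ℝ) : DependsOn (fun ω => F (f ω) (g ω)) S := by
  intro ω ω' h
  simp only [hf h, hg h]

theorem dependsOn_mul {f g : (V → Bool) → ℝ} {S : Set V} (hf : DependsOn f S)
    (hg : DependsOn g S) : DependsOn (f * g) S := dependsOn_comp₂ hf hg (· * ·)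

theorem dependsOn_pow {f : (V → Bool) → ℝ} {S : Set V} (hf : DependsOn f S) (n : ℕ) :
    DependsOn (f ^ n) S := dependsOn_comp₂ hf hf (fun a _ => a ^ n)

theorem dependsOn_sum {ι : Type*} {f : ι → (V → Bool) → ℝ} {S : Set V} (s : Finset ι)
    (hf : ∀ i ∈ s, DependsOn (f i) S) : DependsOn (∑ i ∈ s, f i) S := by
  intro ω ω' h
  simp only [Finset.sum_apply]
  exact Finset.sum_congr rfl fun i hi => hf i hi h

theorem dependsOn_prod {ι : Type*} {f : ι → (V → Bool) → ℝ} {S : Set V} (s : Finset ι)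
    (hf : ∀ i ∈ s, DependsOn (f i) S) : DependsOn (∏ i ∈ s, f i) S := by
  intro ω ω' h
  simp only [Finset.prod_apply]
  exact Finset.prod_congr rfl fun i hi => hf i hi h

variable [DecidableEq V]

theorem siteMean_eq (p : ℝ) (x : V) (f : (V → Bool) → ℝ) (ω : V → Bool) :
    siteMean p x f ω
      = p * f (Function.update ω x true) + (1 - p) * f (Function.update ω x false) := by
  simp [siteMean, weight]

theorem siteMean_comm (p : ℝ) (x y : V) (f : (V → Bool) → ℝ) :
    siteMean p x (siteMean p y f) = siteMean p y (siteMean p x f) := by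
  by_cases h : x = y
  · rw [h]
  · funext ω
    simp only [siteMean_eq, Function.update_comm h]
    ring

/-- Site averages commute, so `Multiset.foldr` can compose them without choosing an order. -/
instance (p : ℝ) : LeftCommutative (siteMean p : V → ((V → Bool) → ℝ) → (V → Bool) → ℝ) :=
  ⟨siteMean_comm p⟩

/-- The average of `f` over the spins in `A`, the other spins being frozen. -/
def avg (p : ℝ) (A : Finset V) (f : (V → Bool) → ℝ) : (V → Bool) → ℝ :=
  A.val.foldr (siteMean p) f

@[simp] theorem avg_empty (f : (V → Bool) → ℝ) : avg p ∅ f = f := by simp [avg]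

theorem avg_insert {x : V} {A : Finset V} (h : x ∉ A) (f : (V → Bool) → ℝ) :
    avg p (insert x A) f = siteMean p x (avg p A f) := by
  simp [avg, Finset.insert_val_of_notMem h]

theorem avg_singleton (x : V) (f : (V → Bool) → ℝ) : avg p {x} f = siteMean p x f := by
  simp [avg]

theorem siteMean_dependsOn {f : (V → Bool) → ℝ} {S : Set V} (hf : DependsOn f S) (x : V) :
    DependsOn (siteMean p x f) (S \ {x}) := by
  intro ω ω' h
  have key : ∀ b, f (Function.update ω x b) = f (Function.update ω' x b) := by
    intro b
    apply hf
    intro i hi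
    by_cases hx : i = x
    · subst hx; simp
    · simp [Function.update_of_ne hx, h i ⟨hi, hx⟩]
  simp [siteMean_eq, key]

theorem avg_dependsOn {f : (V → Bool) → ℝ} {S : Set V} (hf : DependsOn f S) (A : Finset V) :
    DependsOn (avg p A f) (S \ A) := by
  induction A using Finset.induction_on with
  | empty => simpa using hf
  | insert x A hx ih =>
    rw [avg_insert hx]
    have := siteMean_dependsOn (p := p) ih x
    rwa [Set.sdiff_sdiff, Set.union_singleton, ← Finset.coe_insert] at this

theorem dependsOn_avg_compl (f : (V → Bool) → ℝ) (A : Finset V) :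
    DependsOn (avg p A f) (A : Set V)ᶜ := by
  have := avg_dependsOn (p := p) (dependsOn_univ f) A
  rwa [← Set.compl_eq_univ_sdiff] at this

theorem update_of_dependsOn {f : (V → Bool) → ℝ} {S : Set V} (hf : DependsOn f S) {x : V}
    (hx : x ∉ S) (ω : V → Bool) (b : Bool) : f (Function.update ω x b) = f ω := by
  apply hf
  intro i hi
  refine Function.update_of_ne ?_ _ _
  rintro rfl
  exact hx hi

theorem siteMean_mul_left {f g : (V → Bool) → ℝ} {S : Set V} (hg : DependsOn g S) {x : V}
    (hx : x ∉ S) : siteMean p x (g * f) = g * siteMean p x f := by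
  funext ω
  simp only [siteMean_eq, Pi.mul_apply, update_of_dependsOn hg hx]
  ring

theorem avg_mul_left {f g : (V → Bool) → ℝ} {A : Finset V} (hg : DependsOn g (A : Set V)ᶜ) :
    avg p A (g * f) = g * avg p A f := by
  induction A using Finset.induction_on with
  | empty => simp
  | insert x A hx ih =>
    rw [avg_insert hx, avg_insert hx, ih, siteMean_mul_left hg (by simp)]
    exact dependsOn_mono hg (by simp)

theorem siteMean_const (x : V) (c : ℝ) : siteMean p x (fun _ => c) = fun _ => c := by
  funext ω; rw [siteMean_eq]; ring

@[simp] theorem avg_const (A : Finset V) (c : ℝ) :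
    avg p A (fun _ => c) = fun _ => c := by
  induction A using Finset.induction_on with
  | empty => simp
  | insert x A hx ih => rw [avg_insert hx, ih, siteMean_const]

theorem avg_of_dependsOn {f : (V → Bool) → ℝ} {A : Finset V} (hf : DependsOn f (A : Set V)ᶜ) :
    avg p A f = f := by
  have h := avg_mul_left (p := p) (f := fun _ => 1) hf
  rw [avg_const] at h
  have h1 : f * (fun _ => (1 : ℝ)) = f := by funext ω; simp
  rwa [h1] at h

theorem avg_add (A : Finset V) (f g : (V → Bool) → ℝ) :
    avg p A (f + g) = avg p A f + avg p A g := by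
  induction A using Finset.induction_on with
  | empty => simp
  | insert x A hx ih =>
    rw [avg_insert hx, avg_insert hx, avg_insert hx, ih]
    funext ω; simp only [siteMean_eq, Pi.add_apply]; ring

theorem avg_smul (A : Finset V) (c : ℝ) (f : (V → Bool) → ℝ) :
    avg p A (c • f) = c • avg p A f := by
  induction A using Finset.induction_on with
  | empty => simp
  | insert x A hx ih =>
    rw [avg_insert hx, avg_insert hx, ih]
    funext ω; simp only [siteMean_eq, Pi.smul_apply, smul_eq_mul]; ring

theorem avg_zero (A : Finset V) : avg p A 0 = 0 := avg_const A 0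

theorem avg_one (A : Finset V) : avg p A 1 = 1 := avg_const A 1

theorem avg_neg (A : Finset V) (f : (V → Bool) → ℝ) : avg p A (-f) = -avg p A f := by
  have := avg_smul (p := p) A (-1) f
  simpa using this

theorem avg_sub (A : Finset V) (f g : (V → Bool) → ℝ) :
    avg p A (f - g) = avg p A f - avg p A g := by
  rw [sub_eq_add_neg, avg_add, avg_neg, sub_eq_add_neg]

theorem avg_sum {ι : Type*} (A : Finset V) (s : Finset ι) (f : ι → (V → Bool) → ℝ) :
    avg p A (∑ i ∈ s, f i) = ∑ i ∈ s, avg p A (f i) := by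
  classical
  induction s using Finset.induction_on with
  | empty => simp [avg_zero]
  | insert i s hi ih => rw [Finset.sum_insert hi, Finset.sum_insert hi, avg_add, ih]

theorem avg_nonneg (h0 : 0 ≤ p) (h1 : p ≤ 1) {A : Finset V} {f : (V → Bool) → ℝ} (hf : 0 ≤ f) :
    0 ≤ avg p A f := by
  induction A using Finset.induction_on with
  | empty => simpa using hf
  | insert x A hx ih =>
    rw [avg_insert hx]
    intro ω
    rw [siteMean_eq]
    have a := ih (Function.update ω x true)
    have b := ih (Function.update ω x false)
    simp only [Pi.zero_apply] at a b ⊢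
    have : 0 ≤ 1 - p := by linarith
    positivity

theorem avg_mono (h0 : 0 ≤ p) (h1 : p ≤ 1) {A : Finset V} {f g : (V → Bool) → ℝ} (h : f ≤ g) :
    avg p A f ≤ avg p A g := by
  have := avg_nonneg h0 h1 (A := A) (sub_nonneg.2 h)
  rw [avg_sub] at this
  exact sub_nonneg.1 this

/-- Disjointness is not needed: after averaging at a site the result ignores that spin, so a second
average there changes nothing. -/
theorem avg_union (A B : Finset V) (f : (V → Bool) → ℝ) :
    avg p (A ∪ B) f = avg p A (avg p B f) := by
  induction A using Finset.induction_on with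
  | empty => simp
  | insert x A hx ih =>
    rw [avg_insert hx, ← ih, Finset.insert_union]
    by_cases h : x ∈ A ∪ B
    · rw [Finset.insert_eq_of_mem h, ← avg_singleton, avg_of_dependsOn (A := {x})]
      refine dependsOn_mono (dependsOn_avg_compl f (A ∪ B)) fun y hy => ?_
      rintro hyx
      rw [Finset.coe_singleton, Set.mem_singleton_iff] at hyx
      exact hy (hyx ▸ h)
    · rw [avg_insert h]

theorem avg_avg_of_subset {A B : Finset V} (h : B ⊆ A) (f : (V → Bool) → ℝ) :
    avg p A (avg p B f) = avg p A f := by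
  rw [← avg_union, Finset.union_eq_left.2 h]

/-- Functions of disjoint sets of spins are independent. -/
theorem avg_mul_of_disjoint {f g : (V → Bool) → ℝ} {A S : Finset V} (hS : S ⊆ A)
    (hf : DependsOn f (S : Set V)) (hg : DependsOn g (S : Set V)ᶜ) :
    avg p A (f * g) = avg p A f * avg p A g := by
  have hc : DependsOn (avg p S f) (∅ : Set V) := by
    simpa using avg_dependsOn (p := p) hf S
  have hAf : avg p A f = avg p S f := by
    rw [← avg_avg_of_subset hS, avg_of_dependsOn]
    exact dependsOn_mono hc (by simp)
  rw [← avg_avg_of_subset hS, mul_comm, avg_mul_left hg, mul_comm, avg_mul_left, hAf]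
  exact dependsOn_mono hc (by simp)

/-- The quadratic polynomial `t ↦ avg ((t f + g) ^ 2)` is nonnegative, so its discriminant is not
positive. -/
theorem sq_avg_mul_le (h0 : 0 ≤ p) (h1 : p ≤ 1) (A : Finset V) (f g : (V → Bool) → ℝ)
    (ω : V → Bool) :
    (avg p A (f * g) ω) ^ 2 ≤ avg p A (f ^ 2) ω * avg p A (g ^ 2) ω := by
  have key : ∀ t : ℝ, 0 ≤ avg p A (f ^ 2) ω * (t * t) + 2 * avg p A (f * g) ω * t
      + avg p A (g ^ 2) ω := by
    intro t
    have h := avg_nonneg h0 h1 (A := A) (f := (t • f + g) ^ 2) (fun ω => sq_nonneg _) ω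
    have e : (t • f + g) ^ 2 = (t * t) • f ^ 2 + (2 * t) • (f * g) + g ^ 2 := by
      funext ω; simp; ring
    rw [e, avg_add, avg_add, avg_smul, avg_smul] at h
    simp only [Pi.add_apply, Pi.smul_apply, smul_eq_mul, Pi.zero_apply] at h
    linarith
  have := discrim_le_zero key
  rw [discrim] at this
  nlinarith

theorem sq_avg_le (h0 : 0 ≤ p) (h1 : p ≤ 1) (A : Finset V) (f : (V → Bool) → ℝ) :
    (avg p A f) ^ 2 ≤ avg p A (f ^ 2) := by
  intro ω
  have := sq_avg_mul_le h0 h1 A f 1 ω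
  rw [mul_one, one_pow, avg_one] at this
  simpa using this

/-! ### Gradients and variances -/

/-- The discrete gradient at `x`. -/
def grad (x : V) (f : (V → Bool) → ℝ) (ω : V → Bool) : ℝ :=
  f (Function.update ω x true) - f (Function.update ω x false)

theorem grad_siteMean {x y : V} (h : x ≠ y) (f : (V → Bool) → ℝ) :
    grad x (siteMean p y f) = siteMean p y (grad x f) := by
  funext ω
  simp only [grad, siteMean_eq, Function.update_comm h]
  ring

theorem grad_avg {x : V} {A : Finset V} (h : x ∉ A) (f : (V → Bool) → ℝ) :
    grad x (avg p A f) = avg p A (grad x f) := by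
  induction A using Finset.induction_on with
  | empty => simp
  | insert y A hy ih =>
    simp only [Finset.mem_insert, not_or] at h
    rw [avg_insert hy, avg_insert hy, grad_siteMean h.1, ih h.2]

theorem grad_dependsOn {f : (V → Bool) → ℝ} {S : Set V} (hf : DependsOn f S) (x : V) :
    DependsOn (grad x f) (S \ {x}) := by
  intro ω ω' h
  have key : ∀ b, f (Function.update ω x b) = f (Function.update ω' x b) := by
    intro b
    apply hf
    intro i hi
    by_cases hx : i = x
    · subst hx; simp
    · simp [Function.update_of_ne hx, h i ⟨hi, hx⟩]
  simp [grad, key]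

theorem grad_eq_zero {f : (V → Bool) → ℝ} {S : Set V} (hf : DependsOn f S) {x : V} (hx : x ∉ S) :
    grad x f = 0 := by
  funext ω
  simp [grad, update_of_dependsOn hf hx]

/-- The variance over the spins in `A`, the other spins being frozen. -/
def vr (p : ℝ) (A : Finset V) (f : (V → Bool) → ℝ) : (V → Bool) → ℝ :=
  avg p A (f ^ 2) - (avg p A f) ^ 2

theorem vr_nonneg (h0 : 0 ≤ p) (h1 : p ≤ 1) (A : Finset V) (f : (V → Bool) → ℝ) :
    0 ≤ vr p A f := sub_nonneg.2 (sq_avg_le h0 h1 A f)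

/-- The law of total variance; like `avg_union` it needs no disjointness. -/
theorem vr_union (A B : Finset V) (f : (V → Bool) → ℝ) :
    vr p (A ∪ B) f = avg p A (vr p B f) + vr p A (avg p B f) := by
  simp only [vr, avg_union, avg_sub]
  abel

theorem vr_singleton (x : V) (f : (V → Bool) → ℝ) :
    vr p {x} f = (p * (1 - p)) • (grad x f) ^ 2 := by
  funext ω
  simp only [vr, avg_singleton, Pi.sub_apply, siteMean_eq, Pi.pow_apply, Pi.smul_apply, grad,
    smul_eq_mul]
  ring

theorem vr_empty (f : (V → Bool) → ℝ) : vr p ∅ f = 0 := by simp [vr]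

/-- A variance over few spins is on average at most the variance over more spins. -/
theorem avg_vr_le (h0 : 0 ≤ p) (h1 : p ≤ 1) {A B : Finset V} (h : B ⊆ A) (f : (V → Bool) → ℝ) :
    avg p A (vr p B f) ≤ vr p A f := by
  have e : A = (A \ B) ∪ B := by simp [h]
  have h2 : avg p A (vr p B f) = avg p (A \ B) (vr p B f) := by
    conv_lhs => rw [e, avg_union]
    rw [avg_of_dependsOn (A := B)]
    have h3 := dependsOn_avg_compl (p := p) (f ^ 2) B
    have h4 := dependsOn_avg_compl (p := p) f B
    exact dependsOn_comp₂ h3 h4 (fun a b => a - b ^ 2)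
  have h5 : vr p A f = avg p (A \ B) (vr p B f) + vr p (A \ B) (avg p B f) := by
    conv_lhs => rw [e]
    exact vr_union _ _ _
  rw [h2, h5]
  exact le_add_of_nonneg_right (vr_nonneg h0 h1 _ _)

/-! ### The sequential decomposition of the variance -/

section Order

variable {ι : Type} [LinearOrder ι] (key : V → ι)

/-- The part of the variance over `W` that is due to the spin at `x`. -/
def siteVar (p : ℝ) (W : Finset V) (f : (V → Bool) → ℝ) (x : V) : (V → Bool) → ℝ :=
  (p * (1 - p)) • avg p W ((grad x (avg p (later key W x) f)) ^ 2)

theorem siteVar_nonneg (h0 : 0 ≤ p) (h1 : p ≤ 1) (W : Finset V) (f : (V → Bool) → ℝ) (x : V) :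
    0 ≤ siteVar key p W f x := by
  have h2 : 0 ≤ 1 - p := by linarith
  exact smul_nonneg (by positivity) (avg_nonneg h0 h1 fun ω => sq_nonneg _)

/-- Martingale decomposition along the order of `key`. The site with the smallest key is peeled off
by the law of total variance; for it, all remaining sites are the later ones. -/
theorem vr_eq_sum_siteVar (hkey : Function.Injective key) (W : Finset V) (f : (V → Bool) → ℝ) :
    vr p W f = ∑ x ∈ W, siteVar key p W f x := by
  induction W using Finset.induction_on_min_value key with
  | empty => simp [vr_empty]
  | insert x A hx hmin ih =>
    have hlt : ∀ y ∈ A, key x < key y := fun y hy =>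
      lt_of_le_of_ne (hmin y hy) fun h => hx (hkey h ▸ hy)
    have e1 : later key (insert x A) x = A := by
      ext y
      simp only [later, Finset.mem_filter, Finset.mem_insert]
      constructor
      · rintro ⟨rfl | h, h'⟩
        · exact absurd h' (lt_irrefl _)
        · exact h
      · exact fun h => ⟨Or.inr h, hlt y h⟩
    have e2 : ∀ y ∈ A, later key (insert x A) y = later key A y := by
      intro y hy
      ext z
      simp only [later, Finset.mem_filter, Finset.mem_insert]
      constructor
      · rintro ⟨rfl | h, h'⟩
        · exact absurd h' (not_lt.2 (hmin y hy))
        · exact ⟨h, h'⟩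
      · exact fun h => ⟨Or.inr h.1, h.2⟩
    rw [Finset.sum_insert hx, Finset.insert_eq, vr_union, ← Finset.insert_eq, ih, add_comm]
    congr 1
    · rw [vr_singleton, siteVar, e1, avg_of_dependsOn (A := insert x A)]
      refine dependsOn_pow ?_ 2
      have := grad_dependsOn (dependsOn_avg_compl (p := p) f A) x
      refine dependsOn_mono this ?_
      intro y hy
      simpa [not_or, and_comm] using hy
    · rw [avg_sum]
      refine Finset.sum_congr rfl fun y hy => ?_
      rw [siteVar, siteVar, e2 y hy, avg_smul, Finset.insert_eq, avg_union]

/-- The averages over larger sets give smaller contributions. -/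
theorem avg_sq_grad_avg_le (h0 : 0 ≤ p) (h1 : p ≤ 1) {W Z L : Finset V} (hL : L ⊆ Z) (hZ : Z ⊆ W)
    {x : V} (hx : x ∉ Z) (f : (V → Bool) → ℝ) :
    avg p W ((grad x (avg p Z f)) ^ 2) ≤ avg p W ((grad x (avg p L f)) ^ 2) := by
  have e : avg p Z f = avg p Z (avg p L f) := (avg_avg_of_subset hL f).symm
  rw [e, grad_avg hx]
  calc avg p W ((avg p Z (grad x (avg p L f))) ^ 2)
      ≤ avg p W (avg p Z ((grad x (avg p L f)) ^ 2)) := avg_mono h0 h1 (sq_avg_le h0 h1 _ _)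
    _ = _ := avg_avg_of_subset hZ _

end Order

end Average

/-! ### Poincaré inequalities for the constrained dynamics -/

section Average

variable {V : Type} [DecidableEq V] {p : ℝ}

theorem avg_congr_of_eqOn {A : Finset V} {f g : (V → Bool) → ℝ} {ω : V → Bool}
    (h : ∀ ω', (∀ y ∉ A, ω' y = ω y) → f ω' = g ω') : avg p A f ω = avg p A g ω := by
  induction A using Finset.induction_on generalizing ω with
  | empty => simpa using h ω fun _ _ => rfl
  | insert x A hx ih =>
    have key : ∀ b, avg p A f (Function.update ω x b) = avg p A g (Function.update ω x b) := by
      intro b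
      refine ih fun ω' hω' => h ω' fun y hy => ?_
      simp only [Finset.mem_insert, not_or] at hy
      rw [hω' y hy.2, Function.update_of_ne hy.1]
    rw [avg_insert hx, avg_insert hx, siteMean_eq, siteMean_eq, key, key]

theorem avg_eq_of_dependsOn {A U : Finset V} (hU : U ⊆ A) {f : (V → Bool) → ℝ}
    (hf : DependsOn f (U : Set V)) : avg p A f = avg p U f := by
  rw [← avg_avg_of_subset hU, avg_of_dependsOn]
  have := avg_dependsOn (p := p) hf U
  exact dependsOn_mono this (by simp)

/-- The function `f` with the spins outside `U` frozen to those of `ω`. -/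
def freeze (U : Finset V) (ω : V → Bool) (f : (V → Bool) → ℝ) (ω' : V → Bool) : ℝ :=
  f fun y => if y ∈ U then ω' y else ω y

theorem freeze_dependsOn (U : Finset V) (ω : V → Bool) (f : (V → Bool) → ℝ) :
    DependsOn (freeze U ω f) (U : Set V) := by
  intro ω₁ ω₂ h
  unfold freeze
  congr 1
  funext y
  split_ifs with hy
  · exact h y hy
  · rfl

theorem freeze_apply {U : Finset V} {ω ω' : V → Bool} (h : ∀ y ∉ U, ω' y = ω y)
    (f : (V → Bool) → ℝ) : freeze U ω f ω' = f ω' := by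
  unfold freeze
  congr 1
  funext y
  split_ifs with hy
  · rfl
  · exact (h y hy).symm

theorem dependsOn_compl_of_update {f : (V → Bool) → ℝ} {S : Finset V}
    (h : ∀ x ∈ S, ∀ ω b, f (Function.update ω x b) = f ω) : DependsOn f (S : Set V)ᶜ := by
  induction S using Finset.induction_on with
  | empty => simpa using dependsOn_univ f
  | insert x S hx ih =>
    intro ω ω' hω
    rw [← h x (by simp) ω (ω' x)]
    refine ih (fun y hy => h y (by simp [hy])) fun y hy => ?_
    by_cases hyx : y = x
    · subst hyx; simp
    · rw [Function.update_of_ne hyx]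
      exact hω y (by simpa [hyx] using hy)

end Average

variable {k : ℕ} {p : ℝ}

/-- The constraint at `x` for the process on `W`: the children of `x` in `W` are empty. -/
def cons (W : Finset (Vertex k)) (x : Vertex k) (ω : Vertex k → Bool) : ℝ :=
  if ∀ i : Fin k, i :: x ∈ W → ω (i :: x) = false then 1 else 0

theorem cons_nonneg (W : Finset (Vertex k)) (x : Vertex k) : 0 ≤ cons W x := by
  intro ω; unfold cons; split_ifs <;> simp

theorem cons_le_one (W : Finset (Vertex k)) (x : Vertex k) : cons W x ≤ 1 := by
  intro ω; unfold cons; split_ifs <;> simp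

theorem cons_anti {U W : Finset (Vertex k)} (h : U ⊆ W) (x : Vertex k) : cons W x ≤ cons U x := by
  intro ω
  unfold cons
  split_ifs with h1 h2
  · exact le_rfl
  · exact absurd (fun i hi => h1 i (h hi)) h2
  · simp
  · exact le_rfl

theorem cons_dependsOn (W : Finset (Vertex k)) (x : Vertex k) :
    DependsOn (cons W x) (W : Set (Vertex k)) := by
  intro ω ω' h
  unfold cons
  have : (∀ i : Fin k, i :: x ∈ W → ω (i :: x) = false) ↔
      ∀ i : Fin k, i :: x ∈ W → ω' (i :: x) = false :=
    forall_congr' fun i => ⟨fun g hi => by rw [← h _ hi]; exact g hi,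
      fun g hi => by rw [h _ hi]; exact g hi⟩
  simp only [this]

/-- The contribution of the site `x` to the Dirichlet form of the process on `W`. -/
def energy (p : ℝ) (W : Finset (Vertex k)) (x : Vertex k) (f : (Vertex k → Bool) → ℝ) :
    (Vertex k → Bool) → ℝ :=
  (p * (1 - p)) • avg p W (cons W x * (grad x f) ^ 2)

theorem energy_nonneg (h0 : 0 ≤ p) (h1 : p ≤ 1) (W : Finset (Vertex k)) (x : Vertex k)
    (f : (Vertex k → Bool) → ℝ) : 0 ≤ energy p W x f :=
  smul_nonneg (mul_nonneg h0 (sub_nonneg.2 h1))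
    (avg_nonneg h0 h1 (mul_nonneg (cons_nonneg W x) fun _ => sq_nonneg _))

/-- The Poincaré inequality with constant `C` for the process on `W`. -/
def Poincare (p : ℝ) (W : Finset (Vertex k)) (C : ℝ) : Prop :=
  ∀ (f : (Vertex k → Bool) → ℝ) (ω : Vertex k → Bool),
    vr p W f ω ≤ C * ∑ x ∈ W, energy p W x f ω

theorem Poincare.mono_const (h0 : 0 ≤ p) (h1 : p ≤ 1) {W : Finset (Vertex k)} {C C' : ℝ}
    (h : Poincare p W C) (hC : C ≤ C') : Poincare p W C' := fun f ω =>
  (h f ω).trans (mul_le_mul_of_nonneg_right hC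
    (Finset.sum_nonneg fun x _ => energy_nonneg h0 h1 W x f ω))

/-- Removing sites only relaxes constraints. Freezing the spins outside `U` turns `f` into a
function of the spins in `U`; it has no energy at sites outside `U`, and at a site of `U` its energy
for `W` is at most that for `U`. -/
theorem Poincare.subset (h0 : 0 ≤ p) (h1 : p ≤ 1) {U W : Finset (Vertex k)} (hUW : U ⊆ W) {C : ℝ}
    (hC : 0 ≤ C) (h : Poincare p W C) : Poincare p U C := by
  intro f ω
  set f' := freeze U ω f with hf'
  have hd : DependsOn f' (U : Set (Vertex k)) := freeze_dependsOn U ω f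
  have e1 : vr p W f' ω = vr p U f ω := by
    simp only [vr, Pi.sub_apply, Pi.pow_apply]
    rw [avg_eq_of_dependsOn hUW hd, avg_eq_of_dependsOn hUW (dependsOn_pow hd 2)]
    congr 1
    · exact avg_congr_of_eqOn fun ω' h => by simp [hf', freeze_apply h]
    · congr 1
      exact avg_congr_of_eqOn fun ω' h => by simp [hf', freeze_apply h]
  rw [← e1]
  refine (h f' ω).trans (mul_le_mul_of_nonneg_left ?_ hC)
  rw [← Finset.sum_subset hUW]
  · refine Finset.sum_le_sum fun x hx => ?_
    simp only [energy, Pi.smul_apply, smul_eq_mul]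
    refine mul_le_mul_of_nonneg_left ?_ (mul_nonneg h0 (sub_nonneg.2 h1))
    have hg : DependsOn (cons U x * (grad x f') ^ 2) (U : Set (Vertex k)) :=
      dependsOn_mul (cons_dependsOn U x)
        (dependsOn_pow (dependsOn_mono (grad_dependsOn hd x) Set.sdiff_subset) 2)
    calc avg p W (cons W x * (grad x f') ^ 2) ω
        ≤ avg p W (cons U x * (grad x f') ^ 2) ω :=
          avg_mono h0 h1 (fun ω => mul_le_mul_of_nonneg_right (cons_anti hUW x ω)
            (sq_nonneg _)) ω
      _ = avg p U (cons U x * (grad x f') ^ 2) ω := by rw [avg_eq_of_dependsOn hUW hg]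
      _ = avg p U (cons U x * (grad x f) ^ 2) ω := by
          refine avg_congr_of_eqOn fun ω' h' => ?_
          have hb : ∀ b, f' (Function.update ω' x b) = f (Function.update ω' x b) := by
            intro b
            refine freeze_apply (fun y hy => ?_) f
            rw [Function.update_of_ne (by rintro rfl; exact hy hx), h' y hy]
          simp [grad, hb]
      _ ≤ _ := le_rfl
  · intro x _ hx
    simp [energy, grad_eq_zero hd hx, avg_zero]

/-- Vertices ordered by depth, and lexicographically at each depth. -/
def levelKey (x : Vertex k) : ℕ ×ₗ List (Fin k) := toLex (x.length, x)

theorem levelKey_injective : Function.Injective (levelKey (k := k)) := by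
  intro x y h
  have := congrArg (fun z => (ofLex z).2) h
  simpa [levelKey] using this

/-- All deeper sites are later, so averaging over the later sites integrates out, in particular,
every spin that decides whether `x` is blocked. -/
theorem levelKey_lt {x y : Vertex k} (h : x.length < y.length) : levelKey x < levelKey y := by
  rw [levelKey, levelKey, Prod.Lex.toLex_lt_toLex]
  exact Or.inl h

/-! ### Occupied paths -/

/-- Some child of `x` in `W` starts an occupied path of `n` vertices of `W`. -/
def Hit (W : Finset (Vertex k)) : ℕ → Vertex k → (Vertex k → Bool) → Prop
  | 0, _, _ => True
  | n + 1, x, ω => ∃ i : Fin k, i :: x ∈ W ∧ ω (i :: x) = true ∧ Hit W n (i :: x) ω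

open Classical in
/-- The indicator function of `Hit`. -/
def hitInd (W : Finset (Vertex k)) (n : ℕ) (x : Vertex k) (ω : Vertex k → Bool) : ℝ :=
  if Hit W n x ω then 1 else 0

open Classical in
/-- The sites between the levels `j` and `N` that have no occupied path to level `N` below them. -/
def freeSites (W : Finset (Vertex k)) (j N : ℕ) (ω : Vertex k → Bool) : Finset (Vertex k) :=
  W.filter fun x => (j ≤ x.length ∧ x.length < N) ∧ ¬ Hit W (N - x.length) x ω

/-- A path to level `N` that uses `z` would have to continue below `z`, and there is no such
continuation; hence the spin at `z` plays no role in any of these events. -/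
theorem hit_update {W : Finset (Vertex k)} {N : ℕ} {z : Vertex k} {ω : Vertex k → Bool}
    (hz : ¬ Hit W (N - z.length) z ω) (b : Bool) (n : ℕ) (x : Vertex k) (hx : x.length + n = N) :
    Hit W n x (Function.update ω z b) ↔ Hit W n x ω := by
  induction n generalizing x with
  | zero => simp [Hit]
  | succ n ih =>
    refine exists_congr fun i => and_congr_right fun _ => ?_
    have hl : (i :: x).length + n = N := by simp only [List.length_cons]; omega
    rw [ih (i :: x) hl]
    by_cases h : i :: x = z
    · have : ¬ Hit W n (i :: x) ω := by
        rw [h]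
        have : n = N - z.length := by rw [← h]; omega
        rwa [this]
      simp [this]
    · rw [Function.update_of_ne h]

theorem freeSites_update {W : Finset (Vertex k)} {j N : ℕ} {z : Vertex k} {ω : Vertex k → Bool}
    (hz : z ∈ freeSites W j N ω) (b : Bool) :
    freeSites W j N (Function.update ω z b) = freeSites W j N ω := by
  simp only [freeSites, Finset.mem_filter] at hz
  unfold freeSites
  ext x
  simp only [Finset.mem_filter]
  refine and_congr_right fun _ => and_congr_right fun hx => not_congr ?_
  exact hit_update hz.2.2 b _ x (by omega)

/-- An occupied child in `W` of a free site is itself free, since otherwise it would extend to a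
path from the site to level `N`. So once the free children are empty, all children in `W` are. -/
theorem cons_freeSites {W : Finset (Vertex k)} {j N : ℕ} {ω : Vertex k → Bool} {x : Vertex k}
    (hx : x ∈ freeSites W j N ω) : cons (freeSites W j N ω) x ω ≤ cons W x ω := by
  unfold cons
  split_ifs with h1 h2
  · exact le_rfl
  · exfalso
    apply h2
    intro i hi
    simp only [freeSites, Finset.mem_filter] at hx h1
    have hN : N - x.length = (N - (i :: x).length) + 1 := by
      simp only [List.length_cons]; omega
    have hnot := hx.2.2
    rw [hN] at hnot
    by_contra hocc
    rw [Bool.not_eq_false] at hocc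
    have hno : ¬ Hit W (N - (i :: x).length) (i :: x) ω := fun hh => hnot ⟨i, hi, hocc, hh⟩
    -- A child at level `N` is hit in zero steps, which `hno` excludes.
    have hlt : (i :: x).length < N := by
      by_contra hge
      have : N - (i :: x).length = 0 := by omega
      rw [this] at hno
      exact hno trivial
    have := h1 i ⟨hi, ⟨by simp only [List.length_cons]; omega, hlt⟩, hno⟩
    rw [this] at hocc
    cases hocc
  · simp
  · exact le_rfl

/-! ### The unblocked part of the variance -/

/-- The indicator function of the event that the set of free sites is `S`. -/
def freeInd (W : Finset (Vertex k)) (j N : ℕ) (S : Finset (Vertex k)) (ω : Vertex k → Bool) : ℝ :=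
  if freeSites W j N ω = S then 1 else 0

/-- By `freeSites_update`, flipping a spin of `S` neither creates nor destroys the event.
Conditionally on it, the spins in `S` therefore keep their product law. -/
theorem freeInd_dependsOn (W : Finset (Vertex k)) (j N : ℕ) (S : Finset (Vertex k)) :
    DependsOn (freeInd W j N S) (S : Set (Vertex k))ᶜ := by
  refine dependsOn_compl_of_update fun x hx ω b => ?_
  unfold freeInd
  have : freeSites W j N (Function.update ω x b) = S ↔ freeSites W j N ω = S := by
    constructor
    · intro h
      have h2 := freeSites_update (by rw [h]; exact hx) (ω x) (ω := Function.update ω x b)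
        (z := x) (W := W) (j := j) (N := N)
      rw [Function.update_idem, Function.update_eq_self] at h2
      rw [h2, h]
    · intro h
      rw [freeSites_update (by rw [h]; exact hx), h]
  simp only [this]

theorem freeInd_nonneg (W : Finset (Vertex k)) (j N : ℕ) (S : Finset (Vertex k)) :
    0 ≤ freeInd W j N S := by
  intro ω; unfold freeInd; split_ifs <;> simp

theorem sum_freeInd_mul (W : Finset (Vertex k)) (j N : ℕ) (T : Finset (Finset (Vertex k)))
    (g : Finset (Vertex k) → (Vertex k → Bool) → ℝ) (ω : Vertex k → Bool) :
    (∑ S ∈ T, freeInd W j N S * g S) ω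
      = if freeSites W j N ω ∈ T then g (freeSites W j N ω) ω else 0 := by
  simp only [Finset.sum_apply, Pi.mul_apply, freeInd, ite_mul, one_mul, zero_mul]
  rw [Finset.sum_ite_eq]

/-- The sites of `W` between the levels `j` and `N`. -/
def band (W : Finset (Vertex k)) (j N : ℕ) : Finset (Vertex k) :=
  W.filter fun x => j ≤ x.length ∧ x.length < N

theorem band_subset (W : Finset (Vertex k)) (j N : ℕ) : band W j N ⊆ W :=
  Finset.filter_subset _ _

theorem freeSites_subset (W : Finset (Vertex k)) (j N : ℕ) (ω : Vertex k → Bool) :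
    freeSites W j N ω ⊆ band W j N := by
  intro x hx
  simp only [freeSites, Finset.mem_filter] at hx
  simp only [band, Finset.mem_filter]
  exact ⟨hx.1, hx.2.1⟩

/-- A site is unblocked exactly when it belongs to the free set, so `1 - hitInd` is the sum of
`freeInd` over the sets containing `x`. The average over the later sites of `S` has to be inserted
before the square is taken, so that the right side becomes a term of the variance decomposition over
`S`. -/
theorem unblocked_le (h0 : 0 ≤ p) (h1 : p ≤ 1) {W : Finset (Vertex k)} {j N : ℕ} {x : Vertex k}
    (hx : x ∈ band W j N) (f : (Vertex k → Bool) → ℝ) :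
    avg p W ((avg p (later levelKey W x) ((1 - hitInd W (N - x.length) x) * grad x f)) ^ 2)
      ≤ ∑ S ∈ (band W j N).powerset with x ∈ S,
          avg p W (freeInd W j N S * (grad x (avg p (later levelKey S x) f)) ^ 2) := by
  set L := later levelKey W x with hL
  set T := (band W j N).powerset.filter (x ∈ ·) with hT
  have hmem : ∀ ω, freeSites W j N ω ∈ T ↔ ¬ Hit W (N - x.length) x ω := by
    intro ω
    simp only [hT, Finset.mem_filter, Finset.mem_powerset, freeSites_subset, true_and]
    simp only [band, Finset.mem_filter] at hx
    simp [freeSites, hx]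
  have hsum : (1 - hitInd W (N - x.length) x) * grad x f
      = ∑ S ∈ T, freeInd W j N S * grad x f := by
    funext ω
    rw [sum_freeInd_mul]
    by_cases h : Hit W (N - x.length) x ω
    · rw [if_neg fun h' => (hmem ω).1 h' h]
      simp [hitInd, h]
    · rw [if_pos ((hmem ω).2 h)]
      simp [hitInd, h]
  have hlater : ∀ S ∈ T, later levelKey S x ⊆ L ∧ later levelKey S x ⊆ S := by
    intro S hS
    simp only [hT, Finset.mem_filter, Finset.mem_powerset] at hS
    exact ⟨Finset.filter_subset_filter _ (hS.1.trans (band_subset W j N)), later_subset _ _ _⟩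
  -- The later sites of `S` are among those of `W`, and `freeInd` ignores them: averaging `f` over
  -- them beforehand changes nothing.
  have hstep : avg p L (∑ S ∈ T, freeInd W j N S * grad x f)
      = avg p L (∑ S ∈ T, freeInd W j N S * grad x (avg p (later levelKey S x) f)) := by
    rw [avg_sum, avg_sum]
    refine Finset.sum_congr rfl fun S hS => ?_
    obtain ⟨ha, hb⟩ := hlater S hS
    rw [← avg_avg_of_subset ha, avg_mul_left, ← grad_avg (self_notMem_later levelKey S x)]
    refine dependsOn_mono (freeInd_dependsOn W j N S) ?_
    rw [Set.compl_subset_compl]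
    exact_mod_cast hb
  rw [hsum, hstep, ← avg_sum]
  refine (avg_mono h0 h1 (sq_avg_le h0 h1 L _)).trans ?_
  rw [avg_avg_of_subset (later_subset _ _ _)]
  -- For a given `ω` at most one set contributes, so the square of the sum is the sum of the
  -- squares.
  refine avg_mono h0 h1 fun ω => ?_
  rw [sum_freeInd_mul, Pi.pow_apply, sum_freeInd_mul]
  split_ifs <;> simp

/-- For a fixed free set `S`, the bounds of `unblocked_le` add up over `x ∈ S` to the variance over
`S`. The Poincaré inequality passes from the band to `S`, and `cons_freeSites` replaces the
constraints of `S` by those of `W` before the sum over `S` is collapsed again. -/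
theorem sum_unblocked_le (h0 : 0 ≤ p) (h1 : p ≤ 1) {W : Finset (Vertex k)} {j N : ℕ} {C : ℝ}
    (hC : 0 ≤ C) (hP : Poincare p (band W j N) C) (f : (Vertex k → Bool) → ℝ) :
    ∑ x ∈ band W j N, (p * (1 - p)) •
        avg p W ((avg p (later levelKey W x) ((1 - hitInd W (N - x.length) x) * grad x f)) ^ 2)
      ≤ C • ∑ x ∈ band W j N, energy p W x f := by
  set Y := band W j N with hY
  have hpq : 0 ≤ p * (1 - p) := mul_nonneg h0 (sub_nonneg.2 h1)
  have hcomm : ∀ S, ∀ g : (Vertex k → Bool) → ℝ, S ∈ Y.powerset →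
      avg p W (freeInd W j N S * avg p S g) = avg p W (freeInd W j N S * g) := by
    intro S g hS
    rw [← avg_mul_left (freeInd_dependsOn W j N S), avg_avg_of_subset]
    exact (Finset.mem_powerset.1 hS).trans (band_subset W j N)
  calc _ ≤ ∑ x ∈ Y, (p * (1 - p)) • ∑ S ∈ Y.powerset with x ∈ S,
          avg p W (freeInd W j N S * (grad x (avg p (later levelKey S x) f)) ^ 2) :=
        Finset.sum_le_sum fun x hx => smul_le_smul_of_nonneg_left (unblocked_le h0 h1 hx f) hpq
    _ = ∑ S ∈ Y.powerset, ∑ x ∈ S, (p * (1 - p)) •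
          avg p W (freeInd W j N S * (grad x (avg p (later levelKey S x) f)) ^ 2) := by
        simp only [Finset.smul_sum]
        refine Finset.sum_comm' fun x S => ?_
        simp only [Finset.mem_filter, Finset.mem_powerset]
        exact ⟨fun h => ⟨h.2.2, h.2.1⟩, fun h => ⟨h.2 h.1, h.2, h.1⟩⟩
    _ = ∑ S ∈ Y.powerset, avg p W (freeInd W j N S * vr p S f) := by
        refine Finset.sum_congr rfl fun S hS => ?_
        rw [vr_eq_sum_siteVar levelKey levelKey_injective, Finset.mul_sum, avg_sum]
        refine Finset.sum_congr rfl fun x _ => ?_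
        rw [siteVar, mul_smul_comm, avg_smul, hcomm S _ hS]
    _ ≤ ∑ S ∈ Y.powerset, avg p W (freeInd W j N S * (C • ∑ x ∈ S, energy p S x f)) := by
        refine Finset.sum_le_sum fun S hS => avg_mono h0 h1 fun ω => ?_
        refine mul_le_mul_of_nonneg_left ?_ (freeInd_nonneg W j N S ω)
        have := (hP.subset h0 h1 (Finset.mem_powerset.1 hS) hC) f ω
        simpa using this
    _ = ∑ S ∈ Y.powerset, ∑ x ∈ S, C • (p * (1 - p)) •
          avg p W (freeInd W j N S * (cons S x * (grad x f) ^ 2)) := by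
        refine Finset.sum_congr rfl fun S hS => ?_
        rw [mul_smul_comm, avg_smul, Finset.mul_sum, avg_sum, Finset.smul_sum]
        refine Finset.sum_congr rfl fun x _ => ?_
        rw [energy, mul_smul_comm, avg_smul, hcomm S _ hS]
    _ = ∑ x ∈ Y, C • (p * (1 - p)) • avg p W (∑ S ∈ Y.powerset with x ∈ S,
          freeInd W j N S * (cons S x * (grad x f) ^ 2)) := by
        simp only [avg_sum, Finset.smul_sum]
        refine Finset.sum_comm' fun S x => ?_
        simp only [Finset.mem_filter, Finset.mem_powerset]
        exact ⟨fun h => ⟨⟨h.1, h.2⟩, h.1 h.2⟩, fun h => ⟨h.1.1, h.1.2⟩⟩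
    _ ≤ ∑ x ∈ Y, C • energy p W x f := by
        refine Finset.sum_le_sum fun x _ => smul_le_smul_of_nonneg_left ?_ hC
        refine smul_le_smul_of_nonneg_left (avg_mono h0 h1 fun ω => ?_) hpq
        rw [sum_freeInd_mul]
        split_ifs with h
        · have hx : x ∈ freeSites W j N ω := (Finset.mem_filter.1 h).2
          exact mul_le_mul_of_nonneg_right (cons_freeSites hx) (sq_nonneg _)
        · exact mul_nonneg (cons_nonneg W x ω) (sq_nonneg _)
    _ = _ := by rw [Finset.smul_sum]

/-! ### The blocked part of the variance -/

/-- The sites of `W` below `x`, including `x`, down to `n` levels below. -/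
def below (W : Finset (Vertex k)) (n : ℕ) (x : Vertex k) : Finset (Vertex k) :=
  W.filter fun y => x <:+ y ∧ y.length ≤ x.length + n

theorem hit_congr {W : Finset (Vertex k)} (n : ℕ) (x : Vertex k) {ω ω' : Vertex k → Bool}
    (h : ∀ y ∈ (below W n x).erase x, ω y = ω' y) : Hit W n x ω ↔ Hit W n x ω' := by
  induction n generalizing x with
  | zero => simp [Hit]
  | succ n ih =>
    refine exists_congr fun i => and_congr_right fun hi => ?_
    have hmem : i :: x ∈ (below W (n + 1) x).erase x := by
      simp only [below, Finset.mem_erase, Finset.mem_filter, List.length_cons]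
      exact ⟨by simp, hi, List.suffix_cons i x, by omega⟩
    rw [h _ hmem, ih (i :: x) fun y hy => h y ?_]
    simp only [below, Finset.mem_erase, Finset.mem_filter, List.length_cons] at hy ⊢
    refine ⟨?_, hy.2.1, (List.suffix_cons i x).trans hy.2.2.1, by omega⟩
    rintro rfl
    have := hy.2.2.1.length_le
    simp at this

theorem hitInd_dependsOn (W : Finset (Vertex k)) (n : ℕ) (x : Vertex k) :
    DependsOn (hitInd W n x) ((below W n x).erase x : Set (Vertex k)) := by
  intro ω ω' h
  have := hit_congr (W := W) n x (ω := ω) (ω' := ω') (by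
    intro y hy; exact h y (by exact_mod_cast hy))
  unfold hitInd
  by_cases h' : Hit W n x ω
  · rw [if_pos h', if_pos (this.1 h')]
  · rw [if_neg h', if_neg fun h => h' (this.2 h)]

theorem hitInd_nonneg (W : Finset (Vertex k)) (n : ℕ) (x : Vertex k) : 0 ≤ hitInd W n x := by
  intro ω; unfold hitInd; split_ifs <;> simp

theorem hitInd_sq (W : Finset (Vertex k)) (n : ℕ) (x : Vertex k) :
    (hitInd W n x) ^ 2 = hitInd W n x := by
  funext ω; simp only [hitInd, Pi.pow_apply]; split_ifs <;> simp

/-- Blocking is decided by the sites `D` strictly below `x`, so the other later sites `R` can be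
averaged first, giving `g`. Cauchy–Schwarz over `D` produces the factor `ε`. What remains is the
variance of `g` at `x`, on average at most its variance over all of `below W n x`; decomposing the
latter site by site gives terms averaged over at least the later sites of `W`, hence at most the
corresponding `siteVar`. -/
theorem blocked_le (h0 : 0 ≤ p) (h1 : p ≤ 1) {W : Finset (Vertex k)} {x : Vertex k} (hx : x ∈ W)
    (n : ℕ) {ε : ℝ} (hε : ∀ ω, avg p W (hitInd W n x) ω ≤ ε) (f : (Vertex k → Bool) → ℝ) :
    (p * (1 - p)) • avg p W ((avg p (later levelKey W x) (hitInd W n x * grad x f)) ^ 2)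
      ≤ ε • ∑ y ∈ below W n x, siteVar levelKey p W f y := by
  set L := later levelKey W x with hL
  set D := (below W n x).erase x with hD
  set R := L \ D with hR
  have hpq : 0 ≤ p * (1 - p) := mul_nonneg h0 (sub_nonneg.2 h1)
  have hε0 : 0 ≤ ε :=
    (avg_nonneg h0 h1 (hitInd_nonneg W n x) fun _ => false).trans (hε fun _ => false)
  have hxbelow : x ∈ below W n x := by
    simp only [below, Finset.mem_filter]; exact ⟨hx, List.suffix_rfl, by omega⟩
  have hDW : D ⊆ W := (Finset.erase_subset _ _).trans (Finset.filter_subset _ _)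
  have hlen : ∀ y ∈ D, x.length < y.length := by
    intro y hy
    simp only [hD, below, Finset.mem_erase, Finset.mem_filter] at hy
    refine lt_of_le_of_ne hy.2.2.1.length_le fun h => hy.1 ?_
    exact (hy.2.2.1.eq_of_length h).symm
  have hDL : D ⊆ L := by
    intro y hy
    simp only [hL, later, Finset.mem_filter]
    exact ⟨hDW hy, levelKey_lt (hlen y hy)⟩
  have hLe : L = D ∪ R := by rw [hR, Finset.union_sdiff_of_subset hDL]
  have hxR : x ∉ R := fun h => self_notMem_later levelKey W x (Finset.mem_sdiff.1 h).1
  have hxD : x ∉ D := Finset.notMem_erase _ _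
  have hRW : R ⊆ W := Finset.sdiff_subset.trans (later_subset _ _ _)
  set g := avg p R f with hg
  have e1 : avg p L (hitInd W n x * grad x f) = avg p D (hitInd W n x * grad x g) := by
    rw [hLe, avg_union, avg_mul_left, ← grad_avg hxR]
    refine dependsOn_mono (hitInd_dependsOn W n x) ?_
    intro y hy hyR
    exact (Finset.mem_sdiff.1 hyR).2 (by exact_mod_cast hy)
  have hav : ∀ ω, avg p D (hitInd W n x) ω ≤ ε := by
    intro ω
    rw [← avg_eq_of_dependsOn hDW]
    · exact hε ω
    · exact_mod_cast hitInd_dependsOn W n x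
  have e2 : (avg p D (hitInd W n x * grad x g)) ^ 2 ≤ ε • avg p D ((grad x g) ^ 2) := by
    intro ω
    refine (sq_avg_mul_le h0 h1 D _ _ ω).trans ?_
    rw [hitInd_sq]
    exact mul_le_mul_of_nonneg_right (hav ω) (avg_nonneg h0 h1 (fun _ => sq_nonneg _) ω)
  have hins : insert x D = below W n x := Finset.insert_erase hxbelow
  have hBW : below W n x ⊆ W := Finset.filter_subset _ _
  calc (p * (1 - p)) • avg p W ((avg p L (hitInd W n x * grad x f)) ^ 2)
      ≤ (p * (1 - p)) • avg p W (ε • avg p D ((grad x g) ^ 2)) := by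
        rw [e1]
        exact smul_le_smul_of_nonneg_left (avg_mono h0 h1 e2) hpq
    _ = ε • avg p W (avg p (below W n x) (vr p {x} g)) := by
        rw [avg_smul, avg_avg_of_subset hDW, avg_avg_of_subset hBW, vr_singleton, avg_smul,
          smul_comm]
    _ ≤ ε • avg p W (vr p (below W n x) g) := by
        refine smul_le_smul_of_nonneg_left (avg_mono h0 h1 ?_) hε0
        exact avg_vr_le h0 h1 (by simpa using hxbelow) g
    _ = ε • ∑ y ∈ below W n x, (p * (1 - p)) •
          avg p W ((grad y (avg p (later levelKey (below W n x) y ∪ R) f)) ^ 2) := by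
        rw [vr_eq_sum_siteVar levelKey levelKey_injective, avg_sum]
        congr 1
        refine Finset.sum_congr rfl fun y _ => ?_
        rw [siteVar, avg_smul, avg_avg_of_subset hBW, avg_union]
    _ ≤ _ := by
        refine smul_le_smul_of_nonneg_left (Finset.sum_le_sum fun y hy => ?_) hε0
        refine smul_le_smul_of_nonneg_left ?_ hpq
        have hxy : levelKey x ≤ levelKey y := by
          by_cases hyx : y = x
          · rw [hyx]
          · exact (levelKey_lt (hlen y (Finset.mem_erase.2 ⟨hyx, hy⟩))).le
        -- Every site later than `y` is either below `x` or in `R`, because `y` is not earlier than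
        -- `x`.
        refine avg_sq_grad_avg_le h0 h1 ?_ ?_ ?_ f
        · intro z hz
          simp only [later, Finset.mem_filter] at hz
          rw [Finset.mem_union]
          by_cases hzB : z ∈ below W n x
          · left; simp only [later, Finset.mem_filter]; exact ⟨hzB, hz.2⟩
          · right
            rw [hR, Finset.mem_sdiff]
            refine ⟨?_, fun h => hzB (Finset.mem_of_mem_erase h)⟩
            simp only [hL, later, Finset.mem_filter]
            exact ⟨hz.1, hxy.trans_lt hz.2⟩
        · exact Finset.union_subset ((later_subset _ _ _).trans hBW) hRW
        · rw [Finset.mem_union, not_or]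
          refine ⟨self_notMem_later levelKey _ _, fun h => ?_⟩
          rw [hR, Finset.mem_sdiff] at h
          by_cases hyx : y = x
          · exact hxR (hyx ▸ Finset.mem_sdiff.2 h)
          · exact h.2 (Finset.mem_erase.2 ⟨hyx, hy⟩)

/-- The decomposition of the contribution of `x` according to whether `x` is blocked. -/
theorem siteVar_le (h0 : 0 ≤ p) (h1 : p ≤ 1) {W : Finset (Vertex k)} {x : Vertex k} (hx : x ∈ W)
    (n : ℕ) {ε s : ℝ} (hs : 0 < s) (hε : ∀ ω, avg p W (hitInd W n x) ω ≤ ε)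
    (f : (Vertex k → Bool) → ℝ) :
    siteVar levelKey p W f x
      ≤ (1 + s⁻¹) • (p * (1 - p)) •
          avg p W ((avg p (later levelKey W x) ((1 - hitInd W n x) * grad x f)) ^ 2)
        + ((1 + s) * ε) • ∑ y ∈ below W n x, siteVar levelKey p W f y := by
  set L := later levelKey W x with hL
  have hpq : 0 ≤ p * (1 - p) := mul_nonneg h0 (sub_nonneg.2 h1)
  have e1 : grad x (avg p L f)
      = avg p L ((1 - hitInd W n x) * grad x f) + avg p L (hitInd W n x * grad x f) := by
    rw [grad_avg (self_notMem_later levelKey W x), ← avg_add]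
    congr 1
    ring
  have e2 : ∀ a b : (Vertex k → Bool) → ℝ,
      (a + b) ^ 2 ≤ (1 + s⁻¹) • a ^ 2 + (1 + s) • b ^ 2 := by
    intro a b ω
    simp only [Pi.add_apply, Pi.pow_apply, Pi.smul_apply, smul_eq_mul]
    have h3 : s⁻¹ * (a ω - s * b ω) ^ 2 = s⁻¹ * a ω ^ 2 - 2 * (a ω * b ω) + s * b ω ^ 2 := by
      field_simp; ring
    have h4 : 0 ≤ s⁻¹ * (a ω - s * b ω) ^ 2 := by positivity
    nlinarith
  have e3 := smul_le_smul_of_nonneg_left (avg_mono h0 h1 (A := W) (e2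
    (avg p L ((1 - hitInd W n x) * grad x f)) (avg p L (hitInd W n x * grad x f)))) hpq
  rw [← e1, avg_add, avg_smul, avg_smul, smul_add, smul_comm _ (1 + s⁻¹), smul_comm _ (1 + s)] at e3
  refine e3.trans (add_le_add le_rfl ?_)
  rw [mul_smul (1 + s) ε]
  exact smul_le_smul_of_nonneg_left (blocked_le h0 h1 hx n hε f) (by linarith : (0 : ℝ) ≤ 1 + s)

/-! ### The probability of long occupied paths -/

section Independence

variable {V : Type} {p : ℝ}

/-- The occupation variable at `x`. -/
def occ (x : V) (ω : V → Bool) : ℝ := if ω x = true then 1 else 0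

theorem occ_dependsOn (x : V) : DependsOn (occ x) ({x} : Set V) := by
  intro ω ω' h
  simp only [occ, h x rfl]

variable [DecidableEq V]

theorem avg_prod_of_disjoint {ι : Type*} (A : Finset V) (s : Finset ι) (B : ι → Finset V)
    (f : ι → (V → Bool) → ℝ) (hB : ∀ i ∈ s, B i ⊆ A)
    (hdis : ∀ i ∈ s, ∀ j ∈ s, i ≠ j → Disjoint (B i) (B j))
    (hf : ∀ i ∈ s, DependsOn (f i) (B i : Set V)) :
    avg p A (∏ i ∈ s, f i) = ∏ i ∈ s, avg p A (f i) := by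
  classical
  induction s using Finset.induction_on with
  | empty => simp [avg_one]
  | insert i s hi ih =>
    rw [Finset.prod_insert hi, Finset.prod_insert hi,
      avg_mul_of_disjoint (hB i (by simp)) (hf i (by simp)), ih]
    · exact fun j hj => hB j (by simp [hj])
    · exact fun j hj l hl => hdis j (by simp [hj]) l (by simp [hl])
    · exact fun j hj => hf j (by simp [hj])
    · refine dependsOn_prod s fun j hj => dependsOn_mono (hf j (by simp [hj])) ?_
      intro y hy hyi
      have hne : i ≠ j := fun h => hi (h ▸ hj)
      exact Finset.disjoint_left.1 (hdis i (by simp) j (by simp [hj]) hne)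
        (by exact_mod_cast hyi) (by exact_mod_cast hy)

theorem avg_occ {A : Finset V} {x : V} (hx : x ∈ A) : avg p A (occ x) = fun _ => p := by
  rw [avg_eq_of_dependsOn (U := {x}) (by simpa using hx) (by simpa using occ_dependsOn x),
    avg_singleton]
  funext ω
  simp [siteMean_eq, occ]

end Independence

variable {k : ℕ} {p : ℝ}

/-- A bound for the probability that an occupied path of length `n` starts below a given vertex. -/
def hitBound (p : ℝ) (k : ℕ) : ℕ → ℝ
  | 0 => 1
  | n + 1 => 1 - (1 - p * hitBound p k n) ^ k

theorem hitBound_mem (h0 : 0 ≤ p) (h1 : p ≤ 1) (n : ℕ) :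
    0 ≤ hitBound p k n ∧ hitBound p k n ≤ 1 := by
  induction n with
  | zero => simp [hitBound]
  | succ n ih =>
    have h2 : 0 ≤ p * hitBound p k n := mul_nonneg h0 ih.1
    have h3 : p * hitBound p k n ≤ 1 := mul_le_one₀ h1 ih.1 ih.2
    have h4 : 0 ≤ 1 - p * hitBound p k n := by linarith
    have h5 : (1 - p * hitBound p k n) ^ k ≤ 1 := pow_le_one₀ h4 (by linarith)
    have h6 : 0 ≤ (1 - p * hitBound p k n) ^ k := pow_nonneg h4 k
    simp only [hitBound]
    constructor <;> linarith

theorem below_disjoint (W : Finset (Vertex k)) (n : ℕ) {y z : Vertex k}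
    (hl : y.length = z.length) (h : y ≠ z) : Disjoint (below W n y) (below W n z) := by
  rw [Finset.disjoint_left]
  intro w hy hz
  simp only [below, Finset.mem_filter] at hy hz
  exact h ((List.suffix_of_suffix_length_le hy.2.1 hz.2.1 hl.le).eq_of_length hl)

/-- No path starts below `x` exactly when each child fails to start one, and the children's subtrees
are independent. Children missing from `W` never start a path, which is why only an inequality
holds. -/
theorem avg_hitInd_le (h0 : 0 ≤ p) (h1 : p ≤ 1) (W : Finset (Vertex k)) (n : ℕ) (x : Vertex k)
    (ω : Vertex k → Bool) : avg p W (hitInd W n x) ω ≤ hitBound p k n := by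
  induction n generalizing x with
  | zero =>
    have : hitInd W 0 x = 1 := by funext ω; simp [hitInd, Hit]
    rw [this, avg_one]
    simp [hitBound]
  | succ n ih =>
    set g : Fin k → (Vertex k → Bool) → ℝ := fun i =>
      if i :: x ∈ W then occ (i :: x) * hitInd W n (i :: x) else 0 with hg
    have hgd : ∀ i, DependsOn (g i) (below W n (i :: x) : Set (Vertex k)) := by
      intro i
      simp only [hg]
      split_ifs with hi
      · refine dependsOn_mul (dependsOn_mono (occ_dependsOn _) ?_)
          (dependsOn_mono (hitInd_dependsOn W n _) ?_)
        · intro y hy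
          rw [Set.mem_singleton_iff] at hy
          subst hy
          simp [below, hi]
        · exact_mod_cast Finset.erase_subset _ _
      · exact dependsOn_mono (dependsOn_const 0) (by simp)
    have e1 : hitInd W (n + 1) x = 1 - ∏ i, (1 - g i) := by
      funext ω
      simp only [Pi.sub_apply, Pi.one_apply, Finset.prod_apply, hg]
      by_cases h : Hit W (n + 1) x ω
      · rw [hitInd, if_pos h]
        obtain ⟨i, hi, ho, hh⟩ := h
        rw [Finset.prod_eq_zero (Finset.mem_univ i)]
        · simp
        · simp [hi, occ, ho, hitInd, hh]
      · rw [hitInd, if_neg h, Finset.prod_eq_one, sub_self]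
        intro i _
        by_cases hi : i :: x ∈ W
        · by_cases ho : ω (i :: x) = true
          · by_cases hh : Hit W n (i :: x) ω
            · exact absurd ⟨i, hi, ho, hh⟩ h
            · simp [hi, hitInd, hh]
          · simp [hi, occ, ho]
        · simp [hi]
    have hgle : ∀ i, avg p W (g i) ω ≤ p * hitBound p k n := by
      intro i
      have hb := (hitBound_mem (k := k) h0 h1 n).1
      simp only [hg]
      split_ifs with hi
      · rw [avg_mul_of_disjoint (S := {i :: x}) (by simpa using hi)
          (by simpa using occ_dependsOn (i :: x)) ?_, avg_occ hi]
        · exact mul_le_mul_of_nonneg_left (ih _) h0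
        · refine dependsOn_mono (hitInd_dependsOn W n _) ?_
          intro y hy
          simpa using (Finset.mem_erase.1 (by exact_mod_cast hy)).1
      · rw [avg_zero]; exact mul_nonneg h0 hb
    rw [e1, avg_sub, avg_one, avg_prod_of_disjoint W Finset.univ (fun i => below W n (i :: x))
      (fun i => 1 - g i) (fun i _ => Finset.filter_subset _ _)]
    · simp only [Pi.sub_apply, Pi.one_apply, Finset.prod_apply, hitBound]
      have : ∏ _i : Fin k, (1 - p * hitBound p k n) ≤ ∏ i, avg p W (1 - g i) ω := by
        refine Finset.prod_le_prod (fun i _ => ?_) fun i _ => ?_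
        · have hb := hitBound_mem (k := k) h0 h1 n
          have : p * hitBound p k n ≤ 1 := mul_le_one₀ h1 hb.1 hb.2
          linarith
        · rw [avg_sub, avg_one]
          simp only [Pi.sub_apply, Pi.one_apply]
          linarith [hgle i]
      rw [Finset.prod_const, Finset.card_univ, Fintype.card_fin] at this
      linarith
    · intro i _ j _ hij
      exact below_disjoint W n (by simp) (by simpa using hij)
    · intro i _
      exact dependsOn_comp₂ (hgd i) (hgd i) (fun a _ => 1 - a)

theorem hitBound_succ_le (h0 : 0 ≤ p) (h1 : p ≤ 1) (n : ℕ) :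
    hitBound p k (n + 1) ≤ k * p * hitBound p k n := by
  have hb := hitBound_mem (k := k) h0 h1 n
  have h3 : p * hitBound p k n ≤ 1 := mul_le_one₀ h1 hb.1 hb.2
  have := one_add_mul_le_pow (a := -(p * hitBound p k n)) (by linarith) k
  simp only [hitBound]
  rw [← sub_eq_add_neg] at this
  linarith

theorem hitBound_le_pow (h0 : 0 ≤ p) (h1 : p ≤ 1) (n : ℕ) : hitBound p k n ≤ (k * p) ^ n := by
  induction n with
  | zero => simp [hitBound]
  | succ n ih =>
    refine (hitBound_succ_le h0 h1 n).trans ?_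
    rw [pow_succ']
    exact mul_le_mul_of_nonneg_left ih (by positivity)

/-- Bernoulli's inequality with exponent `k / 2 ≥ 1`; at mean offspring one this compares `k`
children with two. -/
theorem sq_one_sub_half_le {k : ℕ} (hk : 2 ≤ k) {e : ℝ} (he1 : e ≤ 1) :
    (1 - e / 2) ^ 2 ≤ (1 - e / k) ^ k := by
  have hk' : (2 : ℝ) ≤ k := by exact_mod_cast hk
  have hek : e / k ≤ 1 := by rw [div_le_one (by linarith)]; linarith
  have h := one_add_mul_self_le_rpow_one_add (s := -(e / k)) (by linarith)
    (p := (k : ℝ) / 2) (by linarith)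
  have e1 : 1 + (k : ℝ) / 2 * -(e / k) = 1 - e / 2 := by field_simp; ring
  rw [e1, ← sub_eq_add_neg] at h
  calc (1 - e / 2) ^ 2 ≤ ((1 - e / k) ^ ((k : ℝ) / 2)) ^ 2 :=
        pow_le_pow_left₀ (by linarith) h 2
    _ = (1 - e / k) ^ k := by
        rw [← Real.rpow_natCast, ← Real.rpow_mul (by linarith), ← Real.rpow_natCast]
        congr 1
        push_cast
        ring

/-- Comparison with the binary case gives the recursion `e - e ^ 2 / 4`, whose solutions decay like
`4 / n`. -/
theorem hitBound_le_critical (hk : 2 ≤ k) (h0 : 0 ≤ p) (hp : p ≤ 1 / k) (n : ℕ) :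
    hitBound p k n ≤ 4 / (n + 4) := by
  have hk' : (2 : ℝ) ≤ k := by exact_mod_cast hk
  have h1 : p ≤ 1 := hp.trans (by rw [div_le_one (by linarith)]; linarith)
  induction n with
  | zero => simp [hitBound]
  | succ n ih =>
    have hb := hitBound_mem (k := k) h0 h1 n
    set e := hitBound p k n
    have h2 : (1 - e / k) ^ k ≤ (1 - p * e) ^ k := by
      have h3 : p * e ≤ e / k := by
        rw [div_eq_mul_one_div, mul_comm p e]; exact mul_le_mul_of_nonneg_left hp hb.1
      refine pow_le_pow_left₀ ?_ (by linarith) k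
      rw [sub_nonneg, div_le_one (by linarith)]; linarith
    have h4 := sq_one_sub_half_le hk hb.2
    have h5 : hitBound p k (n + 1) ≤ e - e ^ 2 / 4 := by
      simp only [hitBound]; nlinarith
    refine h5.trans ?_
    have hn : (0 : ℝ) ≤ n := Nat.cast_nonneg n
    have h7 : (4 : ℝ) / (n + 4) ≤ 1 := by rw [div_le_one (by linarith)]; linarith
    -- The map `e ↦ e - e ^ 2 / 4` is increasing on `[0, 1]`, where both arguments lie.
    have h6 : e - e ^ 2 / 4 ≤ 4 / (n + 4) - (4 / (n + 4)) ^ 2 / 4 := by nlinarith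
    refine h6.trans ?_
    push_cast
    rw [div_pow, div_div, div_sub_div _ _ (by positivity) (by positivity),
      div_le_div_iff₀ (by positivity) (by positivity)]
    nlinarith [pow_nonneg hn 2, pow_nonneg hn 3]

/-! ### Slabs and recursions for the Poincaré constant -/

theorem mem_tree {L : ℕ} {x : Vertex k} : x ∈ tree k L ↔ x.length ≤ L := by simp [tree]

/-- The vertices between the levels `j` and `j + h`. -/
def slab (k j h : ℕ) : Finset (Vertex k) := (tree k (j + h)).filter fun x => j ≤ x.length

theorem mem_slab {j h : ℕ} {x : Vertex k} :
    x ∈ slab k j h ↔ j ≤ x.length ∧ x.length ≤ j + h := by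
  simp [slab, mem_tree, and_comm]

theorem slab_zero (L : ℕ) : slab k 0 L = tree k L := by
  ext x; simp [mem_slab, mem_tree]

/-- The Poincaré inequality with constant `C` on all slabs of depth `h`. -/
def SlabPoincare (k : ℕ) (p : ℝ) (h : ℕ) (C : ℝ) : Prop := ∀ j, Poincare p (slab k j h) C

/-- Within a single level there are no constraints, so this is tensorization of the variance for
independent spins, by Jensen applied to each term. -/
theorem slabPoincare_zero (h0 : 0 ≤ p) (h1 : p ≤ 1) : SlabPoincare k p 0 1 := by
  intro j f ω
  rw [vr_eq_sum_siteVar levelKey levelKey_injective, Finset.sum_apply, one_mul]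
  refine Finset.sum_le_sum fun x hx => ?_
  have hc : cons (slab k j 0) x = 1 := by
    funext ω
    unfold cons
    rw [if_pos]
    · rfl
    · intro i hi
      rw [mem_slab] at hx hi
      simp only [List.length_cons] at hi
      omega
  rw [energy, hc, one_mul, siteVar, grad_avg (self_notMem_later _ _ _)]
  have h := avg_mono h0 h1 (A := slab k j 0)
    (sq_avg_le h0 h1 (later levelKey (slab k j 0) x) (grad x f))
  rw [avg_avg_of_subset (later_subset _ _ _)] at h
  exact mul_le_mul_of_nonneg_left (h ω) (mul_nonneg h0 (sub_nonneg.2 h1))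

/-- The sites deeper than some level contribute as the process on those sites. -/
theorem sum_siteVar_deep_le (h0 : 0 ≤ p) (h1 : p ≤ 1) (W : Finset (Vertex k)) (m : ℕ) {C : ℝ}
    (hP : Poincare p (W.filter fun x => m ≤ x.length) C) (f : (Vertex k → Bool) → ℝ)
    (ω : Vertex k → Bool) :
    ∑ x ∈ W with m ≤ x.length, siteVar levelKey p W f x ω
      ≤ C * ∑ x ∈ W with m ≤ x.length, energy p W x f ω := by
  set B := W.filter fun x => m ≤ x.length with hB
  have hBW : B ⊆ W := Finset.filter_subset _ _
  have hle : ∀ {x y : Vertex k}, levelKey x < levelKey y → x.length ≤ y.length := by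
    intro x y h
    by_contra h'
    exact lt_asymm h (levelKey_lt (not_le.1 h'))
  have e1 : ∑ x ∈ B, siteVar levelKey p W f x = avg p W (vr p B f) := by
    rw [vr_eq_sum_siteVar levelKey levelKey_injective, avg_sum]
    refine Finset.sum_congr rfl fun x hx => ?_
    -- Later sites are at least as deep, so for a site of `B` they all lie in `B`.
    have : later levelKey B x = later levelKey W x := by
      ext y
      simp only [later, hB, Finset.mem_filter] at hx ⊢
      exact ⟨fun h => ⟨h.1.1, h.2⟩, fun h => ⟨⟨h.1, hx.2.trans (hle h.2)⟩, h.2⟩⟩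
    rw [siteVar, siteVar, avg_smul, avg_avg_of_subset hBW, this]
  have e2 : avg p W (vr p B f) ≤ avg p W (C • ∑ x ∈ B, energy p B x f) :=
    avg_mono h0 h1 fun ω => by simpa using hP f ω
  have e3 : avg p W (C • ∑ x ∈ B, energy p B x f) = C • ∑ x ∈ B, energy p W x f := by
    rw [avg_smul, avg_sum]
    congr 1
    refine Finset.sum_congr rfl fun x hx => ?_
    have : cons B x = cons W x := by
      funext ω
      have hiff : (∀ i : Fin k, i :: x ∈ B → ω (i :: x) = false) ↔
          ∀ i : Fin k, i :: x ∈ W → ω (i :: x) = false := by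
        refine forall_congr' fun i => imp_congr_left ?_
        simp only [hB, Finset.mem_filter, List.length_cons] at hx ⊢
        exact ⟨fun h => h.1, fun h => ⟨h, by omega⟩⟩
      simp only [cons, hiff]
    rw [energy, energy, avg_smul, avg_avg_of_subset hBW, this]
  have := e2 ω
  rw [e3, ← e1] at this
  simpa using this

/-- The contribution of the sites of the levels from `j` to `j + m - 1`. -/
theorem sum_siteVar_band_le (h0 : 0 ≤ p) (h1 : p ≤ 1) (W : Finset (Vertex k)) (j m M : ℕ)
    (hmM : m ≤ M) {C s ε : ℝ} (hC : 0 ≤ C) (hP : Poincare p (band W j (j + M)) C) (hs : 0 < s)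
    (hε : ∀ n, M < n + m → hitBound p k n ≤ ε) (f : (Vertex k → Bool) → ℝ)
    (ω : Vertex k → Bool) :
    ∑ x ∈ band W j (j + m), siteVar levelKey p W f x ω
      ≤ (1 + s⁻¹) * C * ∑ x ∈ band W j (j + M), energy p W x f ω
        + (1 + s) * ε * ∑ x ∈ band W j (j + m),
            ∑ y ∈ below W (j + M - x.length) x, siteVar levelKey p W f y ω := by
  have hpq : 0 ≤ p * (1 - p) := mul_nonneg h0 (sub_nonneg.2 h1)
  have hsub : band W j (j + m) ⊆ band W j (j + M) := by
    intro x hx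
    simp only [band, Finset.mem_filter] at hx ⊢
    exact ⟨hx.1, hx.2.1, by omega⟩
  have hx1 : ∀ x ∈ band W j (j + m), siteVar levelKey p W f x ω ≤
      (1 + s⁻¹) * ((p * (1 - p)) • avg p W ((avg p (later levelKey W x)
          ((1 - hitInd W (j + M - x.length) x) * grad x f)) ^ 2)) ω
        + (1 + s) * ε * ∑ y ∈ below W (j + M - x.length) x, siteVar levelKey p W f y ω := by
    intro x hx
    simp only [band, Finset.mem_filter] at hx
    have := siteVar_le h0 h1 hx.1 (j + M - x.length) hs
      (fun ω => (avg_hitInd_le h0 h1 W _ x ω).trans (hε _ (by omega))) f ω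
    simpa using this
  refine (Finset.sum_le_sum hx1).trans ?_
  rw [Finset.sum_add_distrib, ← Finset.mul_sum, ← Finset.mul_sum, mul_assoc (1 + s⁻¹) C]
  refine add_le_add (mul_le_mul_of_nonneg_left ?_ (by positivity : (0 : ℝ) ≤ 1 + s⁻¹)) le_rfl
  have := sum_unblocked_le h0 h1 hC hP f ω
  simp only [Finset.sum_apply, Pi.smul_apply, smul_eq_mul] at this ⊢
  refine le_trans (Finset.sum_le_sum_of_subset_of_nonneg hsub fun x _ _ => ?_) this
  exact mul_nonneg hpq (avg_nonneg h0 h1 (fun _ => sq_nonneg _) ω)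

theorem card_suffixes_le (T : Finset (Vertex k)) (y : Vertex k) (I : Finset ℕ)
    (hT : ∀ x ∈ T, x <:+ y ∧ x.length ∈ I) : T.card ≤ I.card := by
  refine Finset.card_le_card_of_injOn List.length (fun x hx => (hT x hx).2) ?_
  intro x hx x' hx' h
  exact (List.suffix_of_suffix_length_le (hT x hx).1 (hT x' hx').1 (le_of_eq h)).eq_of_length h

/-- Exchange the sums: `y` is counted once for each ancestor in `X` that sees it, and the ancestors
of `y` are determined by their lengths. -/
theorem sum_below_le (X W : Finset (Vertex k)) (n : Vertex k → ℕ) (K : ℕ)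
    (g : Vertex k → ℝ) (hg : ∀ y ∈ W, 0 ≤ g y) (I : Vertex k → Finset ℕ)
    (hI : ∀ x ∈ X, ∀ y ∈ W, x <:+ y → y.length ≤ x.length + n x → x.length ∈ I y)
    (hcard : ∀ y ∈ W, (I y).card ≤ K) :
    ∑ x ∈ X, ∑ y ∈ below W (n x) x, g y ≤ K * ∑ y ∈ W, g y := by
  have e : ∑ x ∈ X, ∑ y ∈ below W (n x) x, g y
      = ∑ y ∈ W, ∑ x ∈ X with x <:+ y ∧ y.length ≤ x.length + n x, g y := by
    refine Finset.sum_comm' fun x y => ?_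
    simp only [below, Finset.mem_filter]
    tauto
  rw [e, Finset.mul_sum]
  refine Finset.sum_le_sum fun y hy => ?_
  rw [Finset.sum_const, nsmul_eq_mul]
  refine mul_le_mul_of_nonneg_right ?_ (hg y hy)
  have := card_suffixes_le (X.filter fun x => x <:+ y ∧ y.length ≤ x.length + n x) y (I y) (by
    intro x hx
    simp only [Finset.mem_filter] at hx
    exact ⟨hx.2.1, hI x hx.1 y hy hx.2.1 hx.2.2⟩)
  exact_mod_cast this.trans (hcard y hy)

/-- Slabs are treated by splitting off their first `m` levels. -/
theorem slab_step (h0 : 0 ≤ p) (h1 : p ≤ 1) {L m M : ℕ} (hmM : m ≤ M) (hm : 1 ≤ m)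
    (hML : M ≤ L + 1) (hmL : m ≤ L) {C C' s ε : ℝ} (hC : 0 ≤ C)
    (hP : SlabPoincare k p (M - 1) C) (hP' : SlabPoincare k p (L - m) C') (hs : 0 < s)
    (hε0 : 0 ≤ ε) (hε : ∀ n, M < n + m → hitBound p k n ≤ ε) (j : ℕ)
    (f : (Vertex k → Bool) → ℝ) (ω : Vertex k → Bool) (hC' : 0 ≤ C') :
    vr p (slab k j L) f ω
      ≤ ((1 + s⁻¹) * C + C') * ∑ x ∈ slab k j L, energy p (slab k j L) x f ω
        + (1 + s) * ε * m * vr p (slab k j L) f ω := by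
  set W := slab k j L with hW
  have hband : band W j (j + M) = slab k j (M - 1) := by
    ext x
    simp only [band, hW, Finset.mem_filter, mem_slab]
    omega
  have hdeep : W.filter (fun x => j + m ≤ x.length) = slab k (j + m) (L - m) := by
    ext x
    simp only [hW, Finset.mem_filter, mem_slab]
    omega
  have hsplit : band W j (j + m) = W.filter fun x => ¬ j + m ≤ x.length := by
    ext x
    simp only [band, hW, Finset.mem_filter, mem_slab]
    omega
  have hV : ∀ y, 0 ≤ siteVar levelKey p W f y ω := fun y => siteVar_nonneg _ h0 h1 W f y ω
  have hE : ∀ y, 0 ≤ energy p W y f ω := fun y => energy_nonneg h0 h1 W y f ω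
  have e0 : vr p W f ω = ∑ x ∈ W, siteVar levelKey p W f x ω := by
    rw [vr_eq_sum_siteVar levelKey levelKey_injective, Finset.sum_apply]
  have e1 := sum_siteVar_deep_le h0 h1 W (j + m) (C := C') (by rw [hdeep]; exact hP' _) f ω
  have e2 := sum_siteVar_band_le h0 h1 W j m M hmM hC (by rw [hband]; exact hP j) hs hε f ω
  -- A site has at most one ancestor on each of the `m` top levels, whence the factor `m`.
  have e3 := sum_below_le (band W j (j + m)) W (fun x => j + M - x.length) m
    (fun y => siteVar levelKey p W f y ω) (fun y _ => hV y) (fun _ => Finset.Ico j (j + m))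
    (by
      intro x hx y _ _ _
      simp only [band, Finset.mem_filter] at hx
      exact Finset.mem_Ico.2 hx.2) (by simp)
  rw [← e0] at e3
  have e4 : ∑ x ∈ band W j (j + M), energy p W x f ω ≤ ∑ x ∈ W, energy p W x f ω :=
    Finset.sum_le_sum_of_subset_of_nonneg (band_subset _ _ _) fun x _ _ => hE x
  have e5 : ∑ x ∈ W with j + m ≤ x.length, energy p W x f ω ≤ ∑ x ∈ W, energy p W x f ω :=
    Finset.sum_le_sum_of_subset_of_nonneg (Finset.filter_subset _ _) fun x _ _ => hE x
  have e6 : vr p W f ω = ∑ x ∈ W with j + m ≤ x.length, siteVar levelKey p W f x ω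
      + ∑ x ∈ band W j (j + m), siteVar levelKey p W f x ω := by
    rw [e0, hsplit, Finset.sum_filter_add_sum_filter_not]
  have e7 := mul_le_mul_of_nonneg_left e3 (by positivity : 0 ≤ (1 + s) * ε)
  have e8 := mul_le_mul_of_nonneg_left e4 (by positivity : 0 ≤ (1 + s⁻¹) * C)
  have e9 := mul_le_mul_of_nonneg_left e5 hC'
  linarith

/-- A crude recursion valid at every density, splitting off one level. Since `s` bounds from below
the probability that all children are empty, `ε = 1 - s` is admissible; with the same `s` as weight,
`(1 + s) * ε = 1 - s ^ 2` and a fraction `s ^ 2` of the variance survives the absorption. -/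
theorem slabPoincare_succ (h0 : 0 ≤ p) (h1 : p ≤ 1) {s : ℝ} (hs : 0 < s) (hsp : s ≤ (1 - p) ^ k)
    {L : ℕ} {C : ℝ} (hC : 1 ≤ C) (hP : SlabPoincare k p L C) :
    SlabPoincare k p (L + 1) ((s ^ 2)⁻¹ * (2 + s⁻¹) * C) := by
  intro j f ω
  have hs1 : s ≤ 1 := hsp.trans (pow_le_one₀ (by linarith) (by linarith))
  have h := slab_step h0 h1 (k := k) (L := L + 1) (m := 1) (M := 1) le_rfl le_rfl (by omega)
    (by omega) zero_le_one (slabPoincare_zero h0 h1) hP hs (ε := 1 - s) (by linarith) (by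
      intro n hn
      have hn' : 1 ≤ n := by omega
      clear hn
      induction n, hn' using Nat.le_induction with
      | base => simp only [hitBound, mul_one]; linarith
      | succ n hn ih =>
        have hb := hitBound_mem (k := k) h0 h1 n
        have : (1 - p) ^ k ≤ (1 - p * hitBound p k n) ^ k :=
          pow_le_pow_left₀ (by linarith) (by nlinarith) k
        simp only [hitBound]; linarith) j f ω (by linarith)
  set E := ∑ x ∈ slab k j (L + 1), energy p (slab k j (L + 1)) x f ω with hE
  set v := vr p (slab k j (L + 1)) f ω
  have hE0 : 0 ≤ E := Finset.sum_nonneg fun x _ => energy_nonneg h0 h1 _ x f ω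
  have hsi : 0 < s⁻¹ := inv_pos.2 hs
  have h2 : s ^ 2 * v ≤ (2 + s⁻¹) * C * E := by
    have : ((1 + s⁻¹) * 1 + C) * E ≤ (2 + s⁻¹) * C * E :=
      mul_le_mul_of_nonneg_right (by nlinarith) hE0
    push_cast at h
    nlinarith
  calc v = (s ^ 2)⁻¹ * (s ^ 2 * v) := by field_simp
    _ ≤ (s ^ 2)⁻¹ * ((2 + s⁻¹) * C * E) := mul_le_mul_of_nonneg_left h2 (by positivity)
    _ = _ := by ring

theorem slabPoincare_pow (h0 : 0 ≤ p) (h1 : p ≤ 1) {s : ℝ} (hs : 0 < s) (hsp : s ≤ (1 - p) ^ k)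
    (L : ℕ) : SlabPoincare k p L (((s ^ 2)⁻¹ * (2 + s⁻¹)) ^ L) := by
  have hs1 : s ≤ 1 := hsp.trans (pow_le_one₀ (by linarith) (by linarith))
  have hK : 1 ≤ (s ^ 2)⁻¹ * (2 + s⁻¹) := by
    have h2 : 1 ≤ (s ^ 2)⁻¹ := (one_le_inv₀ (by positivity)).2 (pow_le_one₀ hs.le hs1)
    have h3 : 0 < s⁻¹ := inv_pos.2 hs
    nlinarith
  induction L with
  | zero => simpa using slabPoincare_zero h0 h1
  | succ L ih =>
    rw [pow_succ']
    exact slabPoincare_succ h0 h1 hs hsp (one_le_pow₀ hK) ih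

/-- Take `M = L - m + 1`: the band `M` and the part below the top `m` levels are then both slabs of
depth `L - m`. The relevant paths have length at least `L - 2 * m + 2`, and the hypothesis on `m`
makes their probability at most `1 / (4 * m)`. -/
theorem slabPoincare_critical_step (hk : 2 ≤ k) (h0 : 0 ≤ p) (hp : p ≤ 1 / k) {L m : ℕ}
    (hm : 1 ≤ m) (hmL : 18 * m ≤ L + 5) {C : ℝ} (hC : 0 ≤ C) (hP : SlabPoincare k p (L - m) C) :
    SlabPoincare k p L (6 * C) := by
  intro j f ω
  have hk' : (2 : ℝ) ≤ k := by exact_mod_cast hk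
  have h1 : p ≤ 1 := hp.trans (by rw [div_le_one (by linarith)]; linarith)
  have hm' : (1 : ℝ) ≤ m := by exact_mod_cast hm
  have h := slab_step h0 h1 (k := k) (L := L) (m := m) (M := L - m + 1) (by omega) hm (by omega)
    (by omega) hC (by simpa using hP) hP one_pos (ε := 1 / (4 * m)) (by positivity) (by
      intro n hn
      refine (hitBound_le_critical hk h0 hp n).trans ?_
      rw [div_le_div_iff₀ (by positivity) (by positivity)]
      have : 16 * m ≤ n + 4 := by omega
      have : (16 : ℝ) * m ≤ n + 4 := by exact_mod_cast this
      linarith) j f ω hC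
  -- Half of the variance is absorbed, so `2 * C + C` doubles to `6 * C`.
  have e : (1 + 1 : ℝ) * (1 / (4 * m)) * m = 1 / 2 := by field_simp; norm_num
  rw [e, inv_one] at h
  linarith

/-- Strong induction: `L + 1` shrinks by a factor `30 / 31` or better at the price of a factor 6,
and `(31 / 30) ^ 150 ≥ 6`. Depths up to 12, too small for the step, use the crude bound. -/
theorem slabPoincare_critical (hk : 2 ≤ k) (h0 : 0 ≤ p) (hp : p ≤ 1 / k) {s : ℝ} (hs : 0 < s)
    (hsp : s ≤ (1 - p) ^ k) (L : ℕ) :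
    SlabPoincare k p L (((s ^ 2)⁻¹ * (2 + s⁻¹)) ^ 12 * ((L : ℝ) + 1) ^ 150) := by
  have hk' : (2 : ℝ) ≤ k := by exact_mod_cast hk
  have h1 : p ≤ 1 := hp.trans (by rw [div_le_one (by linarith)]; linarith)
  have hs1 : s ≤ 1 := hsp.trans (pow_le_one₀ (by linarith) (by linarith))
  have hK : 1 ≤ (s ^ 2)⁻¹ * (2 + s⁻¹) := by
    have h2 : 1 ≤ (s ^ 2)⁻¹ := (one_le_inv₀ (by positivity)).2 (pow_le_one₀ hs.le hs1)
    have h3 : 0 < s⁻¹ := inv_pos.2 hs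
    nlinarith
  set K := (s ^ 2)⁻¹ * (2 + s⁻¹) with hKdef
  induction L using Nat.strong_induction_on with
  | _ L ih =>
    by_cases hL : L ≤ 12
    · refine fun j => (slabPoincare_pow h0 h1 hs hsp L j).mono_const h0 h1 ?_
      have h2 : K ^ L ≤ K ^ 12 := pow_le_pow_right₀ hK hL
      have h3 : (1 : ℝ) ≤ ((L : ℝ) + 1) ^ 150 :=
        one_le_pow₀ (by linarith [(Nat.cast_nonneg L : (0 : ℝ) ≤ L)])
      exact h2.trans (le_mul_of_one_le_right (by positivity) h3)
    -- The largest `m` that the step allows; it is positive because `L ≥ 13`.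
    · obtain ⟨m, hm1, hm2, hm3⟩ : ∃ m : ℕ, 1 ≤ m ∧ 18 * m ≤ L + 5 ∧ L + 1 ≤ 31 * m :=
        ⟨(L + 5) / 18, by omega, by omega, by omega⟩
      have h2 := slabPoincare_critical_step hk h0 hp hm1 hm2 (by positivity) (ih (L - m) (by omega))
      refine fun j => (h2 j).mono_const h0 h1 ?_
      have hcast : ((L - m : ℕ) : ℝ) = (L : ℝ) - m := by
        rw [Nat.cast_sub (by omega)]
      have hm3' : (L : ℝ) + 1 ≤ 31 * m := by exact_mod_cast hm3
      have hLm : (m : ℝ) ≤ L := by exact_mod_cast (by omega : m ≤ L)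
      obtain ⟨a, ha⟩ : ∃ a : ℝ, a = (L : ℝ) - m + 1 := ⟨_, rfl⟩
      have ha0 : 0 < a := by linarith
      obtain ⟨r, hr, h5⟩ : ∃ r : ℝ, r = 1 + 1 / 30 ∧ 6 ≤ r ^ 150 := by
        refine ⟨_, rfl, le_trans (by norm_num) (one_add_mul_le_pow (a := (1 / 30 : ℝ))
          (by norm_num) 150)⟩
      have hr0 : 0 < r := by rw [hr]; norm_num
      have hb : a * r ≤ (L : ℝ) + 1 := by rw [hr]; linarith
      have h6 : 6 * a ^ 150 ≤ ((L : ℝ) + 1) ^ 150 :=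
        calc 6 * a ^ 150 ≤ r ^ 150 * a ^ 150 :=
              mul_le_mul_of_nonneg_right h5 (by positivity)
          _ = (a * r) ^ 150 := by rw [mul_pow, mul_comm]
          _ ≤ _ := pow_le_pow_left₀ (by positivity) hb 150
      rw [hcast, ← ha, mul_left_comm]
      exact mul_le_mul_of_nonneg_left h6 (by positivity)

/-- Here each level is the top of its own band of `M` levels, so nothing is lost in `L`: a site's
energy is counted in at most `M` bands and a site has at most `M + 1` ancestors (itself included)
within distance `M`. By the smallness of `ε * (M + 1)`, half of the variance is absorbed. -/
theorem slabPoincare_of_hitBound (h0 : 0 ≤ p) (h1 : p ≤ 1) {M : ℕ} (hM : 1 ≤ M) {ε : ℝ}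
    (hε0 : 0 ≤ ε) (hε : ∀ n, M ≤ n → hitBound p k n ≤ ε) (hεM : ε * (M + 1) ≤ 1 / 4) {C : ℝ}
    (hC : 0 ≤ C) (hP : SlabPoincare k p (M - 1) C) (L : ℕ) :
    Poincare p (tree k L) (4 * M * C) := by
  intro f ω
  set W := tree k L with hW
  have hV : ∀ y, 0 ≤ siteVar levelKey p W f y ω := fun y => siteVar_nonneg _ h0 h1 W f y ω
  have hE : ∀ y, 0 ≤ energy p W y f ω := fun y => energy_nonneg h0 h1 W y f ω
  have e0 : vr p W f ω = ∑ x ∈ W, siteVar levelKey p W f x ω := by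
    rw [vr_eq_sum_siteVar levelKey levelKey_injective, Finset.sum_apply]
  have hlev : ∀ j, band W j (j + M) ⊆ slab k j (M - 1) := by
    intro j x hx
    simp only [band, Finset.mem_filter] at hx
    rw [mem_slab]
    omega
  have e1 : ∀ j, _ := fun j => sum_siteVar_band_le h0 h1 W j 1 M hM hC
    ((hP j).subset h0 h1 (hlev j) hC) one_pos (fun n hn => hε n (by omega)) f ω
  have hfib : ∀ g : Vertex k → ℝ,
      ∑ j ∈ Finset.range (L + 1), ∑ x ∈ band W j (j + 1), g x = ∑ x ∈ W, g x := by
    intro g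
    rw [← Finset.sum_fiberwise_of_maps_to (s := W) (t := Finset.range (L + 1)) (g := List.length)
      (fun x hx => Finset.mem_range.2 (Nat.lt_succ_of_le (mem_tree.1 hx))) g]
    refine Finset.sum_congr rfl fun j _ => Finset.sum_congr ?_ fun _ _ => rfl
    ext x
    simp only [band, Finset.mem_filter]
    exact and_congr_right fun _ => by omega
  have e2 := Finset.sum_le_sum fun j (_ : j ∈ Finset.range (L + 1)) => e1 j
  rw [hfib, Finset.sum_add_distrib, ← Finset.mul_sum, ← Finset.mul_sum, ← e0] at e2
  have e3 : ∑ j ∈ Finset.range (L + 1), ∑ x ∈ band W j (j + M), energy p W x f ω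
      ≤ M * ∑ x ∈ W, energy p W x f ω := by
    have : ∑ j ∈ Finset.range (L + 1), ∑ x ∈ band W j (j + M), energy p W x f ω
        = ∑ x ∈ W, ∑ j ∈ Finset.range (L + 1) with j ≤ x.length ∧ x.length < j + M,
            energy p W x f ω := by
      refine Finset.sum_comm' fun j x => ?_
      simp only [band, Finset.mem_filter]
      tauto
    rw [this, Finset.mul_sum]
    refine Finset.sum_le_sum fun x _ => ?_
    rw [Finset.sum_const, nsmul_eq_mul]
    refine mul_le_mul_of_nonneg_right ?_ (hE x)
    have hc : (Finset.filter (fun j => j ≤ x.length ∧ x.length < j + M)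
        (Finset.range (L + 1))).card ≤ (Finset.Ico (x.length + 1 - M) (x.length + 1)).card := by
      refine Finset.card_le_card fun j hj => ?_
      simp only [Finset.mem_filter] at hj
      rw [Finset.mem_Ico]
      omega
    rw [Nat.card_Ico] at hc
    exact_mod_cast hc.trans (by omega)
  have e4 : ∑ j ∈ Finset.range (L + 1), ∑ x ∈ band W j (j + 1),
        ∑ y ∈ below W (j + M - x.length) x, siteVar levelKey p W f y ω
      ≤ ((M + 1 : ℕ) : ℝ) * vr p W f ω := by
    have : ∑ j ∈ Finset.range (L + 1), ∑ x ∈ band W j (j + 1),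
        ∑ y ∈ below W (j + M - x.length) x, siteVar levelKey p W f y ω
        = ∑ x ∈ W, ∑ y ∈ below W M x, siteVar levelKey p W f y ω := by
      rw [← hfib]
      refine Finset.sum_congr rfl fun j _ => Finset.sum_congr rfl fun x hx => ?_
      simp only [band, Finset.mem_filter] at hx
      have : j + M - x.length = M := by omega
      rw [this]
    rw [this, e0]
    refine sum_below_le W W (fun _ => M) (M + 1) _ (fun y _ => hV y)
      (fun y => Finset.Ico (y.length - M) (y.length + 1)) ?_ ?_
    · intro x _ y _ hs hl
      rw [Finset.mem_Ico]
      have := hs.length_le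
      omega
    · intro y _
      rw [Nat.card_Ico]; omega
  have hv : 0 ≤ vr p W f ω := vr_nonneg h0 h1 W f ω
  have e5 := mul_le_mul_of_nonneg_left e3 (by positivity : 0 ≤ (1 + (1 : ℝ)⁻¹) * C)
  have e6 := mul_le_mul_of_nonneg_left e4 (by positivity : 0 ≤ (1 + 1 : ℝ) * ε)
  have e7 := mul_le_mul_of_nonneg_right hεM hv
  rw [inv_one] at *
  push_cast at e6
  have e8 : (1 + 1) * ε * ((M + 1) * vr p W f ω) = 2 * (ε * (M + 1) * vr p W f ω) := by ring
  rw [e8] at e6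
  linarith

theorem poincare_subcritical (hk : 2 ≤ k) (h0 : 0 ≤ p) (hp : p < 1 / k) {s : ℝ} (hs : 0 < s)
    (hsp : s ≤ (1 - p) ^ k) (L : ℕ) :
    Poincare p (tree k L)
      (4 * 17 ^ 151 * ((s ^ 2)⁻¹ * (2 + s⁻¹)) ^ 12 * ((1 - k * p) ^ 302)⁻¹) := by
  have hk' : (2 : ℝ) ≤ k := by exact_mod_cast hk
  have h1 : p ≤ 1 := hp.le.trans (by rw [div_le_one (by linarith)]; linarith)
  set d := 1 - k * p with hd
  have hkp : k * p < 1 := by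
    rw [lt_div_iff₀ (by linarith)] at hp; linarith
  have hkp0 : 0 ≤ k * p := by positivity
  have hd0 : 0 < d := by linarith
  have hd1 : d ≤ 1 := by linarith
  have hi1 : 1 ≤ (d ^ 2)⁻¹ := (one_le_inv₀ (by positivity)).2 (pow_le_one₀ hd0.le hd1)
  -- With `d ^ 2 * M ≥ 16` one has `exp (d * M) ≥ (d * M) ^ 2 / 2 ≥ 8 * M`, so the path probability
  -- times `M + 1` is at most `1 / 4`. The exponent 302 is `2 * (1 + 150)`: one factor `M` from
  -- `slabPoincare_of_hitBound`, and `M ^ 150` from the critical bound at depth `M - 1`.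
  obtain ⟨M, hM⟩ : ∃ M : ℕ, M = ⌈16 * (d ^ 2)⁻¹⌉₊ := ⟨_, rfl⟩
  have hM1 : 16 * (d ^ 2)⁻¹ ≤ M := hM ▸ Nat.le_ceil _
  have hM2 : (M : ℝ) ≤ 17 * (d ^ 2)⁻¹ := by
    have := Nat.ceil_lt_add_one (a := 16 * (d ^ 2)⁻¹) (by positivity)
    rw [← hM] at this
    linarith
  have hM3 : (1 : ℝ) ≤ M := by linarith
  have hM4 : 1 ≤ M := by exact_mod_cast hM3
  have hdec : ∀ n, M ≤ n → hitBound p k n ≤ (k * p) ^ M := fun n hn =>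
    (hitBound_le_pow h0 h1 n).trans (pow_le_pow_of_le_one hkp0 hkp.le hn)
  have hsmall : (k * p) ^ M * ((M : ℝ) + 1) ≤ 1 / 4 := by
    have a1 : (k * p) ^ M ≤ Real.exp (-(d * M)) := by
      have : k * p ≤ Real.exp (-d) := by
        have := Real.add_one_le_exp (-d); linarith
      calc (k * p) ^ M ≤ Real.exp (-d) ^ M := pow_le_pow_left₀ hkp0 this M
        _ = Real.exp (-(d * M)) := by rw [← Real.exp_nat_mul]; congr 1; ring
    have a2 : (d * M) ^ 2 / 2 ≤ Real.exp (d * M) := by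
      have := Real.quadratic_le_exp_of_nonneg (x := d * M) (by positivity)
      have : 0 ≤ d * M := by positivity
      linarith
    have a3 : 16 ≤ d ^ 2 * M := by
      have := mul_le_mul_of_nonneg_left hM1 (by positivity : 0 ≤ d ^ 2)
      calc (16 : ℝ) = d ^ 2 * (16 * (d ^ 2)⁻¹) := by field_simp
        _ ≤ _ := this
    have a4 : 8 * (M : ℝ) ≤ Real.exp (d * M) := by
      refine le_trans ?_ a2
      nlinarith
    have a5 : Real.exp (-(d * M)) ≤ (8 * (M : ℝ))⁻¹ := by
      rw [Real.exp_neg]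
      exact inv_anti₀ (by positivity) a4
    calc (k * p) ^ M * ((M : ℝ) + 1) ≤ (8 * (M : ℝ))⁻¹ * (2 * M) :=
          mul_le_mul (a1.trans a5) (by linarith) (by positivity) (by positivity)
      _ = 1 / 4 := by field_simp; norm_num
  have h5 := slabPoincare_critical hk h0 hp.le hs hsp (M - 1)
  have hcast : ((M - 1 : ℕ) : ℝ) + 1 = M := by rw [Nat.cast_sub hM4]; push_cast; ring
  rw [hcast] at h5
  have h6 := slabPoincare_of_hitBound h0 h1 hM4 (pow_nonneg hkp0 M) hdec hsmall (by positivity) h5 L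
  refine h6.mono_const h0 h1 ?_
  have hK0 : 0 ≤ ((s ^ 2)⁻¹ * (2 + s⁻¹)) ^ 12 := by positivity
  generalize ((s ^ 2)⁻¹ * (2 + s⁻¹)) ^ 12 = K at hK0
  have e1 : 4 * (M : ℝ) * (K * (M : ℝ) ^ 150) = 4 * K * (M : ℝ) ^ 151 := by
    rw [pow_succ (M : ℝ) 150]
    generalize (M : ℝ) ^ 150 = z
    ring
  have e2 : 4 * K * (17 * (d ^ 2)⁻¹) ^ 151 = 4 * 17 ^ 151 * K * (d ^ 302)⁻¹ := by
    rw [mul_pow, inv_pow, ← pow_mul]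
    generalize (17 : ℝ) ^ 151 = u
    generalize (d ^ (2 * 151))⁻¹ = w
    ring
  rw [e1, ← e2]
  exact mul_le_mul_of_nonneg_left (pow_le_pow_left₀ (Nat.cast_nonneg M) hM2 151) (by linarith)

/-! ### Finite configurations -/

variable {k : ℕ} {p : ℝ}

theorem weight_pos (h0 : 0 < p) (h1 : p < 1) (b : Bool) : 0 < weight p b := by
  unfold weight; split_ifs <;> linarith

theorem mass_pos (h0 : 0 < p) (h1 : p < 1) {A : Finset (Vertex k)} (η : Config A) :
    0 < mass p η := Finset.prod_pos fun x _ => weight_pos h0 h1 (η x)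

/-- The function on all configurations induced by a function of the spins in `A`. -/
def lift {A : Finset (Vertex k)} (f : Config A → ℝ) (ω : Vertex k → Bool) : ℝ :=
  f fun x => ω x

theorem lift_zeroExt {A : Finset (Vertex k)} {F : (Vertex k → Bool) → ℝ}
    (hF : DependsOn F (A : Set (Vertex k))) : lift (fun η : Config A => F (zeroExt η)) = F := by
  funext ω
  refine hF fun x hx => ?_
  have hx' : x ∈ A := by exact_mod_cast hx
  simp [zeroExt, hx']

/-- Expanding `lift f` over configurations into products of single-site indicators reduces the claim
to independence. It transfers the site-by-site calculus to the finite-volume quantities of the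
statement. -/
theorem mean_eq_avg {A : Finset (Vertex k)} (f : Config A → ℝ) (ω : Vertex k → Bool) :
    mean p f = avg p A (lift f) ω := by
  have e : lift f = ∑ σ : Config A, f σ • ∏ x : A,
      (fun ω : Vertex k → Bool => if ω x = σ x then (1 : ℝ) else 0) := by
    funext ω
    simp only [Finset.sum_apply, Pi.smul_apply, Finset.prod_apply, smul_eq_mul, lift]
    rw [Finset.sum_eq_single fun x : A => ω x]
    · simp
    · intro σ _ hσ
      obtain ⟨x, hx⟩ : ∃ x : A, ω x ≠ σ x := by
        by_contra h
        push Not at h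
        exact hσ (funext fun x => (h x).symm)
      rw [Finset.prod_eq_zero (Finset.mem_univ x) (if_neg hx), mul_zero]
    · simp
  have hd : ∀ (x : A) (b : Bool),
      DependsOn (fun ω : Vertex k → Bool => if ω x = b then (1 : ℝ) else 0)
        (({(x : Vertex k)} : Finset (Vertex k)) : Set (Vertex k)) := by
    intro x b ω ω' h
    have := h x (by simp)
    simp only [this]
  rw [e, avg_sum]
  simp only [Finset.sum_apply, mean]
  refine Finset.sum_congr rfl fun σ _ => ?_
  rw [avg_smul, avg_prod_of_disjoint A Finset.univ (fun x : A => {(x : Vertex k)})]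
  · simp only [Pi.smul_apply, smul_eq_mul, Finset.prod_apply, mass]
    rw [mul_comm]
    congr 1
    refine Finset.prod_congr rfl fun x _ => ?_
    rw [avg_eq_of_dependsOn (by simp) (hd x (σ x)), avg_singleton, siteMean_eq]
    cases σ x <;> simp [weight]
  · intro x _
    simp
  · intro x _ y _ hxy
    rw [Finset.disjoint_singleton]
    exact fun h => hxy (Subtype.ext h)
  · intro x _
    exact hd x (σ x)

theorem var_eq_vr {A : Finset (Vertex k)} (f : Config A → ℝ) (ω : Vertex k → Bool) :
    var p f = vr p A (lift f) ω := by
  rw [var, vr, mean_eq_avg _ ω, mean_eq_avg f ω]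
  rfl

theorem lift_siteMean {A : Finset (Vertex k)} (x : A) (f : Config A → ℝ) :
    lift (siteMean p x f) = siteMean p (x : Vertex k) (lift f) := by
  funext ω
  have key : ∀ b, (fun y : A => Function.update ω (x : Vertex k) b y)
      = Function.update (fun y : A => ω y) x b := by
    intro b
    funext y
    by_cases h : y = x
    · subst h; simp
    · rw [Function.update_of_ne h, Function.update_of_ne fun h' => h (Subtype.ext h')]
  simp [lift, siteMean_eq, key]

theorem lift_finConstraint {A : Finset (Vertex k)} (x : A) :
    lift (finConstraint A x) = cons A x := by
  funext ω
  simp only [lift, finConstraint, constraint, cons]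
  have : ∀ i : Fin k, zeroExt (fun y : A => ω y) (i :: (x : Vertex k)) = false ↔
      (i :: (x : Vertex k) ∈ A → ω (i :: (x : Vertex k)) = false) := by
    intro i
    by_cases h : i :: (x : Vertex k) ∈ A <;> simp [zeroExt, h]
  simp only [this]

/-- The constraint at `x` ignores the spin at `x`, so averaging that spin alone already gives the
identity. Its right side is symmetric in `f` and `g`, which is the source of both the Dirichlet form
and reversibility. -/
theorem avg_mul_sub_siteMean {A : Finset (Vertex k)} {x : Vertex k} (hx : x ∈ A)
    (f g : (Vertex k → Bool) → ℝ) (ω : Vertex k → Bool) :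
    avg p A (f * (cons A x * (g - siteMean p x g))) ω
      = p * (1 - p) * avg p A (cons A x * (grad x f * grad x g)) ω := by
  have hc : ∀ (ω : Vertex k → Bool) b, cons A x (Function.update ω x b) = cons A x ω := by
    intro ω b
    unfold cons
    have : ∀ i : Fin k, Function.update ω x b (i :: x) = ω (i :: x) := fun i =>
      Function.update_of_ne (by simp) _ _
    simp only [this]
  have e : siteMean p x (f * (cons A x * (g - siteMean p x g)))
      = (p * (1 - p)) • (cons A x * (grad x f * grad x g)) := by
    funext ω
    simp only [siteMean_eq, Pi.mul_apply, Pi.sub_apply, Pi.smul_apply, hc, Function.update_idem,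
      grad, smul_eq_mul]
    ring
  rw [← avg_avg_of_subset (B := {x}) (by simpa using hx), avg_singleton, e, avg_smul]
  rfl

theorem mean_mul_neg_finGenerator {A : Finset (Vertex k)} (f g : Config A → ℝ)
    (ω : Vertex k → Bool) :
    mean p (fun η => f η * (-finGenerator p A g η))
      = ∑ x ∈ A, p * (1 - p) *
          avg p A (cons A x * (grad x (lift f) * grad x (lift g))) ω := by
  rw [mean_eq_avg _ ω]
  have e : lift (fun η => f η * (-finGenerator p A g η))
      = ∑ x : A, lift f * (cons A x * (lift g - siteMean p (x : Vertex k) (lift g))) := by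
    funext ω
    simp only [Finset.sum_apply, Pi.mul_apply, Pi.sub_apply]
    simp only [← lift_siteMean, ← lift_finConstraint, lift, finGenerator]
    rw [← Finset.mul_sum, ← Finset.sum_neg_distrib]
    congr 1
    refine Finset.sum_congr rfl fun x _ => ?_
    ring
  rw [e, avg_sum, Finset.sum_apply, ← Finset.sum_coe_sort A]
  exact Finset.sum_congr rfl fun x _ => avg_mul_sub_siteMean x.2 _ _ ω

theorem dirichletForm_eq {A : Finset (Vertex k)} (f : Config A → ℝ) (ω : Vertex k → Bool) :
    dirichletForm p A f = ∑ x ∈ A, energy p A x (lift f) ω := by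
  rw [dirichletForm, mean_mul_neg_finGenerator f f ω]
  refine Finset.sum_congr rfl fun x _ => ?_
  rw [energy, pow_two]
  rfl

theorem dirichletForm_nonneg (h0 : 0 ≤ p) (h1 : p ≤ 1) {A : Finset (Vertex k)}
    (f : Config A → ℝ) : 0 ≤ dirichletForm p A f := by
  rw [dirichletForm_eq f fun _ => false]
  exact Finset.sum_nonneg fun x _ => energy_nonneg h0 h1 A x _ _

theorem poincare_iff {A : Finset (Vertex k)} {C : ℝ} :
    Poincare p A C ↔ ∀ f : Config A → ℝ, var p f ≤ C * dirichletForm p A f := by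
  constructor
  · intro h f
    rw [var_eq_vr f fun _ => false, dirichletForm_eq f fun _ => false]
    exact h _ _
  · intro h f ω
    have hf : lift (fun η : Config A => freeze A ω f (zeroExt η)) = freeze A ω f :=
      lift_zeroExt (freeze_dependsOn A ω f)
    have h2 := h fun η : Config A => freeze A ω f (zeroExt η)
    rw [var_eq_vr _ ω, dirichletForm_eq _ ω, hf] at h2
    have e1 : vr p A (freeze A ω f) ω = vr p A f ω := by
      simp only [vr, Pi.sub_apply, Pi.pow_apply]
      congr 1
      · exact avg_congr_of_eqOn fun ω' h => by simp [freeze_apply h]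
      · congr 1
        exact avg_congr_of_eqOn fun ω' h => by simp [freeze_apply h]
    have e2 : ∀ x ∈ A, energy p A x (freeze A ω f) ω = energy p A x f ω := by
      intro x hx
      simp only [energy, Pi.smul_apply]
      congr 1
      refine avg_congr_of_eqOn fun ω' h' => ?_
      have hb : ∀ b, freeze A ω f (Function.update ω' x b) = f (Function.update ω' x b) := by
        intro b
        refine freeze_apply (fun y hy => ?_) f
        rw [Function.update_of_ne (by rintro rfl; exact hy hx), h' y hy]
      simp [grad, hb]
    rw [e1, Finset.sum_congr rfl e2] at h2
    exact h2

theorem sum_mass (p : ℝ) (A : Finset (Vertex k)) : ∑ η : Config A, mass p η = 1 := by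
  have := mean_eq_avg (p := p) (fun _ : Config A => (1 : ℝ)) fun _ => false
  have e : lift (fun _ : Config A => (1 : ℝ)) = fun _ => 1 := rfl
  rw [e, avg_const] at this
  simpa [mean] using this

theorem mean_const {A : Finset (Vertex k)} (c : ℝ) : mean p (fun _ : Config A => c) = c := by
  rw [mean, ← Finset.sum_mul, sum_mass, one_mul]

theorem mean_add {A : Finset (Vertex k)} (f g : Config A → ℝ) :
    mean p (fun η => f η + g η) = mean p f + mean p g := by
  simp only [mean, mul_add, Finset.sum_add_distrib]

theorem mean_sub {A : Finset (Vertex k)} (f g : Config A → ℝ) :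
    mean p (fun η => f η - g η) = mean p f - mean p g := by
  simp only [mean, mul_sub, Finset.sum_sub_distrib]

theorem mean_const_mul {A : Finset (Vertex k)} (c : ℝ) (f : Config A → ℝ) :
    mean p (fun η => c * f η) = c * mean p f := by
  simp only [mean, Finset.mul_sum]
  exact Finset.sum_congr rfl fun η _ => by ring

theorem mean_nonneg (h0 : 0 < p) (h1 : p < 1) {A : Finset (Vertex k)} {f : Config A → ℝ}
    (hf : ∀ η, 0 ≤ f η) : 0 ≤ mean p f :=
  Finset.sum_nonneg fun η _ => mul_nonneg (mass_pos h0 h1 η).le (hf η)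

theorem mean_mono (h0 : 0 < p) (h1 : p < 1) {A : Finset (Vertex k)} {f g : Config A → ℝ}
    (h : ∀ η, f η ≤ g η) : mean p f ≤ mean p g :=
  Finset.sum_le_sum fun η _ => mul_le_mul_of_nonneg_left (h η) (mass_pos h0 h1 η).le

theorem var_eq_mean_sq {A : Finset (Vertex k)} (f : Config A → ℝ) :
    var p f = mean p fun η => (f η - mean p f) ^ 2 := by
  have e : (fun η => (f η - mean p f) ^ 2)
      = fun η => (f η ^ 2 - (2 * mean p f) * f η) + mean p f ^ 2 := by funext η; ring
  rw [e, mean_add, mean_sub, mean_const_mul, mean_const, var]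
  ring

theorem var_pos (h0 : 0 < p) (h1 : p < 1) {A : Finset (Vertex k)} {f : Config A → ℝ}
    (hf : ¬ ∃ a : ℝ, ∀ η, f η = a) : 0 < var p f := by
  rw [var_eq_mean_sq]
  have hne : ∃ η, f η ≠ mean p f := by
    by_contra h
    push Not at h
    exact hf ⟨_, h⟩
  obtain ⟨η, hη⟩ := hne
  refine Finset.sum_pos' (fun σ _ => mul_nonneg (mass_pos h0 h1 σ).le (sq_nonneg _))
    ⟨η, Finset.mem_univ _, mul_pos (mass_pos h0 h1 η) ?_⟩
  have : f η - mean p f ≠ 0 := sub_ne_zero.2 hη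
  positivity

theorem var_nonneg (h0 : 0 < p) (h1 : p < 1) {A : Finset (Vertex k)} (f : Config A → ℝ) :
    0 ≤ var p f := by
  rw [var_eq_mean_sq]
  exact mean_nonneg h0 h1 fun _ => sq_nonneg _

theorem var_of_const {A : Finset (Vertex k)} {f : Config A → ℝ} {a : ℝ} (h : ∀ η, f η = a) :
    var p f = 0 := by
  have : f = fun _ => a := funext h
  rw [var, this, mean_const, mean_const, sub_self]

/-! ### The spectral gap and the relaxation time -/

theorem gap_mul_var_le (h0 : 0 < p) (h1 : p < 1) {A : Finset (Vertex k)} (f : Config A → ℝ) :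
    gap p A * var p f ≤ dirichletForm p A f := by
  by_cases hf : ∃ a : ℝ, ∀ η, f η = a
  · obtain ⟨a, ha⟩ := hf
    rw [var_of_const ha, mul_zero]
    exact dirichletForm_nonneg h0.le h1.le f
  · rw [← le_div_iff₀ (var_pos h0 h1 hf)]
    refine csInf_le ⟨0, ?_⟩ ⟨f, hf, rfl⟩
    rintro r ⟨g, hg, rfl⟩
    exact div_nonneg (dirichletForm_nonneg h0.le h1.le g) (var_pos h0 h1 hg).le

theorem exists_nonconst {A : Finset (Vertex k)} (hA : A.Nonempty) :
    ∃ f : Config A → ℝ, ¬ ∃ a : ℝ, ∀ η, f η = a := by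
  obtain ⟨x, hx⟩ := hA
  refine ⟨fun η => if η ⟨x, hx⟩ = true then 1 else 0, ?_⟩
  rintro ⟨a, ha⟩
  have h1 := ha fun _ => true
  have h2 := ha fun _ => false
  simp only [if_true, Bool.false_eq_true, if_false] at h1 h2
  linarith

theorem nil_mem_tree (k L : ℕ) : ([] : Vertex k) ∈ tree k L := mem_tree.2 (Nat.zero_le _)

theorem inv_le_gap (h0 : 0 < p) (h1 : p < 1) {A : Finset (Vertex k)} (hA : A.Nonempty) {C : ℝ}
    (hC : 0 < C) (hP : Poincare p A C) : C⁻¹ ≤ gap p A := by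
  obtain ⟨f, hf⟩ := exists_nonconst hA
  refine le_csInf ⟨_, f, hf, rfl⟩ ?_
  rintro r ⟨g, hg, rfl⟩
  rw [le_div_iff₀ (var_pos h0 h1 hg), inv_mul_le_iff₀ hC]
  exact poincare_iff.1 hP g

/-- The crude recursion suffices, as it gives a finite Poincaré constant at every density and depth.
-/
theorem gap_pos (h0 : 0 < p) (h1 : p < 1) (L : ℕ) : 0 < gap p (tree k L) := by
  have hs : 0 < (1 - p) ^ k := pow_pos (by linarith) k
  have hP := slabPoincare_pow h0.le h1.le hs le_rfl L 0
  rw [slab_zero] at hP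
  have hC : 0 < ((((1 - p) ^ k) ^ 2)⁻¹ * (2 + ((1 - p) ^ k)⁻¹)) ^ L := by positivity
  exact (inv_pos.2 hC).trans_le (inv_le_gap h0 h1 ⟨_, nil_mem_tree k L⟩ hC hP)

theorem relaxationTime_pos (h0 : 0 < p) (h1 : p < 1) (L : ℕ) :
    0 < relaxationTime p (tree k L) := inv_pos.2 (gap_pos h0 h1 L)

theorem relaxationTime_le (h0 : 0 < p) (h1 : p < 1) {A : Finset (Vertex k)} (hA : A.Nonempty)
    {C : ℝ} (hC : 0 < C) (hP : Poincare p A C) : relaxationTime p A ≤ C := by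
  rw [relaxationTime, ← inv_inv C]
  exact inv_anti₀ (inv_pos.2 hC) (inv_le_gap h0 h1 hA hC hP)

theorem poincare_relaxationTime (h0 : 0 < p) (h1 : p < 1) (L : ℕ) :
    Poincare p (tree k L) (relaxationTime p (tree k L)) := by
  refine poincare_iff.2 fun f => ?_
  rw [relaxationTime, ← div_eq_inv_mul, le_div_iff₀ (gap_pos h0 h1 L), mul_comm]
  exact gap_mul_var_le h0 h1 f

theorem relaxationTime_mono (h0 : 0 < p) (h1 : p < 1) {L M : ℕ} (h : L ≤ M) :
    relaxationTime p (tree k L) ≤ relaxationTime p (tree k M) := by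
  refine relaxationTime_le h0 h1 ⟨_, nil_mem_tree k L⟩ (relaxationTime_pos h0 h1 M) ?_
  refine (poincare_relaxationTime h0 h1 M).subset h0.le h1.le (fun x hx => ?_)
    (relaxationTime_pos h0 h1 M).le
  exact mem_tree.2 ((mem_tree.1 hx).trans h)

theorem le_relaxationTime (h0 : 0 < p) (h1 : p < 1) {L : ℕ} {R : ℝ} (hR : 0 < R)
    (f : Config (tree k L) → ℝ) (hv : 0 < var p f)
    (h : R * dirichletForm p (tree k L) f ≤ var p f) : R ≤ relaxationTime p (tree k L) := by
  have hg := gap_mul_var_le h0 h1 f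
  rw [relaxationTime, le_inv_comm₀ hR (gap_pos h0 h1 L), ← one_div, le_div_iff₀ hR]
  have h3 := mul_le_mul_of_nonneg_left hg hR.le
  have h4 : R * gap p (tree k L) * var p f ≤ 1 * var p f := by linarith
  have := le_of_mul_le_mul_right h4 hv
  linarith

/-! ### The size of the occupied cluster of the root -/

section Occ

variable {V : Type}

/-- The indicator function of the event that all sites of `s` are occupied. -/
def occProd (s : Finset V) : (V → Bool) → ℝ := ∏ y ∈ s, occ y

theorem occProd_dependsOn (s : Finset V) : DependsOn (occProd s) (s : Set V) :=
  dependsOn_prod s fun y hy => dependsOn_mono (occ_dependsOn y) (by simpa using hy)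

theorem occ_sq (y : V) : (occ y) ^ 2 = occ y := by
  funext ω; simp only [occ, Pi.pow_apply]; split_ifs <;> simp

theorem occProd_sq (s : Finset V) : (occProd s) ^ 2 = occProd s := by
  rw [occProd, ← Finset.prod_pow]
  exact Finset.prod_congr rfl fun y _ => occ_sq y

variable [DecidableEq V]

theorem avg_occProd_of_subset {A s : Finset V} (h : s ⊆ A) :
    avg p A (occProd s) = fun _ => p ^ s.card := by
  rw [occProd, avg_prod_of_disjoint A s (fun y => {y})]
  · funext ω
    rw [Finset.prod_apply, Finset.prod_congr rfl fun y hy => congrFun (avg_occ (h hy)) ω,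
      Finset.prod_const]
  · exact fun y hy => by simpa using h hy
  · exact fun y _ z _ hyz => by simpa using hyz
  · exact fun y _ => by simpa using occ_dependsOn y

theorem avg_occProd (A s : Finset V) :
    avg p A (occProd s) = (p ^ (s ∩ A).card) • occProd (s \ A) := by
  have e : occProd s = occProd (s \ A) * occProd (s ∩ A) := by
    rw [occProd, occProd, occProd, mul_comm, Finset.prod_inter_mul_prod_sdiff]
  rw [e, avg_mul_left, avg_occProd_of_subset Finset.inter_subset_right]
  · funext ω; simp [mul_comm]
  · refine dependsOn_mono (occProd_dependsOn _) ?_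
    intro y hy
    simp only [Finset.coe_sdiff, Set.mem_sdiff] at hy
    exact hy.2

theorem grad_occProd_of_mem {x : V} {s : Finset V} (hx : x ∈ s) :
    grad x (occProd s) = occProd (s.erase x) := by
  have e : occProd s = occ x * occProd (s.erase x) := by
    rw [occProd, occProd, Finset.mul_prod_erase s occ hx]
  have hd := occProd_dependsOn (s.erase x)
  funext ω
  simp only [grad, e, Pi.mul_apply, update_of_dependsOn hd (x := x) (by simp)]
  simp [occ]

theorem grad_occProd_of_notMem {x : V} {s : Finset V} (hx : x ∉ s) :
    grad x (occProd s) = 0 := grad_eq_zero (occProd_dependsOn s) (by simpa using hx)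

theorem grad_sum {ι : Type*} (x : V) (s : Finset ι) (f : ι → (V → Bool) → ℝ) :
    grad x (∑ i ∈ s, f i) = ∑ i ∈ s, grad x (f i) := by
  funext ω
  simp only [grad, Finset.sum_apply, Finset.sum_sub_distrib]

end Occ

/-- The vertices on the path from the root to `x`. -/
def pathTo (x : Vertex k) : Finset (Vertex k) := x.tails.toFinset

theorem mem_pathTo {x y : Vertex k} : y ∈ pathTo x ↔ y <:+ x := by simp [pathTo]

theorem self_mem_pathTo (x : Vertex k) : x ∈ pathTo x := mem_pathTo.2 List.suffix_rfl

theorem card_pathTo (x : Vertex k) : (pathTo x).card = x.length + 1 := by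
  have e : pathTo x = (Finset.range (x.length + 1)).image fun i => x.drop i := by
    ext y
    simp only [mem_pathTo, Finset.mem_image, Finset.mem_range]
    constructor
    · intro h
      refine ⟨x.length - y.length, by omega, ?_⟩
      exact (List.suffix_iff_eq_drop.1 h).symm
    · rintro ⟨i, _, rfl⟩
      exact List.drop_suffix i x
  rw [e, Finset.card_image_of_injOn, Finset.card_range]
  intro i hi j hj h
  have := congrArg List.length h
  simp only [List.length_drop] at this
  simp only [Finset.coe_range, Set.mem_Iio] at hi hj
  omega

theorem card_level (k j : ℕ) {L : ℕ} (h : j ≤ L) :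
    ((tree k L).filter fun x => x.length = j).card = k ^ j := by
  have : ((tree k L).filter fun x => x.length = j).card
      = Fintype.card (List.Vector (Fin k) j) := by
    rw [← Fintype.card_coe]
    refine Fintype.card_congr (Equiv.subtypeEquivRight fun x => ?_)
    simp only [Finset.mem_filter, mem_tree]
    exact ⟨fun h => h.2, fun h' => ⟨by omega, h'⟩⟩
  rw [this, card_vector, Fintype.card_fin]

theorem sum_tree_length (L : ℕ) (g : ℕ → ℝ) :
    ∑ x ∈ tree k L, g x.length = ∑ j ∈ Finset.range (L + 1), (k : ℝ) ^ j * g j := by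
  rw [← Finset.sum_fiberwise_of_maps_to (s := tree k L) (t := Finset.range (L + 1))
    (g := List.length) fun x hx => Finset.mem_range.2 (Nat.lt_succ_of_le (mem_tree.1 hx))]
  refine Finset.sum_congr rfl fun j hj => ?_
  rw [Finset.sum_congr rfl (g := fun _ => g j) fun x hx => by rw [(Finset.mem_filter.1 hx).2],
    Finset.sum_const, card_level k j (Nat.lt_succ_iff.1 (Finset.mem_range.1 hj)), nsmul_eq_mul]
  push_cast
  rfl

theorem sum_tree_below (L : ℕ) {x : Vertex k} (hx : x ∈ tree k L) (g : ℕ → ℝ) :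
    ∑ z ∈ tree k L with x <:+ z, g (z.length - x.length)
      = ∑ j ∈ Finset.range (L - x.length + 1), (k : ℝ) ^ j * g j := by
  rw [← sum_tree_length]
  symm
  rw [mem_tree] at hx
  refine Finset.sum_bij (fun w _ => w ++ x) ?_ ?_ ?_ ?_
  · intro w hw
    rw [mem_tree] at hw
    simp only [Finset.mem_filter, mem_tree, List.length_append]
    exact ⟨by omega, List.suffix_append w x⟩
  · intro w _ w' _ h
    exact List.append_cancel_right h
  · intro z hz
    simp only [Finset.mem_filter, mem_tree] at hz
    obtain ⟨w, rfl⟩ := hz.2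
    refine ⟨w, mem_tree.2 ?_, rfl⟩
    have := hz.1
    rw [List.length_append] at this
    omega
  · intro w _
    simp

/-- The size of the occupied cluster of the root in the tree of depth `L`. -/
def clusterSize (k L : ℕ) : (Vertex k → Bool) → ℝ := ∑ z ∈ tree k L, occProd (pathTo z)

/-- Only vertices `z` below `x` feel the spin at `x`. On the path to `z`, the later sites are those
strictly below `x`, and averaging them leaves `p ^ (z.length - x.length)`; the ancestors of `x` stay
as an indicator. -/
theorem grad_avg_clusterSize {L : ℕ} {x : Vertex k} (hx : x ∈ tree k L) :
    grad x (avg p (later levelKey (tree k L) x) (clusterSize k L))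
      = (∑ j ∈ Finset.range (L - x.length + 1), (k * p) ^ j) •
          occProd ((pathTo x).erase x) := by
  rw [grad_avg (self_notMem_later _ _ _), clusterSize, grad_sum, avg_sum]
  have e1 : ∀ z ∈ tree k L, avg p (later levelKey (tree k L) x) (grad x (occProd (pathTo z)))
      = if x <:+ z then (p ^ (z.length - x.length)) • occProd ((pathTo x).erase x) else 0 := by
    intro z hz
    split_ifs with h
    · rw [grad_occProd_of_mem (mem_pathTo.2 h), avg_occProd]
      have hl : ∀ y, y <:+ z → (y ∈ later levelKey (tree k L) x ↔ x.length < y.length) := by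
        intro y hy
        simp only [later, Finset.mem_filter, mem_tree]
        constructor
        · rintro ⟨_, h2⟩
          by_contra h3
          rcases (not_lt.1 h3).eq_or_lt with h4 | h4
          · have : y = x := (List.suffix_of_suffix_length_le hy h h4.le).eq_of_length h4
            rw [this] at h2
            exact lt_irrefl _ h2
          · exact lt_asymm h2 (levelKey_lt h4)
        · intro h2
          exact ⟨hy.length_le.trans (mem_tree.1 hz), levelKey_lt h2⟩
      have hd : (pathTo z).erase x \ later levelKey (tree k L) x = (pathTo x).erase x := by
        ext y
        simp only [Finset.mem_sdiff, Finset.mem_erase, mem_pathTo]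
        constructor
        · rintro ⟨⟨h1, h2⟩, h3⟩
          rw [hl y h2, not_lt] at h3
          exact ⟨h1, List.suffix_of_suffix_length_le h2 h h3⟩
        · rintro ⟨h1, h2⟩
          refine ⟨⟨h1, h2.trans h⟩, ?_⟩
          rw [hl y (h2.trans h), not_lt]
          exact h2.length_le
      have hc : ((pathTo z).erase x ∩ later levelKey (tree k L) x).card
          = z.length - x.length := by
        have h1 := Finset.card_sdiff_add_card_inter ((pathTo z).erase x)
          (later levelKey (tree k L) x)
        rw [hd, Finset.card_erase_of_mem (self_mem_pathTo x),
          Finset.card_erase_of_mem (mem_pathTo.2 h), card_pathTo, card_pathTo] at h1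
        omega
      rw [hd, hc]
    · rw [grad_occProd_of_notMem (fun h' => h (mem_pathTo.1 h')), avg_zero]
  rw [Finset.sum_congr rfl e1, ← Finset.sum_filter, ← Finset.sum_smul, sum_tree_below L hx]
  simp only [mul_pow]

theorem vr_clusterSize (L : ℕ) (ω : Vertex k → Bool) :
    vr p (tree k L) (clusterSize k L) ω
      = p * (1 - p) * ∑ j ∈ Finset.range (L + 1),
          (k * p) ^ j * (∑ i ∈ Finset.range (L - j + 1), (k * p) ^ i) ^ 2 := by
  rw [vr_eq_sum_siteVar levelKey levelKey_injective, Finset.sum_apply]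
  have e : ∀ x ∈ tree k L, siteVar levelKey p (tree k L) (clusterSize k L) x ω
      = p * (1 - p) * (p ^ x.length *
          (∑ i ∈ Finset.range (L - x.length + 1), (k * p) ^ i) ^ 2) := by
    intro x hx
    have hsub : (pathTo x).erase x ⊆ tree k L := by
      intro y hy
      have := mem_pathTo.1 (Finset.mem_of_mem_erase hy)
      exact mem_tree.2 (this.length_le.trans (mem_tree.1 hx))
    rw [siteVar, grad_avg_clusterSize hx, smul_pow, occProd_sq, avg_smul,
      avg_occProd_of_subset hsub, Finset.card_erase_of_mem (self_mem_pathTo x), card_pathTo]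
    simp only [Pi.smul_apply, smul_eq_mul, Nat.add_sub_cancel]
    ring
  rw [Finset.sum_congr rfl e, ← Finset.mul_sum,
    sum_tree_length L fun n => p ^ n * (∑ i ∈ Finset.range (L - n + 1), (k * p) ^ i) ^ 2]
  congr 1
  refine Finset.sum_congr rfl fun j _ => ?_
  rw [mul_pow]
  ring

/-- When the children of `x` are empty, no vertex strictly below `x` is in the cluster, so a flip at
`x` changes the size by one if all strict ancestors of `x` are occupied, and not at all otherwise.
-/
theorem energy_clusterSize_le (h0 : 0 ≤ p) (h1 : p ≤ 1) {L : ℕ} {x : Vertex k}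
    (hx : x ∈ tree k L) (ω : Vertex k → Bool) :
    energy p (tree k L) x (clusterSize k L) ω ≤ p * (1 - p) * p ^ x.length := by
  have hsub : (pathTo x).erase x ⊆ tree k L := by
    intro y hy
    have := mem_pathTo.1 (Finset.mem_of_mem_erase hy)
    exact mem_tree.2 (this.length_le.trans (mem_tree.1 hx))
  have key : cons (tree k L) x * (grad x (clusterSize k L)) ^ 2
      ≤ occProd ((pathTo x).erase x) := by
    intro ω
    simp only [Pi.mul_apply, Pi.pow_apply]
    have hocc : ∀ s : Finset (Vertex k), 0 ≤ occProd s ω := by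
      intro s
      rw [occProd, Finset.prod_apply]
      exact Finset.prod_nonneg fun y _ => by unfold occ; split_ifs <;> simp
    unfold cons
    split_ifs with h
    · have e : grad x (clusterSize k L) ω = occProd ((pathTo x).erase x) ω := by
        rw [clusterSize, grad_sum, Finset.sum_apply, Finset.sum_eq_single x]
        · rw [grad_occProd_of_mem (self_mem_pathTo x)]
        · intro z hz hzx
          by_cases hxz : x <:+ z
          · rw [grad_occProd_of_mem (mem_pathTo.2 hxz)]
            obtain ⟨w, rfl⟩ := hxz
            -- The path from `x` down to `z` starts with the child `i :: x`, which the constraint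
            -- makes empty.
            obtain ⟨w', i, rfl⟩ : ∃ w' i, w = w' ++ [i] := by
              rcases List.eq_nil_or_concat w with h | ⟨w', i, h⟩
              · subst h; simp at hzx
              · exact ⟨w', i, by simpa using h⟩
            have hsuf : i :: x <:+ w' ++ [i] ++ x := ⟨w', by simp⟩
            have hmem : i :: x ∈ (pathTo (w' ++ [i] ++ x)).erase x := by
              rw [Finset.mem_erase, mem_pathTo]
              exact ⟨by simp, hsuf⟩
            have hT : i :: x ∈ tree k L := mem_tree.2 (hsuf.length_le.trans (mem_tree.1 hz))
            rw [occProd, Finset.prod_apply, Finset.prod_eq_zero hmem]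
            simp [occ, h i hT]
          · rw [grad_occProd_of_notMem fun h' => hxz (mem_pathTo.1 h')]
            rfl
        · exact fun h => absurd hx h
      rw [e, one_mul]
      have := congrFun (occProd_sq ((pathTo x).erase x)) ω
      rw [Pi.pow_apply] at this
      rw [this]
    · rw [zero_mul]
      exact hocc _
  have := avg_mono h0 h1 (A := tree k L) key ω
  rw [avg_occProd_of_subset hsub, Finset.card_erase_of_mem (self_mem_pathTo x), card_pathTo] at this
  exact mul_le_mul_of_nonneg_left this (mul_nonneg h0 (sub_nonneg.2 h1))

theorem clusterSize_dependsOn (k L : ℕ) :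
    DependsOn (clusterSize k L) (tree k L : Set (Vertex k)) := by
  refine dependsOn_sum _ fun z hz => dependsOn_mono (occProd_dependsOn _) ?_
  intro y hy
  have := mem_pathTo.1 (by exact_mod_cast hy : y ∈ pathTo z)
  exact_mod_cast mem_tree.2 (this.length_le.trans (mem_tree.1 hz))

theorem sum_sq_ge (L : ℕ) :
    ((L : ℝ) + 1) ^ 3 / 3 ≤ ∑ j ∈ Finset.range (L + 1), ((j : ℝ) + 1) ^ 2 := by
  induction L with
  | zero => norm_num
  | succ L ih =>
    rw [Finset.sum_range_succ]
    push_cast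
    have : (0 : ℝ) ≤ L := Nat.cast_nonneg L
    nlinarith

/-- Cluster size as test function. The hypothesis on the powers says that the tree is still nearly
critical at depth `L`, so the variance is at least `1 / 8` of the critical sum of squares, of order
`L ^ 3`, while the energy is at most of order `L`. -/
theorem relaxationTime_ge (hk : 2 ≤ k) (h0 : 0 < p) (hp : p ≤ 1 / k) (L : ℕ)
    (hL : ∀ n ≤ L, 1 / 2 ≤ (k * p) ^ n) :
    ((L : ℝ) + 1) ^ 2 / 24 ≤ relaxationTime p (tree k L) := by
  have hk' : (2 : ℝ) ≤ k := by exact_mod_cast hk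
  have hkp : k * p ≤ 1 := by rwa [le_div_iff₀ (by linarith), mul_comm] at hp
  have h1 : p < 1 := by nlinarith
  have hkp0 : 0 ≤ k * p := by positivity
  have hpq : 0 < p * (1 - p) := mul_pos h0 (by linarith)
  set f : Config (tree k L) → ℝ := fun η => clusterSize k L (zeroExt η) with hf
  have hlift : lift f = clusterSize k L := lift_zeroExt (clusterSize_dependsOn k L)
  have hvar : p * (1 - p) * (((L : ℝ) + 1) ^ 3 / 24) ≤ var p f := by
    rw [var_eq_vr f fun _ => false, hlift, vr_clusterSize]
    refine mul_le_mul_of_nonneg_left ?_ hpq.le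
    calc ((L : ℝ) + 1) ^ 3 / 24 ≤ 1 / 8 * ∑ j ∈ Finset.range (L + 1), ((j : ℝ) + 1) ^ 2 := by
          have := sum_sq_ge L; linarith
      _ = 1 / 8 * ∑ j ∈ Finset.range (L + 1), (((L - j : ℕ) : ℝ) + 1) ^ 2 := by
          rw [← Finset.sum_range_reflect]
          simp
      _ = ∑ j ∈ Finset.range (L + 1), 1 / 2 * ((((L - j : ℕ) : ℝ) + 1) * (1 / 2)) ^ 2 := by
          rw [Finset.mul_sum]
          exact Finset.sum_congr rfl fun j _ => by ring
      _ ≤ _ := by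
          refine Finset.sum_le_sum fun j hj => ?_
          have hj' : j ≤ L := Nat.lt_succ_iff.1 (Finset.mem_range.1 hj)
          refine mul_le_mul (hL j hj') (pow_le_pow_left₀ (by positivity) ?_ 2) (by positivity)
            (by positivity)
          have : ∑ i ∈ Finset.range (L - j + 1), (1 / 2 : ℝ)
              ≤ ∑ i ∈ Finset.range (L - j + 1), (k * p) ^ i := by
            refine Finset.sum_le_sum fun i hi => hL i ?_
            have := Finset.mem_range.1 hi
            omega
          rw [Finset.sum_const, Finset.card_range, nsmul_eq_mul] at this
          push_cast at this ⊢
          exact this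
  have hdir : dirichletForm p (tree k L) f ≤ p * (1 - p) * ((L : ℝ) + 1) := by
    rw [dirichletForm_eq f fun _ => false, hlift]
    refine (Finset.sum_le_sum fun x hx => energy_clusterSize_le h0.le h1.le hx _).trans ?_
    rw [← Finset.mul_sum, sum_tree_length L fun n => p ^ n]
    refine mul_le_mul_of_nonneg_left ?_ hpq.le
    calc ∑ j ∈ Finset.range (L + 1), (k : ℝ) ^ j * p ^ j
        ≤ ∑ j ∈ Finset.range (L + 1), (1 : ℝ) := by
          refine Finset.sum_le_sum fun j _ => ?_
          rw [← mul_pow]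
          exact pow_le_one₀ hkp0 hkp
      _ = _ := by simp
  refine le_relaxationTime h0 h1 (by positivity) f (lt_of_lt_of_le (by positivity) hvar) ?_
  refine le_trans (mul_le_mul_of_nonneg_left hdir (by positivity)) (le_trans (le_of_eq ?_) hvar)
  ring

/-! ### Matrix semigroups -/

section Semigroup

variable {n : Type*} [Fintype n] [DecidableEq n]

open scoped Matrix

section

open scoped Matrix.Norms.Operator

theorem hasDerivAt_exp_smul_matrix (Q : Matrix n n ℝ) (t : ℝ) :
    HasDerivAt (fun s : ℝ => NormedSpace.exp (s • Q)) (Q * NormedSpace.exp (t • Q)) t :=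
  hasDerivAt_exp_smul_const' Q t

theorem hasDerivAt_exp_smul_entry (Q : Matrix n n ℝ) (t : ℝ) (i j : n) :
    HasDerivAt (fun s : ℝ => NormedSpace.exp (s • Q) i j)
      ((Q * NormedSpace.exp (t • Q)) i j) t :=
  ((Matrix.entryLinearMap ℝ ℝ i j).toContinuousLinearMap.hasFDerivAt).comp_hasDerivAt t
    (hasDerivAt_exp_smul_matrix Q t)

theorem exp_entry_nonneg_of_nonneg (Q : Matrix n n ℝ) (hQ : ∀ i j, 0 ≤ Q i j) (i j : n) :
    0 ≤ NormedSpace.exp Q i j := by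
  have h := ((Matrix.entryLinearMap ℝ ℝ i j).toContinuousLinearMap).hasSum
    (NormedSpace.exp_series_hasSum_exp' (𝕂 := ℝ) Q)
  refine h.nonneg fun m => ?_
  have hpow : ∀ i j, 0 ≤ (Q ^ m) i j := by
    induction m with
    | zero =>
      intro i j
      rw [pow_zero, Matrix.one_apply]
      split_ifs <;> simp
    | succ m ih =>
      intro i j
      rw [pow_succ, Matrix.mul_apply]
      exact Finset.sum_nonneg fun l _ => mul_nonneg (ih i l) (hQ l j)
  exact mul_nonneg (by positivity) (hpow i j)

end

theorem hasDerivAt_exp_mulVec (Q : Matrix n n ℝ) (v : n → ℝ) (t : ℝ) (i : n) :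
    HasDerivAt (fun s : ℝ => (NormedSpace.exp (s • Q) *ᵥ v) i)
      ((Q *ᵥ (NormedSpace.exp (t • Q) *ᵥ v)) i) t := by
  have h : HasDerivAt (fun s : ℝ => ∑ j, NormedSpace.exp (s • Q) i j * v j)
      (∑ j, (Q * NormedSpace.exp (t • Q)) i j * v j) t :=
    HasDerivAt.fun_sum fun j _ => (hasDerivAt_exp_smul_entry Q t i j).mul_const (v j)
  rw [Matrix.mulVec_mulVec]
  exact h

theorem exp_neg_smul_mulVec (Q : Matrix n n ℝ) (t : ℝ) (v : n → ℝ) :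
    NormedSpace.exp (t • Q) *ᵥ (NormedSpace.exp ((-t) • Q) *ᵥ v) = v := by
  have hc : Commute (t • Q) ((-t) • Q) :=
    (Commute.refl Q).smul_left t |>.smul_right (-t)
  rw [Matrix.mulVec_mulVec, ← Matrix.exp_add_of_commute _ _ hc, ← add_smul, add_neg_cancel,
    zero_smul, NormedSpace.exp_zero, Matrix.one_mulVec]

/-- Uniqueness for the linear differential equation `u' = Q u`. -/
theorem eq_exp_mulVec (Q : Matrix n n ℝ) (u : ℝ → n → ℝ)
    (hu : ∀ t i, HasDerivAt (fun s => u s i) ((Q *ᵥ u t) i) t) (t : ℝ) :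
    u t = NormedSpace.exp (t • Q) *ᵥ u 0 := by
  set w : ℝ → n → ℝ := fun s => NormedSpace.exp ((-s) • Q) *ᵥ u s with hw
  have hcomm : ∀ s : ℝ, Q * NormedSpace.exp (s • Q) = NormedSpace.exp (s • Q) * Q := by
    intro s
    exact (((Commute.refl Q).smul_left s).symm.exp_right).eq
  have hderiv : ∀ s i, HasDerivAt (fun s => w s i) 0 s := by
    intro s i
    have h1 : ∀ j, HasDerivAt (fun s : ℝ => NormedSpace.exp ((-s) • Q) i j)
        (-(NormedSpace.exp ((-s) • Q) * Q) i j) s := by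
      intro j
      have h2 := (hasDerivAt_exp_smul_entry Q (-s) i j).scomp s (hasDerivAt_neg s)
      rw [hcomm] at h2
      exact h2.congr_deriv (by simp)
    have h3 : HasDerivAt (fun s : ℝ => ∑ j, NormedSpace.exp ((-s) • Q) i j * u s j)
        (∑ j, (-(NormedSpace.exp ((-s) • Q) * Q) i j * u s j
          + NormedSpace.exp ((-s) • Q) i j * (Q *ᵥ u s) j)) s :=
      HasDerivAt.fun_sum fun j _ => (h1 j).mul (hu s j)
    have h4 : ∑ j, (-(NormedSpace.exp ((-s) • Q) * Q) i j * u s j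
          + NormedSpace.exp ((-s) • Q) i j * (Q *ᵥ u s) j) = 0 := by
      have h5 := congrFun (Matrix.mulVec_mulVec (u s) (NormedSpace.exp ((-s) • Q)) Q) i
      simp only [Matrix.mulVec, dotProduct] at h5 ⊢
      rw [Finset.sum_add_distrib, h5, ← Finset.sum_add_distrib]
      simp
    rw [h4] at h3
    exact h3
  have hconst : w t = w 0 := by
    funext i
    exact is_const_of_deriv_eq_zero (f := fun s => w s i)
      (fun s => (hderiv s i).differentiableAt) (fun s => (hderiv s i).deriv) t 0
  have h0 : w 0 = u 0 := by simp [hw]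
  rw [← h0, ← hconst, hw, exp_neg_smul_mulVec]

/-- Adding a multiple `c` of the identity makes all entries nonnegative, and it multiplies the
semigroup by `exp (c * t)` only; uniqueness for the differential equation identifies the two. -/
theorem exp_smul_entry_nonneg (Q : Matrix n n ℝ) (hQ : ∀ i j, i ≠ j → 0 ≤ Q i j) {t : ℝ}
    (ht : 0 ≤ t) (i j : n) : 0 ≤ NormedSpace.exp (t • Q) i j := by
  obtain ⟨c, hc⟩ : ∃ c : ℝ, ∀ i, 0 ≤ Q i i + c := by
    refine ⟨∑ i, |Q i i|, fun i => ?_⟩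
    have : |Q i i| ≤ ∑ i, |Q i i| :=
      Finset.single_le_sum (f := fun i => |Q i i|) (fun i _ => abs_nonneg _) (Finset.mem_univ i)
    have h2 := neg_abs_le (Q i i)
    linarith
  set v : n → ℝ := Pi.single j 1 with hv
  have h := eq_exp_mulVec (Q + c • (1 : Matrix n n ℝ))
    (fun s i => Real.exp (s * c) * (NormedSpace.exp (s • Q) *ᵥ v) i) (by
      intro s i
      have h1 : HasDerivAt (fun s : ℝ => Real.exp (s * c)) (Real.exp (s * c) * c) s := by
        simpa using ((hasDerivAt_id s).mul_const c).exp
      refine (h1.mul (hasDerivAt_exp_mulVec Q v s i)).congr_deriv ?_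
      have e : (fun i => Real.exp (s * c) * (NormedSpace.exp (s • Q) *ᵥ v) i)
          = Real.exp (s * c) • (NormedSpace.exp (s • Q) *ᵥ v) := rfl
      rw [e, Matrix.mulVec_smul, Matrix.add_mulVec, Matrix.smul_mulVec, Matrix.one_mulVec]
      simp only [Pi.smul_apply, Pi.add_apply, smul_eq_mul]
      ring) t
  have h0 : (fun i => Real.exp (0 * c) * (NormedSpace.exp ((0 : ℝ) • Q) *ᵥ v) i) = v := by
    funext i; simp
  rw [h0] at h
  have hi := congrFun h i
  simp only [hv, Matrix.mulVec_single_one, Matrix.col_apply] at hi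
  have hpos : 0 ≤ NormedSpace.exp (t • (Q + c • (1 : Matrix n n ℝ))) i j := by
    refine exp_entry_nonneg_of_nonneg _ (fun a b => ?_) i j
    simp only [Matrix.smul_apply, Matrix.add_apply, smul_eq_mul, Matrix.one_apply]
    refine mul_nonneg ht ?_
    split_ifs with hab
    · subst hab; simpa using hc a
    · simpa using hQ a b hab
  rw [← hi] at hpos
  exact nonneg_of_mul_nonneg_right hpos (Real.exp_pos _)

end Semigroup

/-! ### The heat semigroup of the finite-volume process -/

variable {k : ℕ} {p : ℝ}

open scoped Matrix

theorem siteMean_sum {V : Type} [DecidableEq V] {ι : Type*} (s : Finset ι) (x : V)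
    (f : ι → (V → Bool) → ℝ) (ω : V → Bool) :
    siteMean p x (fun ω => ∑ i ∈ s, f i ω) ω = ∑ i ∈ s, siteMean p x (f i) ω := by
  simp only [siteMean_eq, Finset.mul_sum, Finset.sum_add_distrib]

theorem rateMatrix_mulVec (A : Finset (Vertex k)) (f : Config A → ℝ) :
    rateMatrix p A *ᵥ f = finGenerator p A f := by
  funext η
  have e : f = fun η => ∑ σ, f σ * (if η = σ then 1 else 0) := by funext η; simp
  conv_rhs => rw [e]
  simp only [Matrix.mulVec, dotProduct, rateMatrix, Matrix.of_apply, finGenerator, Finset.sum_mul]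
  rw [Finset.sum_comm]
  refine Finset.sum_congr rfl fun x _ => ?_
  rw [siteMean_sum, ← Finset.sum_sub_distrib, Finset.mul_sum]
  refine Finset.sum_congr rfl fun σ _ => ?_
  simp only [siteMean_eq]
  ring

/-- The heat semigroup. -/
def heat (p : ℝ) (A : Finset (Vertex k)) (t : ℝ) (f : Config A → ℝ) : Config A → ℝ :=
  NormedSpace.exp (t • rateMatrix p A) *ᵥ f

theorem heat_apply (A : Finset (Vertex k)) (t : ℝ) (f : Config A → ℝ) (η : Config A) :
    heat p A t f η = ∑ σ, lawAt p A t η σ * f σ := rfl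

theorem hasDerivAt_heat (A : Finset (Vertex k)) (f : Config A → ℝ) (t : ℝ) (η : Config A) :
    HasDerivAt (fun s => heat p A s f η) (finGenerator p A (heat p A t f) η) t := by
  rw [← rateMatrix_mulVec]
  exact hasDerivAt_exp_mulVec _ f t η

/-- The semigroup property, the action on eigenfunctions and the factorization over subtrees all
follow by exhibiting a solution of this equation. -/
theorem eq_heat {A : Finset (Vertex k)} (u : ℝ → Config A → ℝ)
    (hu : ∀ t η, HasDerivAt (fun s => u s η) (finGenerator p A (u t) η) t) (t : ℝ) :
    u t = heat p A t (u 0) := by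
  refine eq_exp_mulVec _ u (fun t η => ?_) t
  rw [rateMatrix_mulVec]
  exact hu t η

theorem heat_zero (A : Finset (Vertex k)) (f : Config A → ℝ) : heat p A 0 f = f := by
  simp [heat]

theorem heat_heat (A : Finset (Vertex k)) (s t : ℝ) (f : Config A → ℝ) :
    heat p A s (heat p A t f) = heat p A (s + t) f := by
  have h := eq_heat (p := p) (A := A) (fun s => heat p A (s + t) f) (fun s η =>
    (hasDerivAt_heat A f (s + t) η).comp_add_const s t) s
  simp only [zero_add] at h
  exact h.symm

theorem heat_smul (A : Finset (Vertex k)) (t c : ℝ) (f : Config A → ℝ) :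
    heat p A t (c • f) = c • heat p A t f := Matrix.mulVec_smul _ _ _

theorem heat_sum {ι : Type*} (A : Finset (Vertex k)) (t : ℝ) (s : Finset ι)
    (f : ι → Config A → ℝ) : heat p A t (∑ i ∈ s, f i) = ∑ i ∈ s, heat p A t (f i) :=
  Matrix.mulVec_sum _ _ _

theorem finGenerator_smul (A : Finset (Vertex k)) (c : ℝ) (f : Config A → ℝ) :
    finGenerator p A (c • f) = c • finGenerator p A f := by
  rw [← rateMatrix_mulVec, ← rateMatrix_mulVec, Matrix.mulVec_smul]

theorem finGenerator_add (A : Finset (Vertex k)) (f g : Config A → ℝ) :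
    finGenerator p A (f + g) = finGenerator p A f + finGenerator p A g := by
  rw [← rateMatrix_mulVec, ← rateMatrix_mulVec, ← rateMatrix_mulVec, Matrix.mulVec_add]

theorem heat_of_eigen {A : Finset (Vertex k)} {c : ℝ} {f : Config A → ℝ}
    (hf : finGenerator p A f = c • f) (t : ℝ) : heat p A t f = Real.exp (c * t) • f := by
  have h := eq_heat (p := p) (A := A) (fun s => Real.exp (c * s) • f) (fun s η => by
    rw [finGenerator_smul, hf]
    have h1 : HasDerivAt (fun s : ℝ => Real.exp (c * s)) (Real.exp (c * s) * c) s := by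
      simpa using ((hasDerivAt_id s).const_mul c).exp
    simpa [mul_assoc] using h1.mul_const (f η)) t
  simp only [mul_zero, Real.exp_zero, one_smul] at h
  exact h.symm

theorem finGenerator_const (A : Finset (Vertex k)) (c : ℝ) :
    finGenerator p A (fun _ => c) = 0 := by
  funext η
  simp only [finGenerator, siteMean_const, sub_self, mul_zero, Finset.sum_const_zero,
    Pi.zero_apply]

theorem heat_const (A : Finset (Vertex k)) (t c : ℝ) :
    heat p A t (fun _ => c) = fun _ => c := by
  have := heat_of_eigen (p := p) (A := A) (c := 0) (f := fun _ => c)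
    (by rw [finGenerator_const, zero_smul]) t
  simpa using this

theorem rateMatrix_nonneg (h0 : 0 ≤ p) (h1 : p ≤ 1) (A : Finset (Vertex k)) (η σ : Config A)
    (h : η ≠ σ) : 0 ≤ rateMatrix p A η σ := by
  simp only [rateMatrix, Matrix.of_apply, finGenerator]
  refine Finset.sum_nonneg fun x _ => mul_nonneg ?_ ?_
  · unfold finConstraint constraint; split_ifs <;> simp
  · rw [if_neg h, sub_zero, siteMean_eq]
    have : 0 ≤ 1 - p := by linarith
    refine add_nonneg (mul_nonneg h0 ?_) (mul_nonneg this ?_) <;> split_ifs <;> simp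

theorem lawAt_nonneg (h0 : 0 ≤ p) (h1 : p ≤ 1) (A : Finset (Vertex k)) {t : ℝ} (ht : 0 ≤ t)
    (η σ : Config A) : 0 ≤ lawAt p A t η σ :=
  exp_smul_entry_nonneg _ (fun η σ h => rateMatrix_nonneg h0 h1 A η σ h) ht η σ

theorem heat_mono (h0 : 0 ≤ p) (h1 : p ≤ 1) {A : Finset (Vertex k)} {t : ℝ} (ht : 0 ≤ t)
    {f g : Config A → ℝ} (h : ∀ σ, f σ ≤ g σ) (η : Config A) :
    heat p A t f η ≤ heat p A t g η := by
  rw [heat_apply, heat_apply]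
  exact Finset.sum_le_sum fun σ _ =>
    mul_le_mul_of_nonneg_left (h σ) (lawAt_nonneg h0 h1 A ht η σ)

/-! ### Reversibility and decay of the variance -/

theorem mean_mul_finGenerator_comm {A : Finset (Vertex k)} (f g : Config A → ℝ) :
    mean p (fun η => f η * finGenerator p A g η)
      = mean p (fun η => finGenerator p A f η * g η) := by
  have h1 := mean_mul_neg_finGenerator (p := p) f g fun _ => false
  have h2 := mean_mul_neg_finGenerator (p := p) g f fun _ => false
  have e : ∀ x, grad x (lift f) * grad x (lift g) = grad x (lift g) * grad x (lift f) :=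
    fun x => mul_comm _ _
  simp only [e] at h1
  rw [← h2] at h1
  simp only [mul_neg, mean, Finset.sum_neg_distrib, neg_inj] at h1 ⊢
  rw [h1]
  exact Finset.sum_congr rfl fun η _ => by ring

theorem hasDerivAt_mean {A : Finset (Vertex k)} {u : ℝ → Config A → ℝ} {u' : Config A → ℝ}
    {t : ℝ} (h : ∀ η, HasDerivAt (fun s => u s η) (u' η) t) :
    HasDerivAt (fun s => mean p (u s)) (mean p u') t :=
  HasDerivAt.fun_sum fun η _ => (h η).const_mul _

/-- Reversibility makes `mean (heat s f * heat (t - s) g)` constant in `s`. -/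
theorem mean_heat_mul {A : Finset (Vertex k)} (t : ℝ) (f g : Config A → ℝ) :
    mean p (fun η => heat p A t f η * g η) = mean p (fun η => f η * heat p A t g η) := by
  set φ : ℝ → ℝ := fun s => mean p fun η => heat p A s f η * heat p A (t - s) g η with hφ
  have hd : ∀ s, HasDerivAt φ 0 s := by
    intro s
    have h1 : ∀ η, HasDerivAt (fun s => heat p A s f η * heat p A (t - s) g η)
        (finGenerator p A (heat p A s f) η * heat p A (t - s) g η
          + heat p A s f η * -finGenerator p A (heat p A (t - s) g) η) s := by
      intro η
      refine (hasDerivAt_heat A f s η).mul ?_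
      exact (hasDerivAt_heat (p := p) A g (t - s) η).comp_const_sub t s
    have h3 := hasDerivAt_mean (p := p) h1
    have e : mean p (fun η => finGenerator p A (heat p A s f) η * heat p A (t - s) g η
          + heat p A s f η * -finGenerator p A (heat p A (t - s) g) η) = 0 := by
      rw [mean_add, ← mean_mul_finGenerator_comm]
      simp only [mul_neg, mean, Finset.sum_neg_distrib, add_neg_cancel]
    rw [e] at h3
    exact h3
  have := is_const_of_deriv_eq_zero (f := φ) (fun s => (hd s).differentiableAt)
    (fun s => (hd s).deriv) t 0
  simpa [hφ, heat_zero] using this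

theorem mean_heat {A : Finset (Vertex k)} (t : ℝ) (f : Config A → ℝ) :
    mean p (heat p A t f) = mean p f := by
  have := mean_heat_mul (p := p) t f fun _ => 1
  rw [heat_const] at this
  simpa using this

/-- The derivative of the variance is minus twice the Dirichlet form, hence at most `-2 * gap` times
the variance. -/
theorem var_heat_le (h0 : 0 < p) (h1 : p < 1) {A : Finset (Vertex k)} (f : Config A → ℝ)
    {t : ℝ} (ht : 0 ≤ t) :
    var p (heat p A t f) ≤ Real.exp (-(2 * gap p A * t)) * var p f := by
  set v : ℝ → ℝ := fun s => Real.exp (2 * gap p A * s) * var p (heat p A s f) with hv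
  have hvar : ∀ s, HasDerivAt (fun s => var p (heat p A s f))
      (-(2 * dirichletForm p A (heat p A s f))) s := by
    intro s
    have e : (fun s => var p (heat p A s f))
        = fun s => mean p (fun η => heat p A s f η ^ 2) - mean p f ^ 2 := by
      funext s; rw [var, mean_heat]
    rw [e]
    have h2 := (hasDerivAt_mean (p := p) fun η =>
      (hasDerivAt_heat (p := p) A f s η).fun_pow 2).sub_const (mean p f ^ 2)
    refine h2.congr_deriv ?_
    rw [dirichletForm, ← mean_const_mul]
    simp only [mean, ← Finset.sum_neg_distrib]
    refine Finset.sum_congr rfl fun η _ => ?_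
    push_cast
    ring
  have hd : ∀ s, HasDerivAt v (Real.exp (2 * gap p A * s) * (2 * gap p A)
        * var p (heat p A s f)
      + Real.exp (2 * gap p A * s) * -(2 * dirichletForm p A (heat p A s f))) s := by
    intro s
    have h2 : HasDerivAt (fun s : ℝ => Real.exp (2 * gap p A * s))
        (Real.exp (2 * gap p A * s) * (2 * gap p A)) s := by
      simpa using ((hasDerivAt_id s).const_mul (2 * gap p A)).exp
    exact h2.mul (hvar s)
  have hanti : Antitone v := by
    refine antitone_of_deriv_nonpos (fun s => (hd s).differentiableAt) fun s => ?_
    rw [(hd s).deriv]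
    have h3 := gap_mul_var_le h0 h1 (heat p A s f)
    have h4 := Real.exp_pos (2 * gap p A * s)
    nlinarith
  have := hanti ht
  simp only [hv, mul_zero, Real.exp_zero, one_mul, heat_zero] at this
  rw [Real.exp_neg, inv_mul_eq_div, le_div_iff₀ (Real.exp_pos _), mul_comm]
  exact this

/-! ### Subtrees evolve independently -/

/-- The configuration seen in the subtree of depth `h` below `v`. -/
def proj {L : ℕ} (h : ℕ) (v : Vertex k) (ζ : Config (tree k L)) : Config (tree k h) :=
  fun y => zeroExt ζ ((y : Vertex k) ++ v)

theorem zeroExt_proj {L h : ℕ} {v : Vertex k} (hv : v.length + h = L) (ζ : Config (tree k L))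
    (z : Vertex k) : zeroExt (proj h v ζ) z = zeroExt ζ (z ++ v) := by
  by_cases hz : z ∈ tree k h
  · simp [zeroExt, hz, proj]
  · have : z ++ v ∉ tree k L := by
      rw [mem_tree] at hz ⊢
      rw [List.length_append]
      omega
    simp [zeroExt, hz, this]

theorem append_mem_tree {L h : ℕ} {v y : Vertex k} (hv : v.length + h = L) (hy : y ∈ tree k h) :
    y ++ v ∈ tree k L := by
  rw [mem_tree] at hy ⊢
  rw [List.length_append]
  omega

theorem proj_update_append {L h : ℕ} {v : Vertex k} (hv : v.length + h = L)
    (ζ : Config (tree k L)) (y : tree k h) (b : Bool) :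
    proj h v (Function.update ζ ⟨y ++ v, append_mem_tree hv y.2⟩ b)
      = Function.update (proj h v ζ) y b := by
  funext z
  have hz := append_mem_tree hv z.2
  by_cases h : z = y
  · subst h; simp [proj, zeroExt, hz]
  · have h' : (⟨z ++ v, hz⟩ : tree k L) ≠ ⟨y ++ v, append_mem_tree hv y.2⟩ := by
      intro hh
      exact h (Subtype.ext (List.append_cancel_right (congrArg Subtype.val hh)))
    simp [proj, zeroExt, hz, Function.update_of_ne h, Function.update_of_ne h']

theorem proj_update_of_not_suffix {L h : ℕ} {v : Vertex k} (ζ : Config (tree k L)) (x : tree k L)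
    (hx : ¬ v <:+ (x : Vertex k)) (b : Bool) : proj h v (Function.update ζ x b) = proj h v ζ := by
  funext z
  unfold proj zeroExt
  split_ifs with hz
  · refine Function.update_of_ne ?_ _ _
    rintro rfl
    exact hx (List.suffix_append _ _)
  · rfl

/-- The constraint at a site below `v` involves only sites below `v`, and the subtree of depth `h`
reaches the bottom of the tree: the spins seen by `proj` form an autonomous copy of the process. -/
theorem finGenerator_comp_proj {L h : ℕ} {v : Vertex k} (hv : v.length + h = L)
    (φ : Config (tree k h) → ℝ) (ζ : Config (tree k L)) :
    finGenerator p (tree k L) (fun ζ => φ (proj h v ζ)) ζ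
      = finGenerator p (tree k h) φ (proj h v ζ) := by
  symm
  refine Fintype.sum_of_injective
    (fun y : tree k h => (⟨y ++ v, append_mem_tree hv y.2⟩ : tree k L)) ?_ _ _ ?_ ?_
  · intro y z hyz
    exact Subtype.ext (List.append_cancel_right (congrArg Subtype.val hyz))
  · intro x hx
    have : ¬ v <:+ (x : Vertex k) := by
      rintro ⟨w, hw⟩
      refine hx ⟨⟨w, mem_tree.2 ?_⟩, Subtype.ext hw⟩
      have := mem_tree.1 x.2
      rw [← hw, List.length_append] at this
      omega
    simp only [siteMean_eq, proj_update_of_not_suffix ζ x this]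
    ring
  · intro y
    simp only [siteMean_eq, proj_update_append hv]
    congr 1
    simp only [finConstraint, constraint, zeroExt_proj hv, List.cons_append]

/-- A Leibniz rule without cross terms: every site affects at most one factor. -/
theorem finGenerator_prod {A : Finset (Vertex k)} {ι : Type*} [DecidableEq ι] (S : Finset ι)
    (f : ι → Config A → ℝ)
    (hf : ∀ v ∈ S, ∀ w ∈ S, v ≠ w → ∀ x : A, (∀ ζ b, f v (Function.update ζ x b) = f v ζ) ∨
      ∀ ζ b, f w (Function.update ζ x b) = f w ζ) (ζ : Config A) :
    finGenerator p A (fun ζ => ∏ v ∈ S, f v ζ) ζ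
      = ∑ v ∈ S, (∏ w ∈ S.erase v, f w ζ) * finGenerator p A (f v) ζ := by
  induction S using Finset.induction_on with
  | empty =>
    simp only [Finset.prod_empty, Finset.sum_empty]
    exact congrFun (finGenerator_const A 1) ζ
  | insert v S hv ih =>
    have hS := ih fun w hw w' hw' => hf w (by simp [hw]) w' (by simp [hw'])
    have key : finGenerator p A (fun ζ => ∏ w ∈ insert v S, f w ζ) ζ
        = (∏ w ∈ S, f w ζ) * finGenerator p A (f v) ζ
          + f v ζ * finGenerator p A (fun ζ => ∏ w ∈ S, f w ζ) ζ := by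
      simp only [Finset.prod_insert hv]
      simp only [finGenerator, Finset.mul_sum, ← Finset.sum_add_distrib]
      refine Finset.sum_congr rfl fun x _ => ?_
      by_cases hx : ∀ ζ b, f v (Function.update ζ x b) = f v ζ
      · simp only [siteMean_eq, hx]
        ring
      · have hw : ∀ w ∈ S, ∀ ζ b, f w (Function.update ζ x b) = f w ζ := by
          intro w hw
          have hne : v ≠ w := fun h => hv (h ▸ hw)
          exact (hf v (by simp) w (by simp [hw]) hne x).resolve_left hx
        have hp : ∀ ζ b, ∏ w ∈ S, f w (Function.update ζ x b) = ∏ w ∈ S, f w ζ := fun ζ b =>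
          Finset.prod_congr rfl fun w hw' => hw w hw' ζ b
        simp only [siteMean_eq, hp]
        ring
    rw [key, hS, Finset.sum_insert hv, Finset.erase_insert hv, Finset.mul_sum]
    congr 1
    refine Finset.sum_congr rfl fun w hw => ?_
    have hne : v ≠ w := fun h => hv (h ▸ hw)
    rw [Finset.erase_insert_of_ne hne, Finset.prod_insert (fun h => hv (Finset.mem_of_mem_erase h)),
      mul_assoc]

/-- Subtrees rooted at the same level evolve independently: by the Leibniz rule, the product of the
separate evolutions solves the equation of the whole tree. -/
theorem heat_prod_proj {L h : ℕ} (S : Finset (Vertex k)) (hS : ∀ v ∈ S, v.length + h = L)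
    (φ : Vertex k → Config (tree k h) → ℝ) (t : ℝ) (ζ : Config (tree k L)) :
    heat p (tree k L) t (fun ζ => ∏ v ∈ S, φ v (proj h v ζ)) ζ
      = ∏ v ∈ S, heat p (tree k h) t (φ v) (proj h v ζ) := by
  have hu := eq_heat (p := p) (A := tree k L)
    (fun t ζ => ∏ v ∈ S, heat p (tree k h) t (φ v) (proj h v ζ)) (by
      intro t ζ
      have h1 := HasDerivAt.fun_finsetProd (u := S) (x := t)
        (f := fun v s => heat p (tree k h) s (φ v) (proj h v ζ)) fun v _ =>
        hasDerivAt_heat (tree k h) (φ v) t (proj h v ζ)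
      refine h1.congr_deriv ?_
      rw [finGenerator_prod S (fun v ζ => heat p (tree k h) t (φ v) (proj h v ζ))]
      · refine Finset.sum_congr rfl fun v hv => ?_
        rw [finGenerator_comp_proj (hS v hv), smul_eq_mul]
      · intro v hv w hw hvw x
        by_cases hx : v <:+ (x : Vertex k)
        · right
          have hx' : ¬ w <:+ (x : Vertex k) := by
            intro hwx
            have hl : v.length = w.length := by have := hS v hv; have := hS w hw; omega
            exact hvw ((List.suffix_of_suffix_length_le hx hwx hl.le).eq_of_length hl)
          intro ζ b
          simp only [proj_update_of_not_suffix ζ x hx']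
        · left
          intro ζ b
          simp only [proj_update_of_not_suffix ζ x hx]) t
  have := congrFun hu ζ
  simp only [heat_zero] at this
  exact this.symm

theorem heat_comp_proj {L h : ℕ} {v : Vertex k} (hv : v.length + h = L)
    (φ : Config (tree k h) → ℝ) (t : ℝ) (ζ : Config (tree k L)) :
    heat p (tree k L) t (fun ζ => φ (proj h v ζ)) ζ = heat p (tree k h) t φ (proj h v ζ) := by
  have := heat_prod_proj (p := p) {v} (by simpa using hv) (fun _ => φ) t ζ
  simpa using this

/-! ### Densities and their distance to equilibrium -/

variable {k : ℕ} {p : ℝ}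

theorem lawAt_eq_heat (A : Finset (Vertex k)) (t : ℝ) (η σ : Config A) :
    lawAt p A t η σ = heat p A t (Pi.single σ 1) η := by
  rw [heat, Matrix.mulVec_single_one]
  rfl

theorem mean_single_mul {A : Finset (Vertex k)} (η : Config A) (g : Config A → ℝ) :
    mean p (fun σ => (Pi.single η 1 : Config A → ℝ) σ * g σ) = mass p η * g η := by
  rw [mean, Finset.sum_eq_single η]
  · simp
  · intro σ _ hσ
    simp [Pi.single_eq_of_ne hσ]
  · simp

theorem mass_mul_lawAt (A : Finset (Vertex k)) (t : ℝ) (η σ : Config A) :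
    mass p η * lawAt p A t η σ = mass p σ * lawAt p A t σ η := by
  have h := mean_heat_mul (p := p) (A := A) t (Pi.single η 1) (Pi.single σ 1)
  rw [mean_single_mul] at h
  have e : (fun ζ => heat p A t (Pi.single η 1) ζ * (Pi.single σ 1 : Config A → ℝ) ζ)
      = fun ζ => (Pi.single σ 1 : Config A → ℝ) ζ * heat p A t (Pi.single η 1) ζ := by
    funext ζ; ring
  rw [e, mean_single_mul, ← lawAt_eq_heat, ← lawAt_eq_heat] at h
  exact h.symm

/-- By reversibility the density is itself an evolution of the normalized point mass, so variance
decay applies to it. -/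
theorem density_eq_heat (h0 : 0 < p) (h1 : p < 1) (A : Finset (Vertex k)) (t : ℝ)
    (η : Config A) :
    density p A t η = heat p A t ((mass p η)⁻¹ • Pi.single η 1) := by
  funext σ
  rw [heat_smul, Pi.smul_apply, ← lawAt_eq_heat, density, smul_eq_mul,
    div_eq_iff (mass_pos h0 h1 σ).ne', mul_assoc, mul_comm (lawAt p A t σ η),
    ← mass_mul_lawAt, ← mul_assoc, inv_mul_cancel₀ (mass_pos h0 h1 η).ne', one_mul]

theorem mean_density_mul (h0 : 0 < p) (h1 : p < 1) (A : Finset (Vertex k)) (t : ℝ)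
    (η : Config A) (g : Config A → ℝ) :
    mean p (fun σ => density p A t η σ * g σ) = heat p A t g η := by
  rw [heat_apply, mean]
  refine Finset.sum_congr rfl fun σ _ => ?_
  have := (mass_pos h0 h1 σ).ne'
  rw [density]
  field_simp

theorem mean_density (h0 : 0 < p) (h1 : p < 1) (A : Finset (Vertex k)) (t : ℝ) (η : Config A) :
    mean p (density p A t η) = 1 := by
  have := mean_density_mul h0 h1 A t η fun _ => 1
  rw [heat_const] at this
  simpa using this

/-- The squared distance to equilibrium in `L²` at time `t`. -/
def sqDist (p : ℝ) (A : Finset (Vertex k)) (t : ℝ) (η : Config A) : ℝ :=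
  mean p fun σ => (density p A t η σ - 1) ^ 2

theorem sqDist_eq_var (h0 : 0 < p) (h1 : p < 1) (A : Finset (Vertex k)) (t : ℝ) (η : Config A) :
    sqDist p A t η = var p (density p A t η) := by
  rw [var_eq_mean_sq, mean_density h0 h1, sqDist]

/-- The semigroup is symmetric, so the squared norm of the density at time `t` is its value at the
starting point at time `2 * t`. Return probabilities are what can be compared with subtrees. -/
theorem sqDist_eq (h0 : 0 < p) (h1 : p < 1) (A : Finset (Vertex k)) (t : ℝ) (η : Config A) :
    sqDist p A t η = lawAt p A (t + t) η η / mass p η - 1 := by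
  rw [sqDist_eq_var h0 h1, var, mean_density h0 h1, density_eq_heat h0 h1]
  simp only [pow_two]
  rw [mean_heat_mul, heat_heat]
  have e : (fun σ => ((mass p η)⁻¹ • (Pi.single η 1 : Config A → ℝ)) σ
        * heat p A (t + t) ((mass p η)⁻¹ • Pi.single η 1) σ)
      = fun σ => (Pi.single η 1 : Config A → ℝ) σ
        * ((mass p η)⁻¹ * heat p A (t + t) ((mass p η)⁻¹ • Pi.single η 1) σ) := by
    funext σ
    rw [Pi.smul_apply, smul_eq_mul]
    ring
  rw [e, mean_single_mul, ← mul_assoc, mul_inv_cancel₀ (mass_pos h0 h1 η).ne', heat_smul,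
    Pi.smul_apply, ← lawAt_eq_heat, smul_eq_mul]
  ring

theorem sqDist_nonneg (h0 : 0 < p) (h1 : p < 1) (A : Finset (Vertex k)) (t : ℝ) (η : Config A) :
    0 ≤ sqDist p A t η := mean_nonneg h0 h1 fun _ => sq_nonneg _

theorem sqDist_add_le (h0 : 0 < p) (h1 : p < 1) (A : Finset (Vertex k)) {s t : ℝ} (ht : 0 ≤ t)
    (η : Config A) :
    sqDist p A (t + s) η ≤ Real.exp (-(2 * gap p A * t)) * sqDist p A s η := by
  rw [sqDist_eq_var h0 h1, sqDist_eq_var h0 h1, density_eq_heat h0 h1, density_eq_heat h0 h1,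
    ← heat_heat]
  exact var_heat_le h0 h1 _ ht

/-! ### Mixing time upper bound -/

/-- The vertices of level `m`. -/
def level (k m : ℕ) : Finset (Vertex k) := (tree k m).filter fun x => x.length = m

theorem mem_level {m : ℕ} {x : Vertex k} : x ∈ level k m ↔ x.length = m := by
  rw [level, Finset.mem_filter, mem_tree]
  exact ⟨fun h => h.2, fun h => ⟨h.le, h⟩⟩

theorem card_level' (k m : ℕ) : (level k m).card = k ^ m := card_level k m le_rfl

theorem mass_succ {L : ℕ} (η : Config (tree k (L + 1))) :
    mass p η = weight p (zeroExt η []) * ∏ v ∈ level k 1, mass p (proj L v η) := by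
  have e1 : ∀ {A : Finset (Vertex k)} (ζ : Config A),
      mass p ζ = ∏ x ∈ A, weight p (zeroExt ζ x) := by
    intro A ζ
    rw [mass, ← Finset.prod_coe_sort A]
    refine Finset.prod_congr rfl fun x _ => ?_
    simp [zeroExt]
  rw [e1, ← Finset.mul_prod_erase (tree k (L + 1)) (fun x => weight p (zeroExt η x))
    (nil_mem_tree k _)]
  congr 1
  -- Sites other than the root are grouped by their ancestor on level 1, obtained by dropping all
  -- but the last entry of the list.
  rw [← Finset.prod_fiberwise_of_maps_to (t := level k 1) (g := fun x => x.drop (x.length - 1))]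
  · refine Finset.prod_congr rfl fun v hv => ?_
    rw [mem_level] at hv
    rw [e1]
    symm
    refine Finset.prod_bij (fun y _ => y ++ v) ?_ ?_ ?_ ?_
    · intro y hy
      simp only [Finset.mem_filter, Finset.mem_erase]
      refine ⟨⟨?_, append_mem_tree (by omega) hy⟩, ?_⟩
      · intro h
        have := congrArg List.length h
        rw [List.length_append, List.length_nil] at this
        omega
      · have : (y ++ v).length - 1 = y.length := by rw [List.length_append]; omega
        rw [this, List.drop_left]
    · intro y _ z _ h
      exact List.append_cancel_right h
    · intro x hx
      simp only [Finset.mem_filter, Finset.mem_erase, mem_tree] at hx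
      refine ⟨x.take (x.length - 1), ?_, ?_⟩
      · rw [mem_tree, List.length_take]; omega
      · rw [← hx.2, List.take_append_drop]
    · intro y hy
      rw [zeroExt_proj (by omega)]
  · intro x hx
    rw [mem_level, List.length_drop]
    have : x.length ≠ 0 := fun h => (Finset.mem_erase.1 hx).1 (List.length_eq_zero_iff.1 h)
    omega

/-- Returning to `η` requires returning in every subtree of the root, and these evolve
independently; the spin of the root is ignored. -/
theorem lawAt_self_le (h0 : 0 ≤ p) (h1 : p ≤ 1) {L : ℕ} {t : ℝ} (ht : 0 ≤ t)
    (η : Config (tree k (L + 1))) :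
    lawAt p (tree k (L + 1)) t η η
      ≤ ∏ v ∈ level k 1, lawAt p (tree k L) t (proj L v η) (proj L v η) := by
  simp only [lawAt_eq_heat]
  rw [← heat_prod_proj (level k 1) (fun v hv => by rw [mem_level.1 hv, add_comm])
    (fun v => Pi.single (proj L v η) 1)]
  refine heat_mono h0 h1 ht (fun σ => ?_) η
  by_cases h : σ = η
  · subst h; simp
  · rw [Pi.single_eq_of_ne h]
    refine Finset.prod_nonneg fun v _ => ?_
    by_cases h' : proj L v σ = proj L v η
    · rw [h', Pi.single_eq_same]; exact zero_le_one
    · rw [Pi.single_eq_of_ne h']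

/-- Each subtree contributes a normalized return probability of at most `1 + 1 / 16`, and the root a
factor of at most `1 / δ`. The bound does not depend on the depth. -/
theorem sqDist_succ_le (h0 : 0 < p) (h1 : p < 1) {δ : ℝ} (hδ : 0 < δ) (hδp : δ ≤ p)
    (hδp' : p ≤ 1 - δ) {L : ℕ} {t : ℝ} (ht : 0 ≤ t)
    (h : ∀ η : Config (tree k L), sqDist p (tree k L) t η ≤ 1 / 16)
    (η : Config (tree k (L + 1))) :
    sqDist p (tree k (L + 1)) t η ≤ (17 / 16) ^ k / δ := by
  have hw : ∀ b, δ ≤ weight p b := by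
    intro b; unfold weight; split_ifs <;> linarith
  have hprod : ∏ v ∈ level k 1, (lawAt p (tree k L) (t + t) (proj L v η) (proj L v η)
      / mass p (proj L v η)) ≤ (17 / 16) ^ k := by
    have := Finset.prod_le_prod (s := level k 1)
      (f := fun v => lawAt p (tree k L) (t + t) (proj L v η) (proj L v η) / mass p (proj L v η))
      (g := fun _ => 17 / 16) (fun v _ => div_nonneg
        (lawAt_nonneg h0.le h1.le _ (by linarith) _ _) (mass_pos h0 h1 _).le) (fun v _ => by
          have := h (proj L v η)
          rw [sqDist_eq h0 h1] at this
          linarith)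
    rwa [Finset.prod_const, card_level', pow_one] at this
  rw [sqDist_eq h0 h1, mass_succ]
  have hw0 := weight_pos h0 h1 (zeroExt η [])
  have hm : 0 < ∏ v ∈ level k 1, mass p (proj L v η) :=
    Finset.prod_pos fun v _ => mass_pos h0 h1 _
  have hl := lawAt_self_le h0.le h1.le (by linarith : 0 ≤ t + t) η
  rw [Finset.prod_div_distrib, div_le_iff₀ hm] at hprod
  have h3 : lawAt p (tree k (L + 1)) (t + t) η η
      / (weight p (zeroExt η []) * ∏ v ∈ level k 1, mass p (proj L v η)) ≤ (17 / 16) ^ k / δ := by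
    rw [div_le_div_iff₀ (mul_pos hw0 hm) hδ]
    have h4 := hw (zeroExt η [])
    have h5 := hl.trans hprod
    calc lawAt p (tree k (L + 1)) (t + t) η η * δ
        ≤ ((17 / 16) ^ k * ∏ v ∈ level k 1, mass p (proj L v η)) * weight p (zeroExt η []) :=
          mul_le_mul h5 h4 hδ.le (by positivity)
      _ = _ := by ring
  linarith

theorem gap_mul_relaxationTime (h0 : 0 < p) (h1 : p < 1) (L : ℕ) :
    gap p (tree k L) * relaxationTime p (tree k L) = 1 := mul_inv_cancel₀ (gap_pos h0 h1 L).ne'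

/-- Induction on the depth: passing to one more level worsens the distance to a constant, and a
further time `c` times the relaxation time brings it back to `1 / 16`. This gives a time linear in
`L`, although the smallest mass is exponentially small in the number of vertices. -/
theorem sqDist_le (h0 : 0 < p) (h1 : p < 1) {δ c : ℝ} (hδ : 0 < δ) (hδp : δ ≤ p)
    (hδp' : p ≤ 1 - δ) (hc : 0 < c)
    (hc2 : Real.exp (-(2 * c)) * ((17 / 16) ^ k / δ) ≤ 1 / 16) (L : ℕ)
    (η : Config (tree k L)) :
    sqDist p (tree k L) (c * (L + 1) * relaxationTime p (tree k L)) η ≤ 1 / 16 := by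
  have hstep : ∀ (M : ℕ) (s t : ℝ) (η : Config (tree k M)),
      c * relaxationTime p (tree k M) + s ≤ t → sqDist p (tree k M) s η ≤ (17 / 16) ^ k / δ →
      sqDist p (tree k M) t η ≤ 1 / 16 := by
    intro M s t η hst hs
    have hT := relaxationTime_pos (k := k) h0 h1 M
    have hts : 0 ≤ t - s := by nlinarith
    have h2 := sqDist_add_le h0 h1 (tree k M) (s := s) hts η
    rw [sub_add_cancel] at h2
    refine h2.trans (le_trans (mul_le_mul ?_ hs (sqDist_nonneg h0 h1 _ _ _)
      (Real.exp_pos _).le) hc2)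
    rw [Real.exp_le_exp, neg_le_neg_iff, mul_assoc]
    have hg := gap_pos (k := k) h0 h1 M
    have h3 := gap_mul_relaxationTime (k := k) h0 h1 M
    have h4 : c * relaxationTime p (tree k M) ≤ t - s := by linarith
    have h5 := mul_le_mul_of_nonneg_left h4 hg.le
    have h6 : gap p (tree k M) * (c * relaxationTime p (tree k M)) = c := by
      rw [mul_left_comm, h3, mul_one]
    linarith
  induction L with
  | zero =>
    refine hstep 0 0 _ η (by simp) ?_
    rw [sqDist_eq h0 h1]
    have hlaw : lawAt p (tree k 0) (0 + 0) η η = 1 := by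
      rw [lawAt_eq_heat, add_zero, heat_zero, Pi.single_eq_same]
    have hmass : δ ≤ mass p η := by
      have hcard : Fintype.card (tree k 0) = 1 := by
        have h := sum_tree_length (k := k) 0 fun _ => 1
        simpa using h
      obtain ⟨x, hx⟩ := Fintype.card_eq_one_iff.1 hcard
      have : mass p η = weight p (η x) := by
        rw [mass, Finset.prod_eq_single x]
        · exact fun y _ hy => absurd (hx y) hy
        · simp
      rw [this]
      unfold weight; split_ifs <;> linarith
    rw [hlaw]
    have h3 : 1 / mass p η ≤ 1 / δ := one_div_le_one_div_of_le hδ hmass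
    have h4 : (1 : ℝ) ≤ (17 / 16) ^ k := one_le_pow₀ (by norm_num)
    have h5 : 1 / δ ≤ (17 / 16) ^ k / δ := by gcongr
    linarith
  | succ L ih =>
    have hT := relaxationTime_pos (k := k) h0 h1 L
    have hmono := relaxationTime_mono (k := k) h0 h1 (Nat.le_succ L)
    refine hstep (L + 1) (c * (L + 1) * relaxationTime p (tree k L)) _ η ?_ ?_
    · push_cast
      have : c * (L + 1) * relaxationTime p (tree k L)
          ≤ c * (L + 1) * relaxationTime p (tree k (L + 1)) :=
        mul_le_mul_of_nonneg_left hmono (by positivity)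
      linarith
    · exact sqDist_succ_le h0 h1 hδ hδp hδp' (by positivity) ih η

theorem rpow_two_mean_le_iff {A : Finset (Vertex k)} (t : ℝ) (η : Config A) :
    (mean p fun σ => |density p A t η σ - 1| ^ (2 : ℝ)) ^ (1 / (2 : ℝ)) ≤ 1 / 4
      ↔ sqDist p A t η ≤ 1 / 16 := by
  simp only [Real.rpow_two, sq_abs]
  rw [← Real.sqrt_eq_rpow, Real.sqrt_le_left (by norm_num)]
  norm_num [sqDist]

theorem rpow_one_mean {A : Finset (Vertex k)} (t : ℝ) (η : Config A) :
    (mean p fun σ => |density p A t η σ - 1| ^ (1 : ℝ)) ^ (1 / (1 : ℝ))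
      = mean p fun σ => |density p A t η σ - 1| := by
  simp only [Real.rpow_one, div_one]

theorem mean_abs_le (h0 : 0 < p) (h1 : p < 1) {A : Finset (Vertex k)} {t : ℝ} {η : Config A}
    (h : sqDist p A t η ≤ 1 / 16) : (mean p fun σ => |density p A t η σ - 1|) ≤ 1 / 4 := by
  have h2 := var_nonneg h0 h1 fun σ => |density p A t η σ - 1|
  rw [var] at h2
  simp only [sq_abs] at h2
  refine abs_le_of_sq_le_sq' ?_ (by norm_num) |>.2
  rw [sqDist] at h
  linarith

theorem mixingTime_two_le (h0 : 0 < p) (h1 : p < 1) {A : Finset (Vertex k)} {t : ℝ}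
    (ht : 0 ≤ t) (h : ∀ η : Config A, sqDist p A t η ≤ 1 / 16) :
    mixingTime 1 p A ≤ mixingTime 2 p A ∧ mixingTime 2 p A ≤ t := by
  have hmem : t ∈ {t : ℝ | 0 ≤ t ∧ ∀ η : Config A,
      (mean p fun σ => |density p A t η σ - 1| ^ (2 : ℝ)) ^ (1 / (2 : ℝ)) ≤ 1 / 4} :=
    ⟨ht, fun η => (rpow_two_mean_le_iff t η).2 (h η)⟩
  refine ⟨csInf_le_csInf ⟨0, fun s hs => hs.1⟩ ⟨t, hmem⟩ ?_, csInf_le ⟨0, fun s hs => hs.1⟩ hmem⟩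
  rintro s ⟨hs, hs2⟩
  refine ⟨hs, fun η => ?_⟩
  rw [rpow_one_mean]
  exact mean_abs_le h0 h1 ((rpow_two_mean_le_iff s η).1 (hs2 η))

/-! ### Mixing time lower bound -/

/-- Compactness gives a minimizer of the Dirichlet form among functions of mean zero and unit second
moment; perturbing it by a point mass at each `η` shows that it is an eigenfunction. -/
theorem exists_eigenfunction (h0 : 0 < p) (h1 : p < 1) {A : Finset (Vertex k)}
    (hA : A.Nonempty) :
    ∃ f : Config A → ℝ, f ≠ 0 ∧ finGenerator p A f = (-gap p A) • f := by
  set K : Set (Config A → ℝ) := {f | mean p f = 0 ∧ mean p (fun η => f η ^ 2) = 1} with hK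
  have hc1 : Continuous fun f : Config A → ℝ => mean p f := by
    unfold mean; fun_prop
  have hc2 : Continuous fun f : Config A → ℝ => mean p fun η => f η ^ 2 := by
    unfold mean; fun_prop
  have hc3 : Continuous fun f : Config A → ℝ => dirichletForm p A f := by
    unfold dirichletForm mean finGenerator siteMean; fun_prop
  have hclosed : IsClosed K :=
    (isClosed_eq hc1 continuous_const).inter (isClosed_eq hc2 continuous_const)
  have hbdd : Bornology.IsBounded K := by
    rw [isBounded_iff_forall_norm_le]
    refine ⟨∑ η : Config A, (1 + (mass p η)⁻¹), fun f hf => ?_⟩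
    have hpos : ∀ η : Config A, 0 ≤ 1 + (mass p η)⁻¹ := fun η => by
      have := inv_pos.2 (mass_pos h0 h1 η); linarith
    rw [pi_norm_le_iff_of_nonneg (Finset.sum_nonneg fun η _ => hpos η)]
    intro η
    have h2 : mass p η * f η ^ 2 ≤ 1 := by
      rw [← hf.2]
      exact Finset.single_le_sum (f := fun η => mass p η * f η ^ 2)
        (fun σ _ => mul_nonneg (mass_pos h0 h1 σ).le (sq_nonneg _)) (Finset.mem_univ η)
    have h3 : f η ^ 2 ≤ (mass p η)⁻¹ := by
      rw [← one_div, le_div_iff₀ (mass_pos h0 h1 η)]; linarith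
    have h4 : ‖f η‖ ≤ 1 + (mass p η)⁻¹ := by
      rw [Real.norm_eq_abs]
      have := sq_abs (f η)
      nlinarith [sq_nonneg (|f η| - 1), abs_nonneg (f η)]
    exact h4.trans (Finset.single_le_sum (f := fun η : Config A => 1 + (mass p η)⁻¹)
      (fun σ _ => hpos σ) (Finset.mem_univ η))
  have hnorm : ∀ g : Config A → ℝ, (¬ ∃ a : ℝ, ∀ η, g η = a) →
      (fun η => (√(var p g))⁻¹ * (g η - mean p g)) ∈ K := by
    intro g hg
    have hv := var_pos h0 h1 hg
    constructor
    · rw [mean_const_mul, mean_sub, mean_const, sub_self, mul_zero]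
    · simp only [mul_pow, inv_pow]
      rw [mean_const_mul, Real.sq_sqrt hv.le, ← var_eq_mean_sq, inv_mul_cancel₀ hv.ne']
  have hDnorm : ∀ (g : Config A → ℝ) (c a : ℝ),
      dirichletForm p A (fun η => c * (g η - a)) = c ^ 2 * dirichletForm p A g := by
    intro g c a
    have e : (fun η => c * (g η - a)) = c • (g + fun _ => -a) := by
      funext η; simp [sub_eq_add_neg]
    have e2 : finGenerator p A (c • (g + fun _ => -a)) = c • finGenerator p A g := by
      rw [finGenerator_smul, finGenerator_add, finGenerator_const, add_zero]
    have e3 : mean p (finGenerator p A g) = 0 := by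
      have := mean_mul_finGenerator_comm (p := p) (fun _ => 1) g
      rw [finGenerator_const] at this
      simpa [mean] using this
    rw [dirichletForm, dirichletForm, e, e2, ← mean_const_mul]
    have e4 : (fun η => c * (g η - a) * -(c • finGenerator p A g) η)
        = fun η => c ^ 2 * (g η * -finGenerator p A g η) + (c ^ 2 * a) * finGenerator p A g η := by
      funext η
      simp only [Pi.smul_apply, smul_eq_mul]
      ring
    rw [e4, mean_add, mean_const_mul (c ^ 2 * a), e3, mul_zero, add_zero]
  obtain ⟨g0, hg0⟩ := exists_nonconst hA
  obtain ⟨f, hfK, hmin⟩ := (Metric.isCompact_of_isClosed_isBounded hclosed hbdd).exists_isMinOn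
    ⟨_, hnorm g0 hg0⟩ hc3.continuousOn
  have hvar : var p f = 1 := by rw [var, hfK.1, hfK.2]; norm_num
  have hf0 : f ≠ 0 := by
    rintro rfl
    have := hfK.2
    simp [mean] at this
  have hgap : dirichletForm p A f = gap p A := by
    refine le_antisymm ?_ ?_
    · refine le_csInf ⟨_, g0, hg0, rfl⟩ ?_
      rintro r ⟨g, hg, rfl⟩
      have h2 := hmin (hnorm g hg)
      simp only [Set.mem_ofPred_eq, hDnorm, inv_pow] at h2
      rw [Real.sq_sqrt (var_pos h0 h1 hg).le] at h2
      rwa [div_eq_inv_mul]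
    · have := gap_mul_var_le h0 h1 f
      rwa [hvar, mul_one] at this
  refine ⟨f, hf0, ?_⟩
  funext η
  set g : Config A → ℝ := Pi.single η 1 with hg
  -- The form `dirichletForm - gap * var` is nonnegative and vanishes at `f`; along `f + s • g` it
  -- is a quadratic in `s` without constant term, so its linear coefficient must vanish.
  have hexp : ∀ s : ℝ, 0 ≤ s * (2 * mass p η * (-finGenerator p A f η - gap p A * f η))
      + s ^ 2 * (dirichletForm p A g - gap p A * var p g) := by
    intro s
    have h2 := gap_mul_var_le h0 h1 (f + s • g)
    have e1 : dirichletForm p A (f + s • g) = dirichletForm p A f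
        + s * (2 * mass p η * -finGenerator p A f η) + s ^ 2 * dirichletForm p A g := by
      have e2 := mean_single_mul (p := p) η (finGenerator p A f)
      have e3 := mean_mul_finGenerator_comm (p := p) f g
      have e4 : mean p (fun σ => f σ * finGenerator p A g σ) = mass p η * finGenerator p A f η := by
        rw [e3, ← e2]
        congr 1
        funext σ
        rw [mul_comm]
      have e5 : (fun σ => (f + s • g) σ * -finGenerator p A (f + s • g) σ)
          = fun σ => (f σ * -finGenerator p A f σ + s ^ 2 * (g σ * -finGenerator p A g σ))
            + ((-s) * (f σ * finGenerator p A g σ) + (-s) * (g σ * finGenerator p A f σ)) := by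
        funext σ
        rw [finGenerator_add, finGenerator_smul]
        simp only [Pi.add_apply, Pi.smul_apply, smul_eq_mul]
        ring
      rw [dirichletForm, e5, mean_add, mean_add, mean_add, mean_const_mul, mean_const_mul,
        mean_const_mul, e4, e2, dirichletForm, dirichletForm]
      ring
    have e6 : var p (f + s • g) = 1 + s * (2 * mass p η * f η) + s ^ 2 * var p g := by
      have e2 := mean_single_mul (p := p) η f
      have e7 : (fun σ => (f + s • g) σ ^ 2)
          = fun σ => (f σ ^ 2 + s ^ 2 * g σ ^ 2) + (2 * s) * (g σ * f σ) := by
        funext σ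
        simp only [Pi.add_apply, Pi.smul_apply, smul_eq_mul]
        ring
      have e8 : mean p (f + s • g) = s * mean p g := by
        have : (f + s • g) = fun σ => f σ + s * g σ := by funext σ; simp
        rw [this, mean_add, mean_const_mul, hfK.1, zero_add]
      rw [var, e7, mean_add, mean_add, mean_const_mul, mean_const_mul, e8, e2, hfK.2, var]
      ring
    rw [e1, e6, hgap] at h2
    linarith
  have hzero : 2 * mass p η * (-finGenerator p A f η - gap p A * f η) = 0 := by
    set b := 2 * mass p η * (-finGenerator p A f η - gap p A * f η)
    set a := dirichletForm p A g - gap p A * var p g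
    have ha : 0 ≤ a := by have := gap_mul_var_le h0 h1 g; linarith
    -- Dividing by `a + 1` also covers `a = 0`; the quadratic takes the value `-(b / (a + 1)) ^ 2`
    -- there.
    have h3 := hexp (-b / (a + 1))
    have ha1 : 0 < a + 1 := by linarith
    have h4 : -b / (a + 1) * b + (-b / (a + 1)) ^ 2 * a = -(b ^ 2 / (a + 1) ^ 2) := by
      field_simp
      ring
    rw [h4] at h3
    have h5 : 0 ≤ b ^ 2 / (a + 1) ^ 2 := by positivity
    have h6 : b ^ 2 / (a + 1) ^ 2 = 0 := by linarith
    rw [div_eq_zero_iff] at h6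
    rcases h6 with h6 | h6
    · exact pow_eq_zero_iff (two_ne_zero) |>.1 h6
    · exact absurd h6 (by positivity)
  have hm := (mass_pos h0 h1 η).ne'
  have h7 : -finGenerator p A f η - gap p A * f η = 0 := by
    rcases mul_eq_zero.1 hzero with h | h
    · exact absurd h (mul_ne_zero two_ne_zero hm)
    · exact h
  rw [Pi.smul_apply, smul_eq_mul]
  linarith

/-- A second moment argument. Let `F` be the sum of a sup-normalized gap eigenfunction over `N = k ^
m` independent subtrees, all started where it equals 1. At time `t` the mean of `F` is `exp (-g * t)
* N`, against fluctuations of order `√N`; a chain close to equilibrium in `L¹` cannot have such a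
mean unless `exp (-2 * g * t) * N ≤ 1`. -/
theorem le_of_mean_abs_le (hk : 2 ≤ k) (h0 : 0 < p) (h1 : p < 1) {m h L : ℕ} (hL : m + h = L)
    {t : ℝ} (ht : 0 ≤ t)
    (hmix : ∀ η : Config (tree k L), (mean p fun σ => |density p (tree k L) t η σ - 1|) ≤ 1 / 4) :
    m * Real.log 2 / 2 * relaxationTime p (tree k h) ≤ t := by
  obtain ⟨f₀, hf₀, heig₀⟩ := exists_eigenfunction (k := k) h0 h1 ⟨_, nil_mem_tree k h⟩
  set g := gap p (tree k h) with hg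
  have hg0 : 0 < g := gap_pos h0 h1 h
  obtain ⟨f, η₀, heig, hfη, hf1⟩ : ∃ (f : Config (tree k h) → ℝ) (η₀ : Config (tree k h)),
      finGenerator p (tree k h) f = (-g) • f ∧ f η₀ = 1 ∧ ∀ η, |f η| ≤ 1 := by
    obtain ⟨η₀, hη₀⟩ := Finite.exists_max fun η => |f₀ η|
    have hne : f₀ η₀ ≠ 0 := by
      intro h0'
      refine hf₀ (funext fun η => ?_)
      have := hη₀ η
      rw [h0', abs_zero] at this
      exact abs_nonpos_iff.1 this
    refine ⟨(f₀ η₀)⁻¹ • f₀, η₀, ?_, ?_, fun η => ?_⟩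
    · rw [finGenerator_smul, heig₀, smul_comm]
    · simp [hne]
    · rw [Pi.smul_apply, smul_eq_mul, abs_mul, abs_inv, ← div_eq_inv_mul,
        div_le_one (abs_pos.2 hne)]
      exact hη₀ η
  set S := level k m with hS
  have hSl : ∀ v ∈ S, v.length + h = L := fun v hv => by rw [mem_level.1 hv, hL]
  set N : ℝ := (S.card : ℝ) with hN
  set F : Config (tree k L) → ℝ := ∑ v ∈ S, fun ζ => f (proj h v ζ) with hF
  obtain ⟨η, hη⟩ : ∃ η : Config (tree k L), ∀ v ∈ S, proj h v η = η₀ := by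
    -- A site `y ++ v` with `v` on level `m` receives the spin of `y`; the spins above level `m` are
    -- irrelevant.
    refine ⟨fun x => zeroExt η₀ ((x : Vertex k).take ((x : Vertex k).length - m)),
      fun v hv => ?_⟩
    funext y
    have hmem := append_mem_tree (hSl v hv) y.2
    have hlen : ((y : Vertex k) ++ v).length - m = (y : Vertex k).length := by
      rw [List.length_append, mem_level.1 hv]; omega
    rw [proj, zeroExt, dif_pos hmem]
    simp only [hlen, List.take_left]
    simp [zeroExt]
  have heatF : ∀ s, heat p (tree k L) s F = Real.exp (-g * s) • F := by
    intro s
    rw [hF, heat_sum, Finset.smul_sum]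
    refine Finset.sum_congr rfl fun v hv => ?_
    funext ζ
    rw [heat_comp_proj (hSl v hv), heat_of_eigen heig]
    rfl
  have heatF2 : ∀ s, 0 ≤ s → ∀ ζ, heat p (tree k L) s (fun ζ => F ζ ^ 2) ζ
      ≤ Real.exp (-g * s) ^ 2 * F ζ ^ 2 + N := by
    intro s hs ζ
    have e1 : (fun ζ => F ζ ^ 2)
        = ∑ v ∈ S, ∑ w ∈ S, fun ζ => f (proj h v ζ) * f (proj h w ζ) := by
      funext ζ
      simp only [hF, Finset.sum_apply]
      rw [pow_two, Finset.sum_mul_sum]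
    have e2 : F ζ ^ 2 = ∑ v ∈ S, ∑ w ∈ S, f (proj h v ζ) * f (proj h w ζ) := by
      have := congrFun e1 ζ
      simpa using this
    have e3 : N = ∑ v ∈ S, ∑ w ∈ S, if v = w then (1 : ℝ) else 0 := by
      simp [hN]
    rw [e1, e2, e3, heat_sum, Finset.sum_apply, Finset.mul_sum, ← Finset.sum_add_distrib]
    refine Finset.sum_le_sum fun v hv => ?_
    rw [heat_sum, Finset.sum_apply, Finset.mul_sum, ← Finset.sum_add_distrib]
    refine Finset.sum_le_sum fun w hw => ?_
    by_cases hvw : v = w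
    · subst hvw
      rw [if_pos rfl]
      have h2 := heat_mono h0.le h1.le hs (A := tree k L)
        (f := fun ζ => f (proj h v ζ) * f (proj h v ζ)) (g := fun _ => 1) (fun ζ => by
          have := hf1 (proj h v ζ)
          rw [← abs_mul_abs_self]
          exact mul_le_one₀ this (abs_nonneg _) this) ζ
      rw [heat_const] at h2
      have h3 : 0 ≤ Real.exp (-g * s) ^ 2 * (f (proj h v ζ) * f (proj h v ζ)) :=
        mul_nonneg (sq_nonneg _) (mul_self_nonneg _)
      linarith
    · rw [if_neg hvw, add_zero]
      have h2 := heat_prod_proj (p := p) {v, w} (h := h) (L := L) (by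
        intro u hu
        simp only [Finset.mem_insert, Finset.mem_singleton] at hu
        rcases hu with rfl | rfl
        · exact hSl _ hv
        · exact hSl _ hw) (fun _ => f) s ζ
      simp only [Finset.prod_pair hvw] at h2
      rw [h2, heat_of_eigen heig]
      simp only [Pi.smul_apply, smul_eq_mul]
      exact le_of_eq (by ring)
  -- At this time the eigenfunction is halved. Invariance then gives `mean F = mean F / 2` and `mean
  -- F² ≤ mean F² / 4 + N`.
  set s₀ := Real.log 2 / g with hs₀
  have hs₀0 : 0 ≤ s₀ := div_nonneg (Real.log_nonneg (by norm_num)) hg0.le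
  have hexp0 : Real.exp (-g * s₀) = 1 / 2 := by
    have : -g * s₀ = -Real.log 2 := by rw [hs₀]; field_simp
    rw [this, Real.exp_neg, Real.exp_log (by norm_num)]
    norm_num
  have hmeanF : mean p F = 0 := by
    have h2 := mean_heat (p := p) s₀ F
    rw [heatF, hexp0] at h2
    have h3 : mean p ((1 / 2 : ℝ) • F) = 1 / 2 * mean p F := mean_const_mul _ _
    linarith
  have hmeanF2 : mean p (fun ζ => F ζ ^ 2) ≤ 4 / 3 * N := by
    have h2 := mean_heat (p := p) s₀ fun ζ => F ζ ^ 2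
    have h3 := mean_mono h0 h1 (heatF2 s₀ hs₀0)
    rw [h2, mean_add, mean_const_mul, mean_const, hexp0] at h3
    linarith
  have hFη : F η = N := by
    simp only [hF, Finset.sum_apply]
    rw [Finset.sum_congr rfl fun v hv => by rw [hη v hv, hfη]]
    simp [hN]
  set e := Real.exp (-g * t) with he
  have hlhs : mean p (fun σ => (density p (tree k L) t η σ - 1) * F σ) = e * N := by
    have e1 : (fun σ => (density p (tree k L) t η σ - 1) * F σ)
        = fun σ => density p (tree k L) t η σ * F σ - F σ := by funext σ; ring
    rw [e1, mean_sub, mean_density_mul h0 h1, heatF, hmeanF, Pi.smul_apply, hFη, smul_eq_mul,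
      sub_zero]
  -- Cauchy–Schwarz with weight `|density - 1|`, so that only its `L¹` norm is needed; the other
  -- factor is controlled by the second moments of `F` at time `t` and in equilibrium.
  have hcs : mean p (fun σ => (density p (tree k L) t η σ - 1) * F σ) ^ 2
      ≤ (mean p fun σ => |density p (tree k L) t η σ - 1|)
        * mean p fun σ => |density p (tree k L) t η σ - 1| * F σ ^ 2 := by
    refine Finset.sum_sq_le_sum_mul_sum_of_sq_le_mul _
      (fun σ _ => mul_nonneg (mass_pos h0 h1 σ).le (abs_nonneg _))
      (fun σ _ => mul_nonneg (mass_pos h0 h1 σ).le (mul_nonneg (abs_nonneg _) (sq_nonneg _)))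
      fun σ _ => ?_
    have := abs_mul_abs_self (density p (tree k L) t η σ - 1)
    linear_combination (-(mass p σ ^ 2 * F σ ^ 2)) * this
  have hsecond : mean p (fun σ => |density p (tree k L) t η σ - 1| * F σ ^ 2)
      ≤ (e ^ 2 * N ^ 2 + N) + 4 / 3 * N := by
    have h2 : mean p (fun σ => |density p (tree k L) t η σ - 1| * F σ ^ 2)
        ≤ mean p (fun σ => density p (tree k L) t η σ * F σ ^ 2 + F σ ^ 2) := by
      refine mean_mono h0 h1 fun σ => ?_
      have hd : 0 ≤ density p (tree k L) t η σ :=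
        div_nonneg (lawAt_nonneg h0.le h1.le _ ht _ _) (mass_pos h0 h1 σ).le
      have h3 : |density p (tree k L) t η σ - 1| ≤ density p (tree k L) t η σ + 1 := by
        rw [abs_le]; constructor <;> linarith
      have := mul_le_mul_of_nonneg_right h3 (sq_nonneg (F σ))
      linarith
    rw [mean_add, mean_density_mul h0 h1] at h2
    have h4 := heatF2 t ht η
    rw [hFη] at h4
    linarith
  have hN1 : 0 < N := by
    rw [hN, hS, card_level']
    have : 0 < k ^ m := pow_pos (by omega) m
    exact_mod_cast this
  have hnn : 0 ≤ mean p (fun σ => |density p (tree k L) t η σ - 1| * F σ ^ 2) :=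
    mean_nonneg h0 h1 fun σ => mul_nonneg (abs_nonneg _) (sq_nonneg _)
  have hfinal : e ^ 2 * N ≤ 1 := by
    rw [hlhs] at hcs
    have h2 := mul_le_mul_of_nonneg_right (hmix η) hnn
    have h3 : (e * N) ^ 2 ≤ 1 / 4 * ((e ^ 2 * N ^ 2 + N) + 4 / 3 * N) := by linarith
    have h4 : (e ^ 2 * N) * N ≤ 1 * N := by nlinarith
    exact le_of_mul_le_mul_right h4 hN1
  have hlog : Real.log N ≤ 2 * g * t := by
    have h2 : Real.log (e ^ 2 * N) ≤ 0 := Real.log_nonpos (by positivity) hfinal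
    rw [Real.log_mul (by positivity) hN1.ne', Real.log_pow, he, Real.log_exp] at h2
    push_cast at h2
    linarith
  have hlogN : m * Real.log 2 ≤ Real.log N := by
    rw [hN, hS, card_level']
    push_cast
    rw [Real.log_pow]
    refine mul_le_mul_of_nonneg_left (Real.log_le_log (by norm_num) ?_) (Nat.cast_nonneg m)
    exact_mod_cast hk
  rw [relaxationTime, ← div_eq_mul_inv, div_le_iff₀ hg0]
  linarith

/-- The comparison of mixing times and relaxation times. -/
theorem mixingTime_comparison (hk : 2 ≤ k) {δ : ℝ} (hδ : 0 < δ) :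
    ∃ c : ℝ, 0 < c ∧ ∀ p : ℝ, δ ≤ p → p ≤ 1 - δ → ∀ L : ℕ, 1 ≤ L →
      1 / c * L * relaxationTime p (tree k (L / 2)) ≤ mixingTime 1 p (tree k L) ∧
      mixingTime 1 p (tree k L) ≤ mixingTime 2 p (tree k L) ∧
      mixingTime 2 p (tree k L) ≤ c * L * relaxationTime p (tree k L) := by
  obtain ⟨c, hc, hc2⟩ : ∃ c : ℝ, 8 ≤ c ∧ Real.exp (-(2 * c)) * ((17 / 16) ^ k / δ) ≤ 1 / 16 := by
    -- Since `c ≤ exp (2 * c)`, it is enough that `c` exceeds 16 times the constant lost per level.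
    refine ⟨max 8 (16 * ((17 / 16) ^ k / δ)), le_max_left _ _, ?_⟩
    set c := max 8 (16 * ((17 / 16) ^ k / δ)) with hc
    have h1 : 16 * ((17 / 16) ^ k / δ) ≤ c := le_max_right _ _
    have h2 : (8 : ℝ) ≤ c := le_max_left _ _
    have h3 : c ≤ Real.exp (2 * c) := by
      have := Real.add_one_le_exp (2 * c); linarith
    rw [Real.exp_neg, inv_mul_le_iff₀ (Real.exp_pos _)]
    linarith
  refine ⟨2 * c, by linarith, fun p hp hp' L hL => ?_⟩
  have h0 : 0 < p := by linarith
  have h1 : p < 1 := by linarith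
  have hL' : (1 : ℝ) ≤ L := by exact_mod_cast hL
  have hT := relaxationTime_pos (k := k) h0 h1 L
  have hT2 := relaxationTime_pos (k := k) h0 h1 (L / 2)
  have ht0 : 0 ≤ c * (L + 1) * relaxationTime p (tree k L) := by positivity
  have hsq := sqDist_le (k := k) h0 h1 hδ hp hp' (by linarith) hc2 L
  obtain ⟨h12, h2⟩ := mixingTime_two_le h0 h1 ht0 hsq
  refine ⟨?_, h12, h2.trans ?_⟩
  · refine le_csInf ⟨c * (L + 1) * relaxationTime p (tree k L), ht0, fun η => ?_⟩ ?_
    · rw [rpow_one_mean]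
      exact mean_abs_le h0 h1 (hsq η)
    · rintro t ⟨ht, htm⟩
      simp only [rpow_one_mean] at htm
      -- The upper half of the levels supplies the independent copies, the lower half their depth.
      have h3 := le_of_mean_abs_le hk h0 h1 (m := L - L / 2) (h := L / 2) (by omega) ht htm
      refine le_trans (mul_le_mul_of_nonneg_right ?_ hT2.le) h3
      have hm : (L : ℝ) ≤ 2 * ((L - L / 2 : ℕ) : ℝ) := by
        exact_mod_cast (by omega : L ≤ 2 * (L - L / 2))
      have hlog : (1 / 2 : ℝ) ≤ Real.log 2 := by
        have := Real.log_two_gt_d9; linarith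
      have h4 : 1 / (2 * c) ≤ 1 / 16 := one_div_le_one_div_of_le (by norm_num) (by linarith)
      have h5 : 1 / (2 * c) * (L : ℝ) ≤ 1 / 16 * L := mul_le_mul_of_nonneg_right h4 (by linarith)
      have h6 : ((L - L / 2 : ℕ) : ℝ) * (1 / 2) ≤ ((L - L / 2 : ℕ) : ℝ) * Real.log 2 :=
        mul_le_mul_of_nonneg_left hlog (Nat.cast_nonneg _)
      linarith
  · refine mul_le_mul_of_nonneg_right ?_ hT.le
    nlinarith

/-! ### Local functions on the infinite tree -/

section Local

variable {k : ℕ}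

theorem dependsOn_eq_comp_restrict {A : Finset (Vertex k)} {f : (Vertex k → Bool) → ℝ}
    (hf : DependsOn f (A : Set (Vertex k))) :
    f = (fun η : Config A => f (zeroExt η)) ∘ A.restrict :=
  (lift_zeroExt hf).symm

theorem measurable_of_dependsOn {A : Finset (Vertex k)} {f : (Vertex k → Bool) → ℝ}
    (hf : DependsOn f (A : Set (Vertex k))) : Measurable f := by
  rw [dependsOn_eq_comp_restrict hf]
  exact (Measurable.of_discrete).comp (Finset.measurable_restrict A)

instance (u : unitInterval) : IsProbabilityMeasure (productLaw k u) := by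
  unfold productLaw; infer_instance

theorem memLp_of_dependsOn (u : unitInterval) {A : Finset (Vertex k)}
    {f : (Vertex k → Bool) → ℝ} (hf : DependsOn f (A : Set (Vertex k))) (q : ENNReal) :
    MemLp f q (productLaw k u) := by
  obtain ⟨C, hC⟩ := (Set.finite_range fun η : Config A => ‖f (zeroExt η)‖).bddAbove
  refine MemLp.of_bound (measurable_of_dependsOn hf).aestronglyMeasurable C
    (Eventually.of_forall fun ω => ?_)
  rw [dependsOn_eq_comp_restrict hf]
  exact hC ⟨_, rfl⟩

theorem bernoulliMeasure_real_singleton (u : unitInterval) (b : Bool) :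
    (bernoulliMeasure true false u).real {b} = weight u b := by
  cases b <;> simp [weight]

/-- Expectations of local functions under the product law. -/
theorem integral_eq_avg (u : unitInterval) {A : Finset (Vertex k)}
    {f : (Vertex k → Bool) → ℝ} (hf : DependsOn f (A : Set (Vertex k))) (ω : Vertex k → Bool) :
    ∫ ω, f ω ∂productLaw k u = avg (u : ℝ) A f ω := by
  conv_rhs => rw [← lift_zeroExt hf]
  rw [← mean_eq_avg]
  conv_lhs => rw [dependsOn_eq_comp_restrict hf]
  simp only [Function.comp_apply]
  have e : ∫ ω, f (zeroExt (A.restrict ω)) ∂productLaw k u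
      = ∫ η : Config A, f (zeroExt η) ∂(productLaw k u).map A.restrict :=
    (integral_map (f := fun η : Config A => f (zeroExt η))
      (Finset.measurable_restrict (X := fun _ : Vertex k => Bool) A).aemeasurable
      Measurable.of_discrete.aestronglyMeasurable).symm
  rw [e, productLaw, Measure.infinitePi_map_restrict, integral_fintype Integrable.of_finite, mean]
  refine Finset.sum_congr rfl fun η _ => ?_
  rw [smul_eq_mul, measureReal_def, Measure.pi_singleton, ENNReal.toReal_prod, mass]
  congr 1
  exact Finset.prod_congr rfl fun x _ => bernoulliMeasure_real_singleton u (η x)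

theorem sq_toReal_eLpNorm_two {u : unitInterval} {f : (Vertex k → Bool) → ℝ}
    (hf : MemLp f 2 (productLaw k u)) :
    (eLpNorm f 2 (productLaw k u)).toReal ^ 2 = ∫ ω, f ω ^ 2 ∂productLaw k u := by
  rw [hf.eLpNorm_eq_integral_rpow_norm (by simp) (by simp)]
  have h : 0 ≤ ∫ ω, f ω ^ 2 ∂productLaw k u := integral_nonneg fun ω => sq_nonneg _
  simp only [ENNReal.toReal_ofNat, Real.rpow_two, Real.norm_eq_abs, sq_abs]
  rw [ENNReal.toReal_ofReal (by positivity), ← Real.rpow_natCast, ← Real.rpow_mul h]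
  norm_num

theorem tendsto_integral_sq {u : unitInterval} {f : ℕ → (Vertex k → Bool) → ℝ}
    (hf : ∀ n, MemLp (f n) 2 (productLaw k u))
    (h : Tendsto (fun n => eLpNorm (f n) 2 (productLaw k u)) atTop (𝓝 0)) :
    Tendsto (fun n => ∫ ω, f n ω ^ 2 ∂productLaw k u) atTop (𝓝 0) := by
  have := ((ENNReal.tendsto_toReal ENNReal.zero_ne_top).comp h).pow 2
  simpa [sq_toReal_eLpNorm_two (hf _)] using this

theorem constraint_eq_cons {L : ℕ} {x : Vertex k} (hx : x ∈ tree k L) :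
    constraint x = cons (tree k (L + 1)) x := by
  funext ω
  rw [mem_tree] at hx
  have : ∀ i : Fin k, i :: x ∈ tree k (L + 1) := fun i => mem_tree.2 (by simpa using hx)
  simp only [constraint, cons, this, forall_true_left]

theorem tree_subset {L M : ℕ} (h : L ≤ M) : tree k L ⊆ tree k M := fun x hx => by
  rw [mem_tree] at hx ⊢; omega

theorem dependsOn_tree_mono {L M : ℕ} (h : L ≤ M) {f : (Vertex k → Bool) → ℝ}
    (hf : DependsOn f (tree k L : Set (Vertex k))) : DependsOn f (tree k M : Set (Vertex k)) :=
  dependsOn_mono hf (by exact_mod_cast tree_subset h)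

theorem IsLocal.exists_tree {f : (Vertex k → Bool) → ℝ} (hf : IsLocal f) :
    ∃ L, DependsOn f (tree k L : Set (Vertex k)) := by
  obtain ⟨A, hA⟩ := hf
  refine ⟨A.sup List.length, dependsOn_mono hA fun x hx => ?_⟩
  exact Finset.mem_coe.2 (mem_tree.2 (Finset.le_sup (f := List.length) hx))

theorem siteMean_sub_eq (p : ℝ) (x : Vertex k) (f : (Vertex k → Bool) → ℝ) :
    siteMean p x f - f = (fun ω => p - occ x ω) * grad x f := by
  funext ω
  have h : Function.update ω x (ω x) = ω := Function.update_eq_self x ω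
  simp only [siteMean_eq, Pi.sub_apply, Pi.mul_apply, grad, occ]
  cases hx : ω x
  · rw [hx] at h; rw [h]; simp; ring
  · rw [hx] at h; rw [h]; simp; ring

theorem generator_eq_sum (p : ℝ) {L : ℕ} {f : (Vertex k → Bool) → ℝ}
    (hf : DependsOn f (tree k L : Set (Vertex k))) :
    generator p f = ∑ x ∈ tree k L, cons (tree k (L + 1)) x * (siteMean p x f - f) := by
  funext ω
  rw [generator, tsum_eq_sum (s := tree k L), Finset.sum_apply]
  · refine Finset.sum_congr rfl fun x hx => ?_
    rw [constraint_eq_cons hx]; rfl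
  · intro x hx
    have := congrFun (siteMean_sub_eq p x f) ω
    rw [grad_eq_zero hf (by exact_mod_cast hx), mul_zero] at this
    simp only [Pi.sub_apply, Pi.zero_apply] at this
    rw [this, mul_zero]

theorem generator_dependsOn (p : ℝ) {L : ℕ} {f : (Vertex k → Bool) → ℝ}
    (hf : DependsOn f (tree k L : Set (Vertex k))) :
    DependsOn (generator p f) (tree k (L + 1) : Set (Vertex k)) := by
  rw [generator_eq_sum p hf]
  have hf' := dependsOn_tree_mono (Nat.le_succ L) hf
  refine dependsOn_sum _ fun x _ => dependsOn_mul (cons_dependsOn _ x) ?_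
  exact dependsOn_comp₂ (dependsOn_mono (siteMean_dependsOn hf' x) Set.sdiff_subset) hf'
    (· - ·)

/-- The Dirichlet form of a local function. -/
theorem avg_mul_generator (p : ℝ) {L : ℕ} {f : (Vertex k → Bool) → ℝ}
    (hf : DependsOn f (tree k L : Set (Vertex k))) (ω : Vertex k → Bool) :
    avg p (tree k (L + 1)) (f * -generator p f) ω
      = ∑ x ∈ tree k (L + 1), energy p (tree k (L + 1)) x f ω := by
  have e : f * -generator p f
      = ∑ x ∈ tree k L, f * (cons (tree k (L + 1)) x * (f - siteMean p x f)) := by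
    rw [generator_eq_sum p hf, ← Finset.sum_neg_distrib, Finset.mul_sum]
    refine Finset.sum_congr rfl fun x _ => ?_
    ring
  rw [e, avg_sum, Finset.sum_apply, ← Finset.sum_subset (tree_subset (Nat.le_succ L))]
  · refine Finset.sum_congr rfl fun x hx => ?_
    rw [avg_mul_sub_siteMean (tree_subset (Nat.le_succ L) hx), energy, pow_two]
    rfl
  · intro x _ hx
    rw [energy, grad_eq_zero hf (by exact_mod_cast hx)]
    simp [avg_zero]

/-- The Poincaré inequality together with Cauchy–Schwarz for the pairing of `f` with its image. When
`C` does not depend on `L`, vanishing images under the generator force vanishing variances along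
bounded sequences. -/
theorem sq_vr_le {p C : ℝ} (h0 : 0 ≤ p) (h1 : p ≤ 1) {L : ℕ}
    (hP : Poincare p (tree k (L + 1)) C) {f : (Vertex k → Bool) → ℝ}
    (hf : DependsOn f (tree k L : Set (Vertex k))) (ω : Vertex k → Bool) :
    vr p (tree k (L + 1)) f ω ^ 2
      ≤ C ^ 2 * (avg p (tree k (L + 1)) (f ^ 2) ω
        * avg p (tree k (L + 1)) (generator p f ^ 2) ω) := by
  have h := hP f ω
  rw [← avg_mul_generator p hf] at h
  have h2 := sq_avg_mul_le h0 h1 (tree k (L + 1)) f (-generator p f) ω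
  rw [neg_sq] at h2
  calc vr p (tree k (L + 1)) f ω ^ 2
      ≤ (C * avg p (tree k (L + 1)) (f * -generator p f) ω) ^ 2 :=
        pow_le_pow_left₀ (vr_nonneg h0 h1 _ f ω) h 2
    _ = C ^ 2 * avg p (tree k (L + 1)) (f * -generator p f) ω ^ 2 := by ring
    _ ≤ _ := mul_le_mul_of_nonneg_left h2 (sq_nonneg C)

/-- A spectral gap that is uniform in the depth makes the kernel of the generator trivial. -/
theorem zeroIsSimple_of_poincare {u : unitInterval} {C : ℝ}
    (hP : ∀ L, Poincare (u : ℝ) (tree k L) C) : ZeroIsSimple k u := by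
  rintro f ⟨hf, g, hg, hgf, hgen⟩
  choose L hL using fun n => (hg n).exists_tree
  have hL' := fun n => dependsOn_tree_mono (Nat.le_succ (L n)) (hL n)
  have mg := fun n => memLp_of_dependsOn u (hL n) 2
  have h1 := tendsto_integral_sq (fun n => (mg n).sub hf) hgf
  have h2 := tendsto_integral_sq
    (fun n => memLp_of_dependsOn u (generator_dependsOn (u : ℝ) (hL n)) 2) hgen
  have hsq := hf.integrable_sq
  have hgsq := fun n => (mg n).integrable_sq
  have hdsq := fun n => ((mg n).sub hf).integrable_sq
  let ω₀ : Vertex k → Bool := fun _ => false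
  set a : ℕ → ℝ := fun n => ∫ ω, g n ω ∂productLaw k u with ha
  set v : ℕ → ℝ := fun n => ∫ ω, (g n ω - a n) ^ 2 ∂productLaw k u with hv
  have hvr : ∀ n, v n = vr u (tree k (L n + 1)) (g n) ω₀ := by
    intro n
    have e : v n = variance (g n) (productLaw k u) :=
      (variance_eq_integral (mg n).1.aemeasurable).symm
    rw [e, variance_eq_sub (mg n), vr, Pi.sub_apply, Pi.pow_apply,
      ← integral_eq_avg u (hL' n) ω₀, ← integral_eq_avg u (dependsOn_pow (hL' n) 2) ω₀]
  have hbound : ∀ n, ∫ ω, g n ω ^ 2 ∂productLaw k u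
      ≤ 2 * (∫ ω, f ω ^ 2 ∂productLaw k u) + 2 * ∫ ω, (g n - f) ω ^ 2 ∂productLaw k u := by
    intro n
    rw [← integral_const_mul, ← integral_const_mul, ← integral_add (hsq.const_mul 2)
      ((hdsq n).const_mul 2)]
    refine integral_mono (hgsq n) ((hsq.const_mul 2).add ((hdsq n).const_mul 2)) fun ω => ?_
    simp only [Pi.sub_apply]
    nlinarith [sq_nonneg (2 * f ω - g n ω)]
  have hv0 : Tendsto v atTop (𝓝 0) := by
    have hlim : Tendsto (fun n => √(C ^ 2 * ((2 * (∫ ω, f ω ^ 2 ∂productLaw k u)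
        + 2 * ∫ ω, (g n - f) ω ^ 2 ∂productLaw k u)
        * ∫ ω, generator (u : ℝ) (g n) ω ^ 2 ∂productLaw k u))) atTop (𝓝 0) := by
      have := ((((h1.const_mul 2).const_add (2 * ∫ ω, f ω ^ 2 ∂productLaw k u)).mul
        h2).const_mul (C ^ 2)).sqrt
      simpa using this
    refine squeeze_zero (fun n => integral_nonneg fun ω => sq_nonneg _) (fun n => ?_) hlim
    refine Real.le_sqrt_of_sq_le ?_
    rw [hvr]
    refine (sq_vr_le u.2.1 u.2.2 (hP _) (hL n) ω₀).trans ?_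
    rw [← integral_eq_avg u (dependsOn_pow (hL' n) 2) ω₀,
      ← integral_eq_avg u (dependsOn_pow (generator_dependsOn (u : ℝ) (hL n)) 2) ω₀]
    simp only [Pi.pow_apply]
    exact mul_le_mul_of_nonneg_left (mul_le_mul_of_nonneg_right (hbound n)
      (integral_nonneg fun ω => sq_nonneg _)) (sq_nonneg C)
  -- The variance of `f` is at most its mean squared distance to `a n`, hence at most twice the
  -- squared `L²` distance of `g n` to `f` plus twice the variance of `g n`; both tend to zero.
  have hvar : variance f (productLaw k u) = 0 := by
    refine le_antisymm ?_ (variance_nonneg _ _)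
    refine ge_of_tendsto' (by simpa using (h1.const_mul 2).add (hv0.const_mul 2)) fun n => ?_
    rw [← variance_sub_const hf.1 (a n)]
    have hdm : MemLp (fun ω => g n ω - a n) 2 (productLaw k u) :=
      (mg n).sub (memLp_const (a n))
    have hfm : MemLp (fun ω => f ω - a n) 2 (productLaw k u) := hf.sub (memLp_const (a n))
    refine (variance_le_expectation_sq hfm.1).trans ?_
    change _ ≤ 2 * (∫ ω, (g n - f) ω ^ 2 ∂productLaw k u)
      + 2 * ∫ ω, (g n ω - a n) ^ 2 ∂productLaw k u
    rw [← integral_const_mul, ← integral_const_mul,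
      ← integral_add ((hdsq n).const_mul 2) (hdm.integrable_sq.const_mul 2)]
    refine integral_mono hfm.integrable_sq
      (((hdsq n).const_mul 2).add (hdm.integrable_sq.const_mul 2)) fun ω => ?_
    simp only [Pi.sub_apply, Pi.pow_apply]
    nlinarith [sq_nonneg (2 * g n ω - f ω - a n)]
  refine ⟨∫ ω, f ω ∂productLaw k u, (evariance_eq_zero_iff hf.1.aemeasurable).1 ?_⟩
  rw [← ofReal_variance hf, hvar, ENNReal.ofReal_zero]

end Local

/-! ### Supercritical densities -/

section Supercritical

variable {k : ℕ} {p : ℝ}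

/-- The centred spins of level `n` are independent of each other and of all coefficients, so the
cross terms vanish; each of the `k ^ n` diagonal terms is at most the probability `p ^ n` that the
strict ancestors are occupied. It serves both the martingale increments and the images under the
generator. -/
theorem avg_level_sum_sq_le (h0 : 0 ≤ p) (h1 : p ≤ 1) {n N : ℕ} (hN : n ≤ N)
    (G : Vertex k → (Vertex k → Bool) → ℝ)
    (hG : ∀ x ∈ level k n, DependsOn (G x) {y : Vertex k | y.length ≠ n})
    (hG0 : ∀ x, 0 ≤ G x) (hG1 : ∀ x, G x ≤ occProd ((pathTo x).erase x)) (ω : Vertex k → Bool) :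
    avg p (tree k N) ((∑ x ∈ level k n, G x * fun ω => occ x ω - p) ^ 2) ω ≤ (k * p) ^ n := by
  have hmem : ∀ x ∈ level k n, x ∈ tree k N := fun x hx =>
    mem_tree.2 ((mem_level.1 hx).le.trans hN)
  have hocc : ∀ x : Vertex k, DependsOn (fun ω => occ x ω - p) ({x} : Set (Vertex k)) :=
    fun x => dependsOn_comp₂ (occ_dependsOn x) (occ_dependsOn x) fun a _ => a - p
  have hmean : ∀ x ∈ level k n, avg p (tree k N) (fun ω => occ x ω - p) = 0 := by
    intro x hx
    have e : (fun ω : Vertex k → Bool => occ x ω - p) = occ x - fun _ => p := rfl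
    rw [e, avg_sub, avg_occ (hmem x hx), avg_const]
    funext ω; simp
  have hoff : ∀ x ∈ level k n, ∀ y ∈ level k n, x ≠ y → avg p (tree k N)
      ((G x * fun ω => occ x ω - p) * (G y * fun ω => occ y ω - p)) = 0 := by
    intro x hx y hy hxy
    have e : (G x * fun ω => occ x ω - p) * (G y * fun ω => occ y ω - p)
        = (fun ω => occ x ω - p) * (G x * (G y * fun ω => occ y ω - p)) := by ring
    have hne : ∀ z ∈ level k n, DependsOn (G z) ((({x} : Finset (Vertex k)) : Set (Vertex k))ᶜ) :=
      fun z hz => dependsOn_mono (hG z hz) fun w hw => by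
        simp only [Finset.coe_singleton, Set.mem_compl_iff, Set.mem_singleton_iff]
        rintro rfl
        exact hw (mem_level.1 hx)
    rw [e, avg_mul_of_disjoint (S := {x}) (by simpa using hmem x hx) (by simpa using hocc x),
      hmean x hx, zero_mul]
    refine dependsOn_mul (hne x hx) (dependsOn_mul (hne y hy) (dependsOn_mono (hocc y) ?_))
    simpa using hxy
  have hdiag : ∀ x ∈ level k n, avg p (tree k N)
      ((G x * fun ω => occ x ω - p) * (G x * fun ω => occ x ω - p)) ω ≤ p ^ n := by
    intro x hx
    have hle : (G x * fun ω => occ x ω - p) * (G x * fun ω => occ x ω - p)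
        ≤ occProd ((pathTo x).erase x) := by
      intro ω
      have a0 := hG0 x ω
      have a1 := hG1 x ω
      have a2 : occProd ((pathTo x).erase x) ω ^ 2 = occProd ((pathTo x).erase x) ω :=
        congrFun (occProd_sq _) ω
      have b : (occ x ω - p) ^ 2 ≤ 1 := by
        unfold occ; split_ifs <;> nlinarith
      simp only [Pi.zero_apply] at a0
      simp only [Pi.mul_apply]
      calc G x ω * (occ x ω - p) * (G x ω * (occ x ω - p))
          = G x ω ^ 2 * (occ x ω - p) ^ 2 := by ring
        _ ≤ G x ω ^ 2 * 1 := mul_le_mul_of_nonneg_left b (sq_nonneg _)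
        _ ≤ occProd ((pathTo x).erase x) ω ^ 2 := by
          rw [mul_one]; exact pow_le_pow_left₀ a0 a1 2
        _ = _ := a2
    refine (avg_mono h0 h1 hle ω).trans_eq ?_
    rw [avg_occProd_of_subset, Finset.card_erase_of_mem (self_mem_pathTo x), card_pathTo,
      mem_level.1 hx, Nat.add_sub_cancel]
    intro y hy
    have := (mem_pathTo.1 (Finset.mem_of_mem_erase hy)).length_le
    rw [mem_level] at hx
    exact mem_tree.2 (by omega)
  rw [pow_two, Finset.sum_mul_sum, avg_sum, Finset.sum_apply]
  calc ∑ x ∈ level k n, avg p (tree k N) (∑ y ∈ level k n,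
        (G x * fun ω => occ x ω - p) * (G y * fun ω => occ y ω - p)) ω
      = ∑ x ∈ level k n, avg p (tree k N)
        ((G x * fun ω => occ x ω - p) * (G x * fun ω => occ x ω - p)) ω := by
        refine Finset.sum_congr rfl fun x hx => ?_
        rw [avg_sum, Finset.sum_apply]
        refine Finset.sum_eq_single x (fun y hy hyx => ?_) (fun h => absurd hx h)
        rw [hoff x hx y hy hyx.symm]; rfl
    _ ≤ ∑ _x ∈ level k n, p ^ n := Finset.sum_le_sum hdiag
    _ = (k * p) ^ n := by
        rw [Finset.sum_const, card_level', nsmul_eq_mul, mul_pow]; push_cast; rfl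

/-- The number of vertices of level `n` in the occupied cluster of the root. -/
def levelCount (k n : ℕ) : (Vertex k → Bool) → ℝ := ∑ x ∈ level k n, occProd (pathTo x)

theorem levelCount_dependsOn (k n : ℕ) :
    DependsOn (levelCount k n) (tree k n : Set (Vertex k)) := by
  refine dependsOn_sum _ fun x hx => dependsOn_mono (occProd_dependsOn _) fun y hy => ?_
  have := (mem_pathTo.1 (Finset.mem_coe.1 hy)).length_le
  rw [mem_level] at hx
  exact Finset.mem_coe.2 (mem_tree.2 (by omega))

theorem sum_level_succ {M : Type*} [AddCommMonoid M] (n : ℕ) (h : Vertex k → M) :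
    ∑ y ∈ level k (n + 1), h y.tail = k • ∑ x ∈ level k n, h x := by
  have : ∑ y ∈ level k (n + 1), h y.tail
      = ∑ q ∈ (Finset.univ : Finset (Fin k)) ×ˢ level k n, h q.2 := by
    symm
    refine Finset.sum_bij (fun q _ => q.1 :: q.2) ?_ ?_ ?_ ?_
    · intro q hq
      simp only [Finset.mem_product, Finset.mem_univ, true_and, mem_level] at hq
      simp [mem_level, hq]
    · rintro ⟨i, x⟩ _ ⟨j, y⟩ _ h
      simpa using h
    · intro y hy
      rw [mem_level] at hy
      obtain ⟨i, x, rfl⟩ := List.exists_cons_of_length_eq_add_one hy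
      exact ⟨(i, x), by simpa [mem_level] using hy, rfl⟩
    · intro q _; rfl
  rw [this, Finset.sum_product]
  simp

theorem pathTo_erase {n : ℕ} {y : Vertex k} (hy : y.length = n + 1) :
    (pathTo y).erase y = pathTo y.tail := by
  obtain ⟨i, x, rfl⟩ := List.exists_cons_of_length_eq_add_one hy
  ext z
  simp only [Finset.mem_erase, mem_pathTo, List.suffix_cons_iff, List.tail_cons]
  constructor
  · rintro ⟨h1, h2 | h2⟩
    · exact absurd h2 h1
    · exact h2
  · intro h
    refine ⟨?_, Or.inr h⟩
    rintro rfl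
    have := h.length_le
    simp at this

theorem occProd_erase_mul (x : Vertex k) :
    occProd ((pathTo x).erase x) * occ x = occProd (pathTo x) :=
  Finset.prod_erase_mul _ _ (self_mem_pathTo x)

theorem levelCount_succ_sub (p : ℝ) (n : ℕ) :
    levelCount k (n + 1) - (k * p) • levelCount k n
      = ∑ x ∈ level k (n + 1), occProd ((pathTo x).erase x) * fun ω => occ x ω - p := by
  have e : ∀ x ∈ level k (n + 1), (occProd ((pathTo x).erase x) * fun ω => occ x ω - p)
      = occProd (pathTo x) - p • occProd (pathTo x.tail) := by
    intro x hx
    rw [← pathTo_erase (mem_level.1 hx), ← occProd_erase_mul x]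
    funext ω
    simp only [Pi.mul_apply, Pi.sub_apply, Pi.smul_apply, smul_eq_mul]
    ring
  rw [Finset.sum_congr rfl e, Finset.sum_sub_distrib, ← Finset.smul_sum,
    sum_level_succ n fun x => occProd (pathTo x), levelCount, levelCount,
    ← Nat.cast_smul_eq_nsmul ℝ, smul_smul, mul_comm p]

theorem cons_mul_occProd_eq_zero {L : ℕ} {x z : Vertex k} (hz : z.length ≤ L)
    (hxz : x <:+ z) (hne : x ≠ z) : cons (tree k L) x * occProd ((pathTo z).erase x) = 0 := by
  obtain ⟨w, rfl⟩ := hxz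
  have hw : w ≠ [] := by rintro rfl; exact hne rfl
  obtain ⟨w', i, rfl⟩ : ∃ w' i, w = w' ++ [i] := ⟨_, _, (List.dropLast_append_getLast hw).symm⟩
  have hsuf : i :: x <:+ w' ++ [i] ++ x := ⟨w', by simp⟩
  have hmem : i :: x ∈ (pathTo (w' ++ [i] ++ x)).erase x :=
    Finset.mem_erase.2 ⟨by simp, mem_pathTo.2 hsuf⟩
  funext ω
  simp only [Pi.mul_apply, Pi.zero_apply, occProd, Finset.prod_apply]
  by_cases h : ω (i :: x) = true
  · rw [cons, if_neg, zero_mul]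
    intro h'
    rw [h' i (mem_tree.2 (hsuf.length_le.trans hz))] at h
    exact absurd h (by simp)
  · rw [Finset.prod_eq_zero hmem, mul_zero]
    simp [occ, h]

/-- A strict ancestor of `z` that matters to `z` must have an occupied child on the path, and is
then frozen. Only sites of level `n` itself contribute. -/
theorem generator_levelCount (p : ℝ) (n : ℕ) :
    generator p (levelCount k n) = -∑ x ∈ level k n,
      (cons (tree k (n + 1)) x * occProd ((pathTo x).erase x)) * fun ω => occ x ω - p := by
  have hsub : level k n ⊆ tree k n := fun x hx => mem_tree.2 (mem_level.1 hx).le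
  have e : ∀ x, cons (tree k (n + 1)) x * (siteMean p x (levelCount k n) - levelCount k n)
      = ∑ z ∈ level k n, (fun ω => p - occ x ω)
        * (cons (tree k (n + 1)) x * grad x (occProd (pathTo z))) := by
    intro x
    rw [siteMean_sub_eq, levelCount, grad_sum, ← Finset.mul_sum, ← Finset.mul_sum]
    ring
  have e0 : ∀ x, ∀ z ∈ level k n, x ≠ z →
      cons (tree k (n + 1)) x * grad x (occProd (pathTo z)) = 0 := by
    intro x z hz hxz
    by_cases h : x ∈ pathTo z
    · rw [grad_occProd_of_mem h]
      exact cons_mul_occProd_eq_zero ((mem_level.1 hz).le.trans (Nat.le_succ n))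
        (mem_pathTo.1 h) hxz
    · rw [grad_occProd_of_notMem h, mul_zero]
  rw [generator_eq_sum p (levelCount_dependsOn k n), Finset.sum_congr rfl fun x _ => e x,
    Finset.sum_comm, ← Finset.sum_neg_distrib]
  refine Finset.sum_congr rfl fun z hz => ?_
  rw [Finset.sum_eq_single z]
  · rw [grad_occProd_of_mem (self_mem_pathTo z)]
    funext ω
    simp only [Pi.mul_apply, Pi.neg_apply]
    ring
  · intro x _ hx
    rw [e0 x z hz hx, mul_zero]
  · exact fun h => absurd (hsub hz) h

/-- The normalized size of level `n` of the occupied cluster of the root. -/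
def branchingMartingale (k : ℕ) (p : ℝ) (n : ℕ) : (Vertex k → Bool) → ℝ :=
  ((k * p) ^ n)⁻¹ • levelCount k n

theorem dependsOn_smul {V : Type} {f : (V → Bool) → ℝ} {S : Set V} (hf : DependsOn f S) (c : ℝ) :
    DependsOn (c • f) S := dependsOn_comp₂ hf hf fun a _ => c * a

theorem branchingMartingale_dependsOn (k : ℕ) (p : ℝ) (n : ℕ) :
    DependsOn (branchingMartingale k p n) (tree k n : Set (Vertex k)) :=
  dependsOn_smul (levelCount_dependsOn k n) _

theorem avg_smul_sq (A : Finset (Vertex k)) (c : ℝ) (f : (Vertex k → Bool) → ℝ)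
    (ω : Vertex k → Bool) : avg p A ((c • f) ^ 2) ω = c ^ 2 * avg p A (f ^ 2) ω := by
  rw [smul_pow, avg_smul]; rfl

theorem pathTo_erase_dependsOn {n : ℕ} {x : Vertex k} (hx : x ∈ level k n) :
    DependsOn (occProd ((pathTo x).erase x)) {y : Vertex k | y.length ≠ n} := by
  refine dependsOn_mono (occProd_dependsOn _) fun y hy => ?_
  have hy' := Finset.mem_erase.1 (Finset.mem_coe.1 hy)
  intro h
  exact hy'.1 ((mem_pathTo.1 hy'.2).eq_of_length (h.trans (mem_level.1 hx).symm))

theorem occProd_nonneg {V : Type} (s : Finset V) : 0 ≤ occProd s := by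
  intro ω
  rw [occProd, Finset.prod_apply]
  exact Finset.prod_nonneg fun y _ => by unfold occ; split_ifs <;> simp

theorem avg_sq_martingale_sub_le (h0 : 0 ≤ p) (h1 : p ≤ 1) (hkp : 0 < k * p) (n : ℕ)
    (ω : Vertex k → Bool) :
    avg p (tree k (n + 1)) ((branchingMartingale k p (n + 1) - branchingMartingale k p n) ^ 2) ω
      ≤ ((k * p) ^ (n + 1))⁻¹ := by
  have e : branchingMartingale k p (n + 1) - branchingMartingale k p n
      = ((k * p) ^ (n + 1))⁻¹ • ∑ x ∈ level k (n + 1),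
        occProd ((pathTo x).erase x) * fun ω => occ x ω - p := by
    rw [← levelCount_succ_sub, branchingMartingale, branchingMartingale, smul_sub, smul_smul]
    congr 2
    rw [pow_succ, mul_inv, mul_assoc, inv_mul_cancel₀ hkp.ne', mul_one]
  rw [e, avg_smul_sq]
  have := avg_level_sum_sq_le h0 h1 (le_refl (n + 1)) (fun x => occProd ((pathTo x).erase x))
    (fun x hx => pathTo_erase_dependsOn hx) (fun x => occProd_nonneg _) (fun x => le_rfl) ω
  refine (mul_le_mul_of_nonneg_left this (sq_nonneg _)).trans_eq ?_
  have : (k * p) ^ (n + 1) ≠ 0 := (pow_pos hkp _).ne'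
  field_simp

/-- The image of the level count has squared norm at most `(k * p) ^ n`, against a squared
normalization of `(k * p) ^ (2 * n)`; for `k * p > 1` the bound tends to zero. -/
theorem avg_sq_generator_martingale_le (h0 : 0 ≤ p) (h1 : p ≤ 1) (hkp : 0 < k * p) (n : ℕ)
    (ω : Vertex k → Bool) :
    avg p (tree k (n + 1)) (generator p (branchingMartingale k p n) ^ 2) ω
      ≤ ((k * p) ^ n)⁻¹ := by
  have e : generator p (branchingMartingale k p n)
      = ((k * p) ^ n)⁻¹ • generator p (levelCount k n) := by
    rw [generator_eq_sum p (branchingMartingale_dependsOn k p n),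
      generator_eq_sum p (levelCount_dependsOn k n), Finset.smul_sum]
    refine Finset.sum_congr rfl fun x _ => ?_
    funext ω
    simp only [branchingMartingale, Pi.mul_apply, Pi.sub_apply, Pi.smul_apply, smul_eq_mul,
      siteMean_eq]
    ring
  rw [e, avg_smul_sq, generator_levelCount, neg_sq]
  have := avg_level_sum_sq_le h0 h1 (Nat.le_succ n)
    (fun x => cons (tree k (n + 1)) x * occProd ((pathTo x).erase x))
    (fun x hx => dependsOn_mul (by
      intro ω ω' h
      simp only [cons]
      have : ∀ i : Fin k, ω (i :: x) = ω' (i :: x) := fun i => h _ (by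
        simp [mem_level.1 hx])
      simp only [this]) (pathTo_erase_dependsOn hx))
    (fun x => mul_nonneg (cons_nonneg _ x) (occProd_nonneg _))
    (fun x ω => mul_le_of_le_one_left (occProd_nonneg _ ω) (cons_le_one _ x ω)) ω
  refine (mul_le_mul_of_nonneg_left this (sq_nonneg _)).trans_eq ?_
  have : (k * p) ^ n ≠ 0 := (pow_pos hkp _).ne'
  field_simp

theorem avg_levelCount_mul_occ_nil (n : ℕ) (ω : Vertex k → Bool) :
    avg p (tree k n) (levelCount k n * fun ω => occ [] ω - p) ω
      = p * (1 - p) * (k * p) ^ n := by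
  have hsub : ∀ x ∈ level k n, pathTo x ⊆ tree k n := fun x hx y hy =>
    mem_tree.2 ((mem_pathTo.1 hy).length_le.trans (mem_level.1 hx).le)
  have e : (levelCount k n * fun ω => occ [] ω - p) = (1 - p) • levelCount k n := by
    rw [levelCount, Finset.sum_mul, Finset.smul_sum]
    refine Finset.sum_congr rfl fun x _ => ?_
    have h : occProd (pathTo x) = occ [] * occProd ((pathTo x).erase []) :=
      (Finset.mul_prod_erase _ _ (mem_pathTo.2 List.nil_suffix)).symm
    funext ω
    have := congrFun (occ_sq ([] : Vertex k)) ω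
    simp only [h, Pi.mul_apply, Pi.smul_apply, Pi.pow_apply, smul_eq_mul] at this ⊢
    linear_combination occProd ((pathTo x).erase []) ω * this
  rw [e, avg_smul, levelCount, avg_sum, Pi.smul_apply, Finset.sum_apply,
    Finset.sum_congr rfl fun x hx => congrFun (avg_occProd_of_subset (hsub x hx)) ω,
    Finset.sum_congr rfl (g := fun _ => p ^ (n + 1)) fun x hx => by
      rw [card_pathTo, mem_level.1 hx], Finset.sum_const, card_level', nsmul_eq_mul, smul_eq_mul]
  push_cast
  rw [mul_pow, pow_succ]
  ring

theorem avg_martingale_mul_occ_nil (hkp : 0 < k * p) (n : ℕ) (ω : Vertex k → Bool) :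
    avg p (tree k n) (branchingMartingale k p n * fun ω => occ [] ω - p) ω = p * (1 - p) := by
  rw [branchingMartingale, smul_mul_assoc, avg_smul, Pi.smul_apply,
    avg_levelCount_mul_occ_nil, smul_eq_mul]
  have : (k * p) ^ n ≠ 0 := (pow_pos hkp _).ne'
  field_simp

/-- The covariance with the root spin is `p * (1 - p)` for every `n`, so by Cauchy–Schwarz the
martingale stays away from all constants, and so does its limit. -/
theorem le_avg_sq_martingale_sub_const (h0 : 0 ≤ p) (h1 : p ≤ 1) (hkp : 0 < k * p) (n : ℕ) (a : ℝ)
    (ω : Vertex k → Bool) :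
    (p * (1 - p)) ^ 2
      ≤ avg p (tree k n) ((branchingMartingale k p n - fun _ => a) ^ 2) ω := by
  have hnil : avg p (tree k n) (fun ω => occ ([] : Vertex k) ω - p) = 0 := by
    have e : (fun ω : Vertex k → Bool => occ [] ω - p) = occ [] - fun _ => p := rfl
    rw [e, avg_sub, avg_occ (nil_mem_tree k n), avg_const]
    funext ω; simp
  have e : avg p (tree k n) ((branchingMartingale k p n - fun _ => a)
      * fun ω => occ [] ω - p) ω = p * (1 - p) := by
    have : ((branchingMartingale k p n - fun _ => a) * fun ω => occ [] ω - p)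
        = (branchingMartingale k p n * fun ω => occ [] ω - p) - a • fun ω => occ [] ω - p := by
      funext ω
      simp only [Pi.mul_apply, Pi.sub_apply, Pi.smul_apply, smul_eq_mul]
      ring
    rw [this, avg_sub, avg_smul, hnil, smul_zero, sub_zero, avg_martingale_mul_occ_nil hkp]
  have hcs := sq_avg_mul_le h0 h1 (tree k n) (branchingMartingale k p n - fun _ => a)
    (fun ω => occ [] ω - p) ω
  rw [e] at hcs
  refine hcs.trans (mul_le_of_le_one_right
    (avg_nonneg h0 h1 (f := (branchingMartingale k p n - fun _ => a) ^ 2)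
      (fun ω => sq_nonneg _) ω) ?_)
  have hle : (fun ω : Vertex k → Bool => occ [] ω - p) ^ 2 ≤ 1 := by
    intro ω
    simp only [Pi.pow_apply, Pi.one_apply, occ]
    split_ifs <;> nlinarith
  have := avg_mono h0 h1 (A := tree k n) hle ω
  rwa [avg_one] at this

theorem not_zeroIsSimple {u : unitInterval} (hu : 1 < k * (u : ℝ)) (hu1 : (u : ℝ) < 1) :
    ¬ ZeroIsSimple k u := by
  intro hs
  set p : ℝ := (u : ℝ) with hp
  have h0 : 0 ≤ p := u.2.1
  have h1 : p ≤ 1 := u.2.2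
  have hkp : 0 < k * p := by linarith
  have hp0 : 0 < p := lt_of_le_of_ne h0 fun h => by rw [← h] at hkp; simp at hkp
  set W := branchingMartingale k p with hW
  let ω₀ : Vertex k → Bool := fun _ => false
  have hd := branchingMartingale_dependsOn k p
  have hm : ∀ n, MemLp (W n) 2 (productLaw k u) := fun n => memLp_of_dependsOn u (hd n) 2
  -- The common geometric rate of the increments and of the images under the generator in `L²`.
  set r : ℝ := √((k * p)⁻¹) with hr
  have hr1 : r < 1 := by
    rw [hr, Real.sqrt_lt' one_pos, one_pow]
    exact inv_lt_one_of_one_lt₀ hu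
  have hrn : ∀ n, (r ^ n) ^ 2 = ((k * p) ^ n)⁻¹ := by
    intro n
    rw [← pow_mul, mul_comm, pow_mul, hr, Real.sq_sqrt (inv_pos.2 hkp).le, inv_pow]
  have hnorm : ∀ (f : (Vertex k → Bool) → ℝ) (N : ℕ) (s : ℝ), 0 ≤ s →
      DependsOn f (tree k N : Set (Vertex k)) → avg p (tree k N) (f ^ 2) ω₀ ≤ s ^ 2 →
      (eLpNorm f 2 (productLaw k u)).toReal ≤ s := by
    intro f N s hs0 hf h
    refine abs_le_of_sq_le_sq' ?_ hs0 |>.2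
    rw [sq_toReal_eLpNorm_two (memLp_of_dependsOn u hf 2)]
    exact (integral_eq_avg u (dependsOn_pow hf 2) ω₀).trans_le h
  have hstep : ∀ n, dist ((hm n).toLp (W n)) ((hm (n + 1)).toLp (W (n + 1))) ≤ 1 * r ^ n := by
    intro n
    rw [dist_comm, dist_eq_norm, ← MemLp.toLp_sub, Lp.norm_toLp, one_mul]
    refine hnorm _ (n + 1) _ (by positivity) (dependsOn_comp₂ (hd (n + 1))
      (dependsOn_tree_mono (Nat.le_succ n) (hd n)) (· - ·)) ?_
    refine (avg_sq_martingale_sub_le h0 h1 hkp n ω₀).trans ?_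
    rw [hrn]
    exact inv_anti₀ (pow_pos hkp n) (pow_le_pow_right₀ hu.le (Nat.le_succ n))
  obtain ⟨F, hFm, hconv⟩ : ∃ F : (Vertex k → Bool) → ℝ, MemLp F 2 (productLaw k u) ∧
      Tendsto (fun n => eLpNorm (W n - F) 2 (productLaw k u)) atTop (𝓝 0) := by
    obtain ⟨F, hF⟩ := cauchySeq_tendsto_of_complete (cauchySeq_of_le_geometric r 1 hr1 hstep)
    refine ⟨F, Lp.memLp F, ?_⟩
    rw [← Lp.toLp_coeFn F (Lp.memLp F)] at hF
    exact (Lp.tendsto_Lp_iff_tendsto_eLpNorm'' W hm F (Lp.memLp F)).1 hF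
  have hker : InKernel u F := by
    refine ⟨hFm, W, fun n => ⟨_, hd n⟩, hconv, ?_⟩
    have hg := fun n => generator_dependsOn p (hd n)
    have hgm := fun n => memLp_of_dependsOn u (hg n) 2
    rw [← ENNReal.tendsto_toReal_iff (fun n => (hgm n).2.ne) ENNReal.zero_ne_top]
    refine squeeze_zero (fun n => ENNReal.toReal_nonneg) (fun n => hnorm _ (n + 1) (r ^ n)
      (by positivity) (hg n) ?_) (tendsto_pow_atTop_nhds_zero_of_lt_one (Real.sqrt_nonneg _) hr1)
    rw [hrn]
    exact avg_sq_generator_martingale_le h0 h1 hkp n ω₀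
  obtain ⟨a, ha⟩ := hs F hker
  have hconst : Tendsto (fun n => eLpNorm (W n - fun _ => a) 2 (productLaw k u)) atTop (𝓝 0) := by
    refine hconv.congr fun n => eLpNorm_congr_ae ?_
    filter_upwards [ha] with ω hω
    simp [hω]
  have hda : ∀ n, DependsOn (W n - fun _ => a) (tree k n : Set (Vertex k)) := fun n =>
    dependsOn_comp₂ (hd n) (hd n) fun b _ => b - a
  have hlim := tendsto_integral_sq (fun n => memLp_of_dependsOn u (hda n) 2) hconst
  have hge : (p * (1 - p)) ^ 2 ≤ 0 := ge_of_tendsto' hlim fun n => by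
    have := le_avg_sq_martingale_sub_const h0 h1 hkp n a ω₀
    rwa [← integral_eq_avg u (dependsOn_pow (hda n) 2) ω₀] at this
  have : 0 < p * (1 - p) := mul_pos hp0 (by linarith)
  exact absurd hge (not_le.2 (pow_pos this 2))

/-- Below `1 / k` the Poincaré constant is uniform in the depth, above it the martingale limit lies
in the kernel. The density `1 / k` itself need not be decided for a supremum. -/
theorem criticalDensity_eq (hk : 2 ≤ k) : criticalDensity k = 1 / k := by
  have hk' : (2 : ℝ) ≤ k := by exact_mod_cast hk
  have hk0 : (0 : ℝ) < k := by linarith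
  refine csSup_eq_of_forall_le_of_forall_lt_exists_gt ?_ ?_ ?_
  · have hP := poincare_subcritical hk (le_refl (0 : ℝ)) (by positivity) one_pos (by simp)
    exact ⟨0, 0, rfl, one_pos, zeroIsSimple_of_poincare (u := 0) hP⟩
  · rintro p ⟨u, rfl, hu1, hu⟩
    by_contra h
    rw [not_le, div_lt_iff₀ hk0] at h
    exact not_zeroIsSimple (by linarith) hu1 hu
  · intro q hq
    obtain ⟨p, hp1, hp2⟩ := exists_between (max_lt hq (by positivity : (0 : ℝ) < 1 / k))
    have hp0 : 0 ≤ p := (le_max_right _ _).trans hp1.le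
    have hp3 : p < 1 := hp2.trans (by rw [div_lt_one hk0]; linarith)
    have hP := poincare_subcritical hk hp0 hp2 (pow_pos (by linarith : (0 : ℝ) < 1 - p) k) le_rfl
    exact ⟨p, ⟨⟨p, hp0, hp3.le⟩, rfl, hp3, zeroIsSimple_of_poincare (u := ⟨p, hp0, hp3.le⟩) hP⟩,
      (le_max_left _ _).trans_lt hp1⟩

end Supercritical

/-! ### Relaxation times up to the critical density -/

section Relaxation

variable {k : ℕ} {p : ℝ}

/-- Up to the critical density `p ≤ 1 / 2`, so `s = (1 / 2) ^ k` can be used throughout and the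
constants depend on `k` only. -/
theorem half_pow_le (hk : 2 ≤ k) (hp : p ≤ 1 / k) : (1 / 2 : ℝ) ^ k ≤ (1 - p) ^ k := by
  have hk' : (2 : ℝ) ≤ k := by exact_mod_cast hk
  have : (1 : ℝ) / k ≤ 1 / 2 := one_div_le_one_div_of_le two_pos hk'
  exact pow_le_pow_left₀ (by norm_num) (by linarith) k

theorem relaxationTime_critical_le (hk : 2 ≤ k) : ∃ c : ℝ, 0 < c ∧ ∀ L : ℕ, 1 ≤ L →
    relaxationTime (1 / k) (tree k L) ≤ c * (L : ℝ) ^ 150 := by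
  have hk' : (2 : ℝ) ≤ k := by exact_mod_cast hk
  have h0 : (0 : ℝ) < 1 / k := by positivity
  have h1 : (1 : ℝ) / k < 1 := by rw [div_lt_one (by linarith)]; linarith
  have hP := slabPoincare_critical hk h0.le le_rfl (s := (1 / 2) ^ k) (by positivity)
    (half_pow_le hk le_rfl)
  generalize hD : ((((1 / 2 : ℝ) ^ k) ^ 2)⁻¹ * (2 + ((1 / 2 : ℝ) ^ k)⁻¹)) ^ 12 = D at hP
  have hD0 : 0 < D := by rw [← hD]; positivity
  refine ⟨D * 2 ^ 150, by positivity, fun L hL => ?_⟩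
  have hL' : (1 : ℝ) ≤ L := by exact_mod_cast hL
  have hL1 : (0 : ℝ) < (L : ℝ) + 1 := by linarith
  have h := relaxationTime_le h0 h1 ⟨_, nil_mem_tree k L⟩ (mul_pos hD0 (pow_pos hL1 150))
    (by simpa only [slab_zero] using hP L 0)
  refine h.trans ?_
  rw [mul_assoc, ← mul_pow]
  exact mul_le_mul_of_nonneg_left (pow_le_pow_left₀ hL1.le (by linarith) 150) hD0.le

theorem relaxationTime_subcritical_le (hk : 2 ≤ k) : ∃ c : ℝ, 0 < c ∧ ∀ p : ℝ, 0 < p → p < 1 / k →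
    ∀ L : ℕ, relaxationTime p (tree k L) ≤ c * ((1 / k - p) ^ 302)⁻¹ := by
  have hk' : (2 : ℝ) ≤ k := by exact_mod_cast hk
  have hk0 : (0 : ℝ) < k := by linarith
  refine ⟨4 * 17 ^ 151 * ((((1 / 2 : ℝ) ^ k) ^ 2)⁻¹ * (2 + ((1 / 2 : ℝ) ^ k)⁻¹)) ^ 12,
    by positivity, fun p h0 hp L => ?_⟩
  have h1 : p < 1 := hp.trans_le (by rw [div_le_one hk0]; linarith)
  have hP := poincare_subcritical hk h0.le hp (s := (1 / 2) ^ k) (by positivity)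
    (half_pow_le hk hp.le) L
  generalize hD : 4 * (17 : ℝ) ^ 151 * ((((1 / 2 : ℝ) ^ k) ^ 2)⁻¹
    * (2 + ((1 / 2 : ℝ) ^ k)⁻¹)) ^ 12 = D at hP ⊢
  have hD0 : 0 < D := by rw [← hD]; positivity
  have hd : 0 < 1 / k - p := by linarith
  have hkd : 1 - k * p = k * (1 / k - p) := by field_simp
  have hle : 1 / k - p ≤ 1 - k * p := by rw [hkd]; exact le_mul_of_one_le_left hd.le (by linarith)
  refine (relaxationTime_le h0 h1 ⟨_, nil_mem_tree k L⟩
    (mul_pos hD0 (inv_pos.2 (pow_pos (hd.trans_le hle) 302))) hP).trans ?_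
  exact mul_le_mul_of_nonneg_left (inv_anti₀ (pow_pos hd 302)
    (pow_le_pow_left₀ hd.le hle 302)) hD0.le

theorem le_relaxationTime_critical (hk : 2 ≤ k) (L : ℕ) :
    (L : ℝ) ^ 2 / 96 ≤ relaxationTime (1 / k) (tree k (L / 2)) := by
  have hk' : (2 : ℝ) ≤ k := by exact_mod_cast hk
  have h := relaxationTime_ge hk (p := 1 / k) (by positivity) le_rfl (L / 2) fun n _ => by
    rw [mul_one_div_cancel (by linarith), one_pow]; norm_num
  refine le_trans ?_ h
  have : (L : ℝ) ≤ 2 * (((L / 2 : ℕ) : ℝ) + 1) := by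
    have : L ≤ 2 * (L / 2 + 1) := by omega
    exact_mod_cast this
  have h2 := pow_le_pow_left₀ (Nat.cast_nonneg L) this 2
  linarith

/-- A bound from depth zero is enough when the constant may depend on `p`. -/
theorem le_relaxationTime_subcritical (hk : 2 ≤ k) (h0 : 0 < p) (hp : p < 1 / k) (L : ℕ) :
    1 / 24 ≤ relaxationTime p (tree k L) := by
  have hk' : (2 : ℝ) ≤ k := by exact_mod_cast hk
  have h1 : p < 1 := hp.trans_le (by rw [div_le_one (by linarith)]; linarith)
  have h := relaxationTime_ge hk h0 hp.le 0 fun n hn => by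
    rw [Nat.le_zero.1 hn, pow_zero]; norm_num
  refine le_trans ?_ (h.trans (relaxationTime_mono h0 h1 (Nat.zero_le L)))
  norm_num

/-- Up to the depth `M`, about `1 / (2 * k * d)`, the tree looks critical: `(1 - k * d) ^ n ≥ 1 / 2`
by Bernoulli's inequality. The assumption on `L` guarantees that `M ≤ L / 2`. -/
theorem le_relaxationTime_near_critical (hk : 2 ≤ k) (h0 : 0 < p) (hp : p < 1 / k) {L : ℕ}
    (hL : 1 / (1 / k - p) ≤ L) :
    ((1 / k - p) ^ 2)⁻¹ / (96 * k ^ 2) ≤ relaxationTime p (tree k (L / 2)) := by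
  have hk' : (2 : ℝ) ≤ k := by exact_mod_cast hk
  have hk0 : (0 : ℝ) < k := by linarith
  have h1 : p < 1 := hp.trans_le (by rw [div_le_one hk0]; linarith)
  set d := 1 / k - p with hd
  have hd0 : 0 < d := by rw [hd]; linarith
  have hkd : k * p = 1 - k * d := by rw [hd]; field_simp; ring
  have hkp : 0 < k * p := mul_pos hk0 h0
  set M := ⌊1 / (2 * (k * d))⌋₊ with hM
  have hpos : 0 < 1 / (2 * (k * d)) := by positivity
  have hM1 : (M : ℝ) ≤ 1 / (2 * (k * d)) := Nat.floor_le hpos.le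
  have hM2 : 1 / (2 * (k * d)) ≤ M + 1 := (Nat.lt_floor_add_one _).le
  have hpow : ∀ n ≤ M, 1 / 2 ≤ (k * p) ^ n := by
    intro n hn
    have hb := one_add_mul_le_pow (a := -(k * d)) (by linarith) n
    have hn' : (n : ℝ) * (2 * (k * d)) ≤ 1 := by
      rw [← le_div_iff₀ (by positivity)]
      exact le_trans (by exact_mod_cast hn) hM1
    rw [hkd, sub_eq_add_neg]
    linarith
  have hML : M ≤ L / 2 := by
    rw [Nat.le_div_iff_mul_le two_pos]
    have : (M : ℝ) * 2 ≤ L := by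
      refine le_trans ?_ hL
      rw [le_div_iff₀ hd0]
      rw [le_div_iff₀ (by positivity)] at hM1
      have : 0 ≤ (M : ℝ) * d := by positivity
      nlinarith
    exact_mod_cast this
  refine le_trans ?_ ((relaxationTime_ge hk h0 hp.le M hpow).trans (relaxationTime_mono h0 h1 hML))
  have h2 := pow_le_pow_left₀ hpos.le hM2 2
  have e : (d ^ 2)⁻¹ / (96 * k ^ 2) = (1 / (2 * (k * d))) ^ 2 / 24 := by
    field_simp; norm_num
  rw [e]
  linarith

end Relaxation

end

end OFA

/-! ### The main theorem: combining the comparison with the relaxation time bounds -/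

theorem theorem3 :
    ∃ α β : ℝ, 0 ≤ α ∧ 0 ≤ β ∧ ∀ k : ℕ, 2 ≤ k →
      -- the general comparison, with a constant that is locally uniform in the density
      (∀ δ : ℝ, 0 < δ → ∃ c : ℝ, 0 < c ∧ ∀ p : ℝ, δ ≤ p → p ≤ 1 - δ → ∀ L : ℕ, 1 ≤ L →
        1 / c * L * OFA.relaxationTime p (OFA.tree k (L / 2))
            ≤ OFA.mixingTime 1 p (OFA.tree k L) ∧
        OFA.mixingTime 1 p (OFA.tree k L) ≤ OFA.mixingTime 2 p (OFA.tree k L) ∧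
        OFA.mixingTime 2 p (OFA.tree k L)
            ≤ c * L * OFA.relaxationTime p (OFA.tree k L)) ∧
      -- the critical density
      (∃ c : ℝ, 0 < c ∧ ∀ L : ℕ, 1 ≤ L →
        c⁻¹ * (L : ℝ) ^ 3 ≤ OFA.mixingTime 1 (OFA.criticalDensity k) (OFA.tree k L) ∧
        OFA.mixingTime 1 (OFA.criticalDensity k) (OFA.tree k L) ≤ c * (L : ℝ) ^ (3 + β)) ∧
      -- subcritical densities, for each density and all depths
      (∀ p : ℝ, 0 < p → p < OFA.criticalDensity k → ∃ c : ℝ, 0 < c ∧ ∀ L : ℕ, 1 ≤ L →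
        1 / c * (OFA.criticalDensity k - p) ^ (-2 : ℝ) * L
            ≤ OFA.mixingTime 1 p (OFA.tree k L) ∧
        OFA.mixingTime 1 p (OFA.tree k L)
            ≤ c * L * (OFA.criticalDensity k - p) ^ (-(2 + α))) ∧
      -- subcritical densities, with a constant that is uniform up to the critical density
      (∀ δ : ℝ, 0 < δ → ∃ c : ℝ, 0 < c ∧
        ∀ p : ℝ, δ ≤ p → p < OFA.criticalDensity k → ∀ L : ℕ, 1 ≤ L →
          (1 / (OFA.criticalDensity k - p) ≤ L →
            1 / c * (OFA.criticalDensity k - p) ^ (-2 : ℝ) * L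
              ≤ OFA.mixingTime 1 p (OFA.tree k L)) ∧
          OFA.mixingTime 1 p (OFA.tree k L)
              ≤ c * L * (OFA.criticalDensity k - p) ^ (-(2 + α))) := by
  have rpow_neg_two : ∀ x : ℝ, 0 < x → x ^ (-2 : ℝ) = (x ^ 2)⁻¹ := fun x hx => by
    rw [Real.rpow_neg hx.le]; norm_cast
  have rpow_neg_alpha : ∀ x : ℝ, 0 < x → x ^ (-(2 + 300) : ℝ) = (x ^ 302)⁻¹ := fun x hx => by
    rw [Real.rpow_neg hx.le]; norm_num
  -- The exponents are `302 = 2 + 300` below criticality and, with one more factor `L` from the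
  -- comparison, `1 + 150 = 3 + 148` at criticality.
  refine ⟨300, 148, by norm_num, by norm_num, fun k hk => ?_⟩
  have hk' : (2 : ℝ) ≤ k := by exact_mod_cast hk
  have hk0 : (0 : ℝ) < k := by linarith
  have hk2 : (1 : ℝ) / k ≤ 1 / 2 := one_div_le_one_div_of_le two_pos hk'
  have hk3 : (0 : ℝ) < 1 / k := by positivity
  rw [OFA.criticalDensity_eq hk]
  obtain ⟨B, hB0, hB⟩ := OFA.relaxationTime_subcritical_le hk
  have upper : ∀ c : ℝ, 0 < c → ∀ p : ℝ, 0 < p → p < 1 / k → ∀ L : ℕ, ∀ t : ℝ,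
      t ≤ c * L * OFA.relaxationTime p (OFA.tree k L) →
      ∀ c', c * B ≤ c' → t ≤ c' * L * (1 / k - p) ^ (-(2 + 300) : ℝ) := by
    intro c hc p h0 hp L t ht c' hc'
    have hd : 0 < 1 / k - p := by linarith
    rw [rpow_neg_alpha _ hd]
    have hinv : 0 < ((1 / k - p) ^ 302)⁻¹ := inv_pos.2 (pow_pos hd 302)
    have h := hB p h0 hp L
    generalize ((1 / k - p) ^ 302)⁻¹ = y at h hinv ⊢
    calc t ≤ c * L * OFA.relaxationTime p (OFA.tree k L) := ht
      _ ≤ c * L * (B * y) := mul_le_mul_of_nonneg_left h (by positivity)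
      _ = (c * B) * (L * y) := by ring
      _ ≤ c' * (L * y) := mul_le_mul_of_nonneg_right hc' (by positivity)
      _ = c' * L * y := by ring
  refine ⟨fun δ hδ => OFA.mixingTime_comparison hk hδ, ?_, ?_, ?_⟩
  · obtain ⟨c, hc, h⟩ := OFA.mixingTime_comparison hk hk3
    obtain ⟨D, hD0, hD⟩ := OFA.relaxationTime_critical_le hk
    -- A sum dominates both constants that are needed; the same device is used in the remaining
    -- cases.
    refine ⟨c * D + 96 * c, by positivity, fun L hL => ?_⟩
    obtain ⟨h1, h2, h3⟩ := h (1 / k) le_rfl (by linarith) L hL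
    have hL' : (0 : ℝ) < L := by exact_mod_cast hL
    constructor
    · refine le_trans ?_ h1
      have hlow := OFA.le_relaxationTime_critical hk L
      calc (c * D + 96 * c)⁻¹ * (L : ℝ) ^ 3 ≤ (96 * c)⁻¹ * (L : ℝ) ^ 3 :=
            mul_le_mul_of_nonneg_right (inv_anti₀ (by positivity)
              (le_add_of_nonneg_left (by positivity))) (by positivity)
        _ = 1 / c * L * ((L : ℝ) ^ 2 / 96) := by field_simp
        _ ≤ _ := mul_le_mul_of_nonneg_left hlow (by positivity)
    · have e : (L : ℝ) ^ ((3 : ℝ) + 148) = L * (L : ℝ) ^ 150 := by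
        rw [← pow_succ', ← Real.rpow_natCast]; norm_num
      have hup := hD L hL
      rw [e]
      have hpow : 0 < (L : ℝ) ^ 150 := pow_pos hL' 150
      generalize (L : ℝ) ^ 150 = y at hup hpow ⊢
      calc _ ≤ c * L * OFA.relaxationTime (1 / k) (OFA.tree k L) := h2.trans h3
        _ ≤ c * L * (D * y) := mul_le_mul_of_nonneg_left hup (by positivity)
        _ = (c * D) * (L * y) := by ring
        _ ≤ (c * D + 96 * c) * (L * y) := mul_le_mul_of_nonneg_right
            (le_add_of_nonneg_right (by positivity)) (by positivity)
  · intro p h0 hp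
    have hd : 0 < 1 / k - p := by linarith
    -- The comparison is used with `δ = p`, as the constant may depend on `p`; the factor `(1 / k -
    -- p) ^ (-2)` of the lower bound is likewise put into the constant.
    obtain ⟨c, hc, h⟩ := OFA.mixingTime_comparison hk h0
    refine ⟨c * B + 24 * c * ((1 / k - p) ^ 2)⁻¹, by positivity, fun L hL => ?_⟩
    obtain ⟨h1, h2, h3⟩ := h p le_rfl (by linarith) L hL
    refine ⟨le_trans ?_ h1, upper c hc p h0 hp L _ (h2.trans h3) _
      (le_add_of_nonneg_right (by positivity))⟩
    have hlow := OFA.le_relaxationTime_subcritical hk h0 hp (L / 2)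
    rw [rpow_neg_two _ hd]
    have hy : 0 < ((1 / k - p) ^ 2)⁻¹ := by positivity
    generalize ((1 / k - p) ^ 2)⁻¹ = y at hy ⊢
    calc 1 / (c * B + 24 * c * y) * y * L ≤ 1 / (24 * c * y) * y * L := by
          gcongr
          exact le_add_of_nonneg_left (by positivity)
      _ = 1 / c * L * (1 / 24) := by field_simp
      _ ≤ _ := mul_le_mul_of_nonneg_left hlow (by positivity)
  · intro δ hδ
    -- With `min δ (1 / 2)` the condition `p ≤ 1 - δ` of the comparison is automatic, because `p < 1
    -- / k ≤ 1 / 2`.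
    obtain ⟨c, hc, h⟩ := OFA.mixingTime_comparison hk (lt_min hδ one_half_pos)
    refine ⟨c * B + 96 * k ^ 2 * c, by positivity, fun p hδp hp L hL => ?_⟩
    have h0 : 0 < p := hδ.trans_le hδp
    have hd : 0 < 1 / k - p := by linarith
    obtain ⟨h1, h2, h3⟩ := h p ((min_le_left _ _).trans hδp)
      (by linarith [min_le_right δ (1 / 2)]) L hL
    refine ⟨fun hLd => le_trans ?_ h1, upper c hc p h0 hp L _ (h2.trans h3) _
      (le_add_of_nonneg_right (by positivity))⟩
    have hlow := OFA.le_relaxationTime_near_critical hk h0 hp hLd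
    rw [rpow_neg_two _ hd]
    have hy : 0 < ((1 / k - p) ^ 2)⁻¹ := by positivity
    generalize ((1 / k - p) ^ 2)⁻¹ = y at hy hlow ⊢
    calc 1 / (c * B + 96 * k ^ 2 * c) * y * L ≤ 1 / (96 * k ^ 2 * c) * y * L := by
          gcongr
          exact le_add_of_nonneg_left (by positivity)
      _ = 1 / c * L * (y / (96 * k ^ 2)) := by field_simp
      _ ≤ _ := mul_le_mul_of_nonneg_left hlow (by positivity)
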